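/- **Setting.** All function spaces are over $\mathbb{R}_+=(0,\infty)$ with Lebesgue measure, with real or complex values. For $\alpha\ge -1/2$ and $\lambda,x>0$ let $\psi^{\alpha}_\lambda(x)=\sqrt{x\lambda}\,J_\alpha(x\lambda)$, where $J_\alpha$ is the Bessel function of the first kind, and let $\mathcal H_\alpha$ be the Hankel transform on $L^2(\mathbb R_+)$, $$\mathcal H_\alpha f(\lambda)=\int_0^\infty \psi^\alpha_\lambda(x)f(x)\,dx$$ (the integral being the $L^2$-limit of $\int_0^R$ as $R\to\infty$). The heat semigroup of the Bessel operator $-\frac{d^2}{dx^2}+\frac{1}{x^2}\left(\alpha^2-\frac14\right)$ (in the self-adjoint realization diagonalized by $\mathcal H_\alpha$) is $$T^{\alpha,\psi}_tf=\mathcal H_\alpha\big(e^{-t(\cdot)^2}\mathcal H_\alpha f\big),\qquad f\in L^2(\mathbb R_+),\ t\ge 0 .$$ It is extended to $L^1(\mathbb R_+)+L^\infty(\mathbb R_+)$ by $T^{\alpha,\psi}_0=\mathrm{Id}$ and, for $t>0$, $$T^{\alpha,\psi}_tf(x)=\int_0^\infty G_t^{\alpha,\psi}(x,y)f(y)\,dy,\qquad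 G^{\alpha,\psi}_t(x,y)=\int_0^\infty e^{-t\lambda^2}\psi^\alpha_\lambda(x)\psi^\alpha_\lambda(y)\,d\lambda .$$ A *symmetric diffusion semigroup* is a family $\{T_t\}_{t\ge0}$ of linear operators from $L^1+L^\infty$ to the measurable functions, $T_0=\mathrm{Id}$, such that (i) for each $1\le p\le\infty$ every $T_t$ is a contraction on $L^p$ and $\{T_t\}$ is a semigroup there; (ii) every $T_t$ is self-adjoint on $L^2$; (iii) $T_tf\to f$ in $L^2$ as $t\to0^+$ for each $f\in L^2$. It is *Markovian* if moreover $T_tf\ge 0$ whenever $f\ge0$, and $T_t\mathbf 1=\mathbf 1$ for all $t$; it is *submarkovian* if moreover $T_tf\ge0$ whenever $f\ge 0$, and $T_t\mathbf 1\le\mathbf 1$ for all $t$. A semigroup on $L^2$ is *$L^p$-contractive* if $\|T_tf\|_p\le\|f\|_p$ for all $1\le p\le\infty$, $t\ge0$ and $f\in L^2\cap L^p$. For $\gamma\ge\eta>0$ and $u>0$ put $H_{\eta,\gamma}(u)=\frac{\Gamma(\eta)}{\Gamma(\gamma)}u^{\gamma-\eta}e^{-u}\,{}_1F_1(\eta;\gamma;u)$,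 where ${}_1F_1$ is the confluent hypergeometric function. **Proposition.** Let $\alpha\in[-1/2,\infty)$. 1. For $t>0$ the integral defining $T^{\alpha,\psi}_tf(x)$ converges absolutely for every $f\in L^1+L^\infty$ and every $x>0$. For every $t\ge0$ and $f\in L^2$, the function $T^{\alpha,\psi}_tf$ so defined agrees almost everywhere with $\mathcal H_\alpha\big(e^{-t(\cdot)^2}\mathcal H_\alpha f\big)$. Moreover, for all $t,x>0$, $$T^{\alpha,\psi}_t\mathbf 1(x)=H_{\frac\alpha2+\frac34,\,\alpha+1}\Big(\frac{x^2}{4t}\Big).$$ 2. If $\alpha\in\{-1/2\}\cup[1/2,\infty)$, then $\{T^{\alpha,\psi}_t\}$ is a submarkovian symmetric diffusion semigroup, and it is Markovian if and only if $\alpha=-1/2$. 3. If $\alpha\in(-1/2,1/2)$, then $\{T^{\alpha,\psi}_t\}$ is not an $L^p$-contractive semigroup, but there is a constant $c=c(\alpha)>1$ such that for all $1\le p\le\infty$ and all $t>0$ the operator $T^{\alpha,\psi}_t$ maps $L^p$ into itself with $\|T^{\alpha,\psi}_t\|_{p\to p}\le c$. -/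

import Mathlib

open MeasureTheory Filter Topology Set
open scoped ENNReal ComplexOrder

noncomputable section

/-! ### Symmetric diffusion semigroups

Let `μ` be a measure on `X`.  Operators act on functions `X → 𝕜` (`𝕜 = ℝ` or `ℂ`), which are
identified when they agree `μ`-almost everywhere. -/

section Diffusion

variable {X 𝕜 : Type*} [MeasurableSpace X] [RCLike 𝕜]

/-- `f` belongs to `L¹(μ) + L^∞(μ)`. -/
def MemL1AddLinfty (μ : Measure X) (f : X → 𝕜) : Prop :=
  ∃ g h : X → 𝕜, MemLp g 1 μ ∧ MemLp h ∞ μ ∧ f = g + h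

/-- The family `T t`, `t ≥ 0`, is a symmetric diffusion semigroup on `(X, μ)`, with common domain
`L¹ + L^∞`. The first five fields say that each `T t` is a linear operator from `L¹ + L^∞` to the
space of (classes of) measurable functions, and that `T 0` is the identity. -/
structure IsSymmetricDiffusionSemigroup (μ : Measure X) (T : ℝ → (X → 𝕜) → (X → 𝕜)) : Prop where
  measurable : ∀ t, 0 ≤ t → ∀ f, MemL1AddLinfty μ f → AEStronglyMeasurable (T t f) μ
  congr : ∀ t, 0 ≤ t → ∀ f g, MemL1AddLinfty μ f → MemL1AddLinfty μ g →
    f =ᵐ[μ] g → T t f =ᵐ[μ] T t g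
  map_add : ∀ t, 0 ≤ t → ∀ f g, MemL1AddLinfty μ f → MemL1AddLinfty μ g →
    T t (f + g) =ᵐ[μ] T t f + T t g
  map_smul : ∀ t, 0 ≤ t → ∀ (a : 𝕜) (f), MemL1AddLinfty μ f → T t (a • f) =ᵐ[μ] a • T t f
  map_zero_time : ∀ f, MemL1AddLinfty μ f → T 0 f =ᵐ[μ] f
  /-- every `T t` is a contraction on every `L^p`, `1 ≤ p ≤ ∞` -/
  contraction : ∀ t, 0 ≤ t → ∀ p : ℝ≥0∞, 1 ≤ p → ∀ f, MemLp f p μ →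
    MemLp (T t f) p μ ∧ eLpNorm (T t f) p μ ≤ eLpNorm f p μ
  /-- the semigroup property on every `L^p`, `1 ≤ p ≤ ∞` -/
  semigroup : ∀ s t, 0 ≤ s → 0 ≤ t → ∀ p : ℝ≥0∞, 1 ≤ p → ∀ f, MemLp f p μ →
    T (s + t) f =ᵐ[μ] T s (T t f)
  /-- every `T t` is self-adjoint on `L²` -/
  self_adjoint : ∀ t, 0 ≤ t → ∀ f g, MemLp f 2 μ → MemLp g 2 μ →
    ∫ x, inner 𝕜 (T t f x) (g x) ∂μ = ∫ x, inner 𝕜 (f x) (T t g x) ∂μ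
  /-- strong continuity at `0` on `L²` -/
  tendsto_zero : ∀ f, MemLp f 2 μ →
    Tendsto (fun t => eLpNorm (T t f - f) 2 μ) (𝓝[>] 0) (𝓝 0)

/-- A Markovian semigroup: a symmetric diffusion semigroup that is positive and conservative. -/
structure IsMarkovianSemigroup (μ : Measure X) (T : ℝ → (X → 𝕜) → (X → 𝕜)) : Prop
    extends IsSymmetricDiffusionSemigroup μ T where
  positive : ∀ t, 0 ≤ t → ∀ f, MemL1AddLinfty μ f → (∀ᵐ x ∂μ, 0 ≤ f x) → ∀ᵐ x ∂μ, 0 ≤ T t f x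
  conservative : ∀ t, 0 ≤ t → ∀ᵐ x ∂μ, T t (fun _ => 1) x = 1

/-- A submarkovian semigroup: a positive symmetric diffusion semigroup with `T t 1 ≤ 1`. -/
structure IsSubmarkovianSemigroup (μ : Measure X) (T : ℝ → (X → 𝕜) → (X → 𝕜)) : Prop
    extends IsSymmetricDiffusionSemigroup μ T where
  positive : ∀ t, 0 ≤ t → ∀ f, MemL1AddLinfty μ f → (∀ᵐ x ∂μ, 0 ≤ f x) → ∀ᵐ x ∂μ, 0 ≤ T t f x
  subconservative : ∀ t, 0 ≤ t → ∀ᵐ x ∂μ, T t (fun _ => 1) x ≤ 1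

/-- A family of operators on `L²(μ)` is `L^p`-contractive if `‖T t f‖_p ≤ ‖f‖_p` for all
`1 ≤ p ≤ ∞`, all `t ≥ 0` and all `f ∈ L² ∩ L^p`. -/
def IsLpContractive (μ : Measure X) (T : ℝ → (X → 𝕜) → (X → 𝕜)) : Prop :=
  ∀ p : ℝ≥0∞, 1 ≤ p → ∀ t, 0 ≤ t → ∀ f, MemLp f 2 μ → MemLp f p μ →
    eLpNorm (T t f) p μ ≤ eLpNorm f p μ

end Diffusion

/-! ### Special functions -/

/-- The Bessel function of the first kind `J_ν(z)`, for `z > 0` and `ν > -1`. -/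
def besselJ (ν z : ℝ) : ℝ :=
  ∑' k : ℕ, (-1) ^ k / ((k.factorial : ℝ) * Real.Gamma (k + ν + 1)) * (z / 2) ^ (2 * (k : ℝ) + ν)

/-- The confluent hypergeometric function `₁F₁(a; b; z)`. -/
def confluentHypergeometric (a b z : ℝ) : ℝ :=
  ∑' k : ℕ, (ascPochhammer ℝ k).eval a / (ascPochhammer ℝ k).eval b * z ^ k / (k.factorial : ℝ)

/-- `H_{η,γ}(u) = Γ(η)/Γ(γ) u^{γ-η} e^{-u} ₁F₁(η; γ; u)`, for `u > 0` and `γ ≥ η > 0`. -/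
def auxH (η γ u : ℝ) : ℝ :=
  Real.Gamma η / Real.Gamma γ * u ^ (γ - η) * Real.exp (-u) * confluentHypergeometric η γ u

/-! ### The Hankel transform and the Bessel semigroup on `(0, ∞)` -/

/-- Lebesgue measure on `(0, ∞)`. -/
def halfLine : Measure ℝ := volume.restrict (Ioi 0)

/-- The eigenfunctions `ψ^α_l(x) = √(x l) J_α(x l)`. -/
def besselPsi (α l x : ℝ) : ℝ := Real.sqrt (x * l) * besselJ α (x * l)

section Bessel

variable {𝕜 : Type*} [RCLike 𝕜]

/-- `g` is the Hankel transform of order `α` of `f ∈ L²(0, ∞)`: the function `g` is in `L²(0, ∞)`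
and is the `L²`-limit, as `R → ∞`, of the functions `l ↦ ∫_0^R ψ^α_l(x) f(x) dx`. -/
def IsHankelTransform (α : ℝ) (f g : ℝ → 𝕜) : Prop :=
  MemLp g 2 halfLine ∧
    Tendsto (fun R : ℝ =>
      eLpNorm (fun l => g l - ∫ x in Ioo 0 R, besselPsi α l x • f x) 2 halfLine) atTop (𝓝 0)

/-- `h = exp(-t L) f` for `f ∈ L²(0, ∞)`, where `L` is the self-adjoint Bessel operator that the
Hankel transform `𝓗` diagonalizes: `h = 𝓗 (e^{-t l²} 𝓗 f)`. -/
def IsHankelHeat (α t : ℝ) (f h : ℝ → 𝕜) : Prop :=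
  ∃ g : ℝ → 𝕜, IsHankelTransform α f g ∧
    IsHankelTransform α (fun l => Real.exp (-t * l ^ 2) • g l) h

/-- The heat kernel `G_t(x, y) = ∫_0^∞ e^{-t l²} ψ^α_l(x) ψ^α_l(y) dl`. -/
def besselKernel (α t x y : ℝ) : ℝ :=
  ∫ l, Real.exp (-t * l ^ 2) * besselPsi α l x * besselPsi α l y ∂halfLine

/-- The Bessel semigroup as a family of integral operators:
`T_t f(x) = ∫_0^∞ G_t(x, y) f(y) dy` for `t > 0`, and `T_0 f = f`. -/
def besselSemigroup (α t : ℝ) (f : ℝ → 𝕜) : ℝ → 𝕜 :=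
  if t = 0 then f else fun x => ∫ y, besselKernel α t x y • f y ∂halfLine

end Bessel

end

/-! Everything is read off from a closed form of the heat kernel. `√z J_α(z)` is a power of `z`
times an entire series in `z ^ 2`, here `besselClifford`. Weber's second exponential integral
(`integral_gaussian_mul_besselClifford_mul`) then turns the spectral integral into a power of `x y`,
times a Gaussian, times the same series at a nonnegative argument (`besselKernel_eq`). So the kernel
is symmetric and nonnegative, and a second use of Weber's integral gives the Chapman–Kolmogorov
identity.

For such a kernel the Schur test bounds the norm on every `L^p` by `sup T_t 1`, and termwise
integration gives `T_t 1 (x) = auxH η (η + δ) (x² / 4t)` with `η = α/2 + 3/4`, `δ = α/2 + 1/4`. For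
`δ > 0`, Euler's integral writes `auxH` as `u^δ / Γ(δ)` times `∫_0^1 r^(δ-1) (1-r)^(η-1) e^(-ur)
dr`, to be compared with the integral over `(0, ∞)` without the weight `(1-r)^(η-1)`, which is
normalized to `1`. If `η ≥ 1`, that is `α ≥ 1/2`, the weight is at most `1` and a tail is lost, so
`T_t 1 < 1`. If `η < 1`, the weight is at least `1 + (1-η) r`; this gain, of relative order `1/u`,
beats the lost tail for large `u`, so `T_t 1` exceeds `1` somewhere but stays bounded. For `α =
-1/2`, `δ = 0` and `T_t 1 = 1`. Where `T_1 1 > 1`, contractivity fails in `L¹`, because `‖T_1 F‖₁ =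
∫ (T_1 1) F` for `F ≥ 0`.

The `L²` theory uses no spectral theorem. The semigroup acts explicitly on the functions `x^(α+1/2)
e^(-a x²)`, which are total by Weierstrass approximation in `e^(-x²)`; with the uniform norm bound
this gives strong continuity at `0`. Inserting `e^(-t l²)`, applying Fubini to compactly supported
functions and letting `t → 0` gives Plancherel's identity for the Hankel transform. Its extension to
`L²` is a symmetric isometry, and testing against an arbitrary vector identifies `T_t` with `𝓗 e^(-t
l²) 𝓗`. -/

noncomputable section

/-! ### The Bessel–Clifford function -/

/-- The Taylor coefficients of the Bessel–Clifford function. -/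
def cliffordCoeff (α : ℝ) (k : ℕ) : ℝ := ((k.factorial : ℝ) * Real.Gamma (k + α + 1))⁻¹

/-- The Bessel–Clifford function `∑ w ^ k / (k! Γ(k + α + 1))`. -/
def besselClifford (α w : ℝ) : ℝ := ∑' k : ℕ, cliffordCoeff α k * w ^ k

section Clifford

variable {α : ℝ}

theorem natCast_add_add_one_pos (hα : -1 / 2 ≤ α) (k : ℕ) : 0 < (k : ℝ) + α + 1 := by
  have : (0 : ℝ) ≤ k := k.cast_nonneg
  linarith

theorem Gamma_natCast_add_pos (hα : -1 / 2 ≤ α) (k : ℕ) : 0 < Real.Gamma (k + α + 1) :=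
  Real.Gamma_pos_of_pos (natCast_add_add_one_pos hα k)

theorem cliffordCoeff_pos (hα : -1 / 2 ≤ α) (k : ℕ) : 0 < cliffordCoeff α k :=
  inv_pos.2 (mul_pos (by positivity) (Gamma_natCast_add_pos hα k))

theorem cliffordCoeff_succ (hα : -1 / 2 ≤ α) (k : ℕ) :
    cliffordCoeff α (k + 1) = cliffordCoeff α k / ((k + 1) * (k + α + 1)) := by
  have h := natCast_add_add_one_pos hα k
  have h2 := Gamma_natCast_add_pos hα k
  have : ((k + 1 : ℕ) : ℝ) + α + 1 = (k + α + 1) + 1 := by push_cast; ring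
  rw [cliffordCoeff, this, Real.Gamma_add_one h.ne', cliffordCoeff, Nat.factorial_succ]
  push_cast
  field_simp

/-- Comparison with the extremal order `α = -1/2`: the ratio of consecutive denominators is
`(k+1)(k+α+1) ≥ (k+1)(k+1/2)`, and the latter product telescopes to `(2k)! / 4^k`. The majorant is
the `cosh` series. -/
theorem cliffordCoeff_le (hα : -1 / 2 ≤ α) (k : ℕ) :
    cliffordCoeff α k ≤ (Real.Gamma (α + 1))⁻¹ * (4 ^ k / ((2 * k).factorial : ℝ)) := by
  induction k with
  | zero => simp [cliffordCoeff]
  | succ k ih =>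
    have h := natCast_add_add_one_pos hα k
    have hk : (0 : ℝ) ≤ k := k.cast_nonneg
    have e : ((2 * (k + 1)).factorial : ℝ) = (2 * k).factorial * (4 * ((k + 1) * (k + 1 / 2))) := by
      rw [show 2 * (k + 1) = 2 * k + 1 + 1 by ring, Nat.factorial_succ, Nat.factorial_succ]
      push_cast; ring
    rw [cliffordCoeff_succ hα, e, pow_succ]
    calc cliffordCoeff α k / ((k + 1) * (k + α + 1))
        ≤ cliffordCoeff α k / ((k + 1) * (k + 1 / 2)) := by
          have := cliffordCoeff_pos hα k
          have h' : (k : ℝ) + 1 / 2 ≤ k + α + 1 := by linarith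
          gcongr _ / (_ * ?_)
      _ ≤ ((Real.Gamma (α + 1))⁻¹ * (4 ^ k / ((2 * k).factorial : ℝ))) /
            ((k + 1) * (k + 1 / 2)) := by gcongr
      _ = _ := by field_simp

theorem cliffordCoeff_mul_pow_le (hα : -1 / 2 ≤ α) {w : ℝ} (hw : 0 ≤ w) (k : ℕ) :
    cliffordCoeff α k * w ^ k ≤
      (Real.Gamma (α + 1))⁻¹ * ((2 * √w) ^ (2 * k) / ((2 * k).factorial : ℝ)) := by
  have : (2 * √w) ^ (2 * k) = 4 ^ k * w ^ k := by
    rw [pow_mul, mul_pow, Real.sq_sqrt hw, ← mul_pow]; norm_num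
  rw [this]
  calc _ ≤ (Real.Gamma (α + 1))⁻¹ * (4 ^ k / ((2 * k).factorial : ℝ)) * w ^ k := by
        gcongr; exact cliffordCoeff_le hα k
    _ = _ := by ring

theorem summable_besselClifford_of_nonneg (hα : -1 / 2 ≤ α) {w : ℝ} (hw : 0 ≤ w) :
    Summable fun k : ℕ => cliffordCoeff α k * w ^ k :=
  Summable.of_nonneg_of_le (fun k => mul_nonneg (cliffordCoeff_pos hα k).le (pow_nonneg hw k))
    (cliffordCoeff_mul_pow_le hα hw) ((Real.hasSum_cosh (2 * √w)).summable.mul_left _)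

theorem abs_cliffordCoeff_mul_pow (hα : -1 / 2 ≤ α) (w : ℝ) (k : ℕ) :
    |cliffordCoeff α k * w ^ k| = cliffordCoeff α k * |w| ^ k := by
  rw [abs_mul, abs_pow, abs_of_pos (cliffordCoeff_pos hα k)]

theorem summable_norm_besselClifford (hα : -1 / 2 ≤ α) (w : ℝ) :
    Summable fun k : ℕ => ‖cliffordCoeff α k * w ^ k‖ := by
  simp_rw [Real.norm_eq_abs, abs_cliffordCoeff_mul_pow hα]
  exact summable_besselClifford_of_nonneg hα (abs_nonneg w)

theorem hasSum_besselClifford (hα : -1 / 2 ≤ α) (w : ℝ) :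
    HasSum (fun k : ℕ => cliffordCoeff α k * w ^ k) (besselClifford α w) :=
  (summable_norm_besselClifford hα w).of_norm.hasSum

theorem besselClifford_nonneg (hα : -1 / 2 ≤ α) {w : ℝ} (hw : 0 ≤ w) : 0 ≤ besselClifford α w :=
  tsum_nonneg fun k => mul_nonneg (cliffordCoeff_pos hα k).le (pow_nonneg hw k)

theorem abs_besselClifford_le (hα : -1 / 2 ≤ α) (w : ℝ) :
    |besselClifford α w| ≤ besselClifford α |w| := by
  have h := norm_tsum_le_tsum_norm (summable_norm_besselClifford hα w)
  simp_rw [Real.norm_eq_abs, abs_cliffordCoeff_mul_pow hα] at h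
  exact h

theorem besselClifford_le_exp (hα : -1 / 2 ≤ α) {w : ℝ} (hw : 0 ≤ w) :
    besselClifford α w ≤ (Real.Gamma (α + 1))⁻¹ * Real.exp (2 * √w) := by
  have h := (hasSum_besselClifford hα w).tsum_eq ▸
    (hasSum_besselClifford hα w).summable.tsum_le_tsum (cliffordCoeff_mul_pow_le hα hw)
      ((Real.hasSum_cosh (2 * √w)).summable.mul_left _)
  rw [tsum_mul_left, (Real.hasSum_cosh (2 * √w)).tsum_eq] at h
  refine h.trans ?_
  have : 0 < Real.Gamma (α + 1) := Real.Gamma_pos_of_pos (by linarith)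
  gcongr
  rw [Real.cosh_eq]
  have : Real.exp (-(2 * √w)) ≤ Real.exp (2 * √w) :=
    Real.exp_le_exp.2 (by linarith [Real.sqrt_nonneg w])
  linarith

/-- In the variable `x` the growth is only exponential, so any Gaussian in `x` absorbs it. This is
the sole growth estimate used to justify integrability below. -/
theorem abs_besselClifford_mul_sq_le (hα : -1 / 2 ≤ α) (w x : ℝ) :
    |besselClifford α (w * x ^ 2)| ≤ (Real.Gamma (α + 1))⁻¹ * Real.exp (2 * √|w| * |x|) := by
  refine (abs_besselClifford_le hα _).trans ((besselClifford_le_exp hα (abs_nonneg _)).trans_eq ?_)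
  rw [abs_mul, Real.sqrt_mul (abs_nonneg w), abs_of_nonneg (sq_nonneg x), Real.sqrt_sq_eq_abs,
    mul_assoc]

theorem continuous_besselClifford (hα : -1 / 2 ≤ α) : Continuous (besselClifford α) := by
  rw [continuous_iff_continuousAt]
  intro w
  have h : ContinuousOn (besselClifford α) (Metric.closedBall 0 (|w| + 1)) := by
    refine continuousOn_tsum (u := fun k => cliffordCoeff α k * (|w| + 1) ^ k)
      (fun k => by fun_prop) (summable_besselClifford_of_nonneg hα (by positivity)) ?_
    intro k x hx
    rw [Real.norm_eq_abs, abs_cliffordCoeff_mul_pow hα]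
    have := (cliffordCoeff_pos hα k).le
    have hx : |x| ≤ |w| + 1 := by simpa using hx
    gcongr
  refine h.continuousAt (Metric.closedBall_mem_nhds_of_mem ?_)
  simp

theorem measurable_besselClifford (hα : -1 / 2 ≤ α) : Measurable (besselClifford α) :=
  (continuous_besselClifford hα).measurable

end Clifford

/-! ### Gaussian moments -/

theorem integral_rpow_mul_exp_neg_mul_sq {p q : ℝ} (hp : 0 < p) (hq : -1 < q) :
    ∫ x in Ioi (0 : ℝ), x ^ q * Real.exp (-p * x ^ 2) =
      p ^ (-((q + 1) / 2)) * Real.Gamma ((q + 1) / 2) / 2 := by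
  have h := integral_rpow_mul_exp_neg_mul_rpow (p := 2) two_pos hq hp
  simp only [Real.rpow_two] at h
  rw [h, neg_div]
  ring

theorem integrableOn_rpow_mul_exp_neg_mul_sq_mul {p q b C : ℝ} (hp : 0 < p) (hq : -1 < q)
    {f : ℝ → ℝ} (hf : Measurable f) (hb : ∀ x, 0 < x → |f x| ≤ C * Real.exp (b * x)) :
    IntegrableOn (fun x => x ^ q * Real.exp (-p * x ^ 2) * f x) (Ioi 0) := by
  have h := (integrableOn_rpow_mul_exp_neg_mul_sq (half_pos hp) hq).mul_const
    (C * Real.exp (b ^ 2 / (2 * p)))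
  refine Integrable.mono' h (by fun_prop) ?_
  filter_upwards [ae_restrict_mem measurableSet_Ioi] with x hx
  have hx : 0 < x := hx
  have hC : 0 ≤ C := by
    have := (abs_nonneg _).trans (hb 1 one_pos)
    exact nonneg_of_mul_nonneg_left this (Real.exp_pos _)
  rw [norm_mul, Real.norm_eq_abs, Real.norm_eq_abs, abs_of_pos (by positivity)]
  calc x ^ q * Real.exp (-p * x ^ 2) * |f x|
      ≤ x ^ q * Real.exp (-p * x ^ 2) * (C * Real.exp (b * x)) := by gcongr; exact hb x hx
    _ = x ^ q * C * Real.exp (-p * x ^ 2 + b * x) := by rw [Real.exp_add]; ring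
    _ ≤ x ^ q * C * Real.exp (-(p / 2) * x ^ 2 + b ^ 2 / (2 * p)) := by
        -- Completing the square: half of the Gaussian absorbs `exp (b x)`, the other half is kept
        -- for integrability.
        have : b ^ 2 / (2 * p) + p / 2 * x ^ 2 - b * x = (b - p * x) ^ 2 / (2 * p) := by
          field_simp; ring
        have : 0 ≤ (b - p * x) ^ 2 / (2 * p) := by positivity
        have : -p * x ^ 2 + b * x ≤ -(p / 2) * x ^ 2 + b ^ 2 / (2 * p) := by linarith
        gcongr ?_ * Real.exp ?_
    _ = _ := by rw [Real.exp_add]; ring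

section Moments

variable {α : ℝ}

theorem integrableOn_gaussian_mul_besselClifford (hα : -1 / 2 ≤ α) {p q : ℝ} (hp : 0 < p)
    (hq : -1 < q) (w : ℝ) :
    IntegrableOn (fun x => x ^ q * Real.exp (-p * x ^ 2) * besselClifford α (w * x ^ 2))
      (Ioi 0) := by
  refine integrableOn_rpow_mul_exp_neg_mul_sq_mul hp hq
    ((measurable_besselClifford hα).comp (by fun_prop)) (b := 2 * √|w|)
    (C := (Real.Gamma (α + 1))⁻¹) fun x hx => ?_
  simpa only [abs_of_pos hx] using abs_besselClifford_mul_sq_le hα w x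

theorem integrableOn_gaussian_mul_besselClifford_mul (hα : -1 / 2 ≤ α) {p q : ℝ} (hp : 0 < p)
    (hq : -1 < q) (v w : ℝ) :
    IntegrableOn (fun x => x ^ q * Real.exp (-p * x ^ 2) *
      (besselClifford α (v * x ^ 2) * besselClifford α (w * x ^ 2))) (Ioi 0) := by
  have := measurable_besselClifford hα
  refine integrableOn_rpow_mul_exp_neg_mul_sq_mul hp hq (by fun_prop) (b := 2 * √|v| + 2 * √|w|)
    (C := (Real.Gamma (α + 1))⁻¹ * (Real.Gamma (α + 1))⁻¹) fun x hx => ?_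
  have h1 := abs_besselClifford_mul_sq_le hα v x
  have h2 := abs_besselClifford_mul_sq_le hα w x
  rw [abs_of_pos hx] at h1 h2
  rw [abs_mul, add_mul, Real.exp_add]
  refine (mul_le_mul h1 h2 (abs_nonneg _) ((abs_nonneg _).trans h1)).trans_eq (by ring)

/-- Termwise integration against a Gaussian of a power series in `x ^ 2`. -/
theorem hasSum_integral_gaussian_mul_besselClifford (hα : -1 / 2 ≤ α) {p q : ℝ} (hp : 0 < p)
    (hq : -1 < q) (w : ℝ) :
    HasSum (fun k : ℕ => cliffordCoeff α k * w ^ k *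
        (p ^ (-((q + 1) / 2 + k)) * Real.Gamma ((q + 1) / 2 + k) / 2))
      (∫ x in Ioi (0 : ℝ), x ^ q * Real.exp (-p * x ^ 2) * besselClifford α (w * x ^ 2)) := by
  have key := hasSum_integral_of_dominated_convergence (μ := volume.restrict (Ioi (0 : ℝ)))
    (F := fun (k : ℕ) x =>
      x ^ q * Real.exp (-p * x ^ 2) * (cliffordCoeff α k * (w * x ^ 2) ^ k))
    (f := fun x => x ^ q * Real.exp (-p * x ^ 2) * besselClifford α (w * x ^ 2))
    (fun k x => x ^ q * Real.exp (-p * x ^ 2) * (cliffordCoeff α k * (|w| * x ^ 2) ^ k))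
    (fun k => by fun_prop) ?_ ?_ ?_ ?_
  · convert! key using 2 with k
    have h := integral_rpow_mul_exp_neg_mul_sq hp (show -1 < q + 2 * k by
      have : (0 : ℝ) ≤ k := k.cast_nonneg
      linarith)
    rw [show (q + 2 * k + 1) / 2 = (q + 1) / 2 + k by ring] at h
    rw [← h, ← integral_const_mul]
    refine setIntegral_congr_fun measurableSet_Ioi fun x hx => ?_
    have hx : 0 < x := hx
    rw [Real.rpow_add hx, show (2 * (k : ℝ)) = ((2 * k : ℕ) : ℝ) by push_cast; ring,
      Real.rpow_natCast, mul_pow, ← pow_mul]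
    ring
  · intro k
    filter_upwards [ae_restrict_mem measurableSet_Ioi] with x hx
    have hx : 0 < x := hx
    rw [norm_mul, Real.norm_eq_abs, Real.norm_eq_abs, abs_cliffordCoeff_mul_pow hα,
      abs_of_pos (by positivity), abs_mul, abs_of_pos (by positivity : 0 < x ^ 2)]
  · exact Eventually.of_forall fun x => ((hasSum_besselClifford hα _).summable.mul_left _)
  · simp_rw [tsum_mul_left]
    exact integrableOn_gaussian_mul_besselClifford hα hp hq |w|
  · exact Eventually.of_forall fun x => (hasSum_besselClifford hα _).mul_left _

end Moments

/-! ### Weber's second exponential integral -/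

theorem Gamma_add_natCast_succ {a : ℝ} (ha : 0 < a) (n : ℕ) :
    Real.Gamma (a + (n + 1 : ℕ)) = (a + n) * Real.Gamma (a + n) := by
  have : 0 < a + n := by positivity
  rw [← Real.Gamma_add_one this.ne']
  push_cast; ring_nf

/-- A form of the Chu–Vandermonde identity. -/
theorem Gamma_vandermonde (k : ℕ) : ∀ {a : ℝ}, 0 < a → ∀ j : ℕ,
    Real.Gamma (a + k + j) / (j.factorial * Real.Gamma (a + k)) =
      ∑ ij ∈ Finset.HasAntidiagonal.antidiagonal j, (k.choose ij.1 : ℝ) *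
        (Real.Gamma (a + ij.1 + ij.2) / (ij.2.factorial * Real.Gamma (a + ij.1))) := by
  -- `Γ(a+n) / (n! Γ(a))` is the coefficient of `z^n` in `(1-z)^(-a)`. The identity to be proved
  -- compares coefficients in `(1-z)^(-(a+k)) = (1-z)^(-a) (1 + z/(1-z))^k`, and the recursion here
  -- is the case `k = 1`.
  have pascal : ∀ {a : ℝ}, 0 < a → ∀ n : ℕ,
      Real.Gamma (a + 1 + (n + 1 : ℕ)) / ((n + 1).factorial * Real.Gamma (a + 1)) =
      Real.Gamma (a + (n + 1 : ℕ)) / ((n + 1).factorial * Real.Gamma a) +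
        Real.Gamma (a + 1 + n) / (n.factorial * Real.Gamma (a + 1)) := by
    intro a ha n
    have h1 := Gamma_add_natCast_succ (show 0 < a + 1 by linarith) n
    have h2 : a + (n + 1 : ℕ) = a + 1 + n := by push_cast; ring
    rw [h1, h2, Real.Gamma_add_one ha.ne', Nat.factorial_succ]
    have := Real.Gamma_pos_of_pos ha
    push_cast
    field_simp
    ring
  induction k with
  | zero =>
    intro a ha j
    cases j with
    | zero => simp
    | succ j => rw [Finset.Nat.sum_antidiagonal_succ]; simp
  | succ k ih =>
    intro a ha j
    have e : a + ((k + 1 : ℕ) : ℝ) = a + 1 + k := by push_cast; ring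
    rw [e, ih (by linarith)]
    cases j with
    | zero =>
      have h1 := Real.Gamma_pos_of_pos ha
      have h2 := Real.Gamma_pos_of_pos (show 0 < a + 1 by linarith)
      simp [h1.ne', h2.ne']
    | succ j =>
      have hm (m : ℕ) : 0 < a + m := by positivity
      have em (m : ℕ) : a + 1 + (m : ℝ) = a + m + 1 := by ring
      -- The same antidiagonal sum with its first, respectively its last, term split off. This
      -- matches the index shift produced by Pascal's rule for `(k+1).choose`.
      have h0 := (Finset.Nat.sum_antidiagonal_succ (n := j) (f := fun ij : ℕ × ℕ =>
        (k.choose ij.1 : ℝ) *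
        (Real.Gamma (a + ij.1 + ij.2) / (ij.2.factorial * Real.Gamma (a + ij.1))))).symm.trans
        (Finset.Nat.sum_antidiagonal_succ' (n := j) (f := fun ij : ℕ × ℕ =>
        (k.choose ij.1 : ℝ) *
        (Real.Gamma (a + ij.1 + ij.2) / (ij.2.factorial * Real.Gamma (a + ij.1)))))
      rw [Finset.Nat.sum_antidiagonal_succ', Finset.Nat.sum_antidiagonal_succ]
      simp only [em, pascal (hm _), mul_add, Finset.sum_add_distrib]
      have hG (m : ℕ) := (Real.Gamma_pos_of_pos (hm m)).ne'
      have hG' (m : ℕ) := (Real.Gamma_pos_of_pos (show 0 < a + m + 1 by have := hm m; linarith)).ne'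
      simp only [Nat.factorial_zero, Nat.cast_zero, Nat.cast_one, one_mul, add_zero, hG, hG',
        div_self, ne_eq, not_false_eq_true, mul_one, Nat.choose_zero_right] at h0 ⊢
      rw [← add_assoc, ← h0]
      simp only [Nat.choose_succ_succ, Nat.cast_add, add_mul, Finset.sum_add_distrib, Nat.cast_one,
        Nat.succ_eq_add_one, ← add_assoc]
      ring

theorem Gamma_mul_cliffordCoeff_eq_sum {α : ℝ} (hα : -1 / 2 ≤ α) (j k : ℕ) :
    Real.Gamma (α + 1 + k + j) * cliffordCoeff α j =
      ∑ ij ∈ Finset.HasAntidiagonal.antidiagonal j,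
        (k.choose ij.1 * (Real.Gamma (α + 1 + k) / Real.Gamma (α + 1 + ij.1))) *
          ((ij.2.factorial : ℝ))⁻¹ := by
  have ha : 0 < α + 1 := by linarith
  have hG (m : ℕ) := (Real.Gamma_pos_of_pos (show 0 < α + 1 + m by positivity)).ne'
  have h := congrArg (fun z => z * (Real.Gamma (α + 1 + k) / Real.Gamma (α + 1 + j)))
    (Gamma_vandermonde k ha j)
  have e : (j : ℝ) + α + 1 = α + 1 + j := by ring
  simp only [Finset.sum_mul] at h
  rw [cliffordCoeff, e]
  convert h using 1
  · have := hG j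
    have := hG k
    field_simp
  · refine Finset.sum_congr rfl fun ij hij => ?_
    have e : α + 1 + (ij.1 : ℝ) + ij.2 = α + 1 + j := by
      rw [← Finset.HasAntidiagonal.mem_antidiagonal.1 hij]; push_cast; ring
    rw [e]
    have := hG j
    have := hG ij.1
    field_simp

theorem Real.summable_norm_pow_div_factorial (x : ℝ) :
    Summable fun n : ℕ => ‖x ^ n / (n.factorial : ℝ)‖ :=
  NormedSpace.norm_expSeries_div_summable x

theorem Real.tsum_pow_div_factorial (x : ℝ) :
    ∑' n : ℕ, x ^ n / (n.factorial : ℝ) = Real.exp x := by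
  rw [Real.exp_eq_exp_ℝ, NormedSpace.exp_eq_tsum_div]

/-- Kummer's transformation in the terminating case: the left side is a multiple of `₁F₁(α+1+k; α+1;
X)`, and the finite sum is `k! L_k^α(-X)` with `L_k^α` the Laguerre polynomial. By Vandermonde the
coefficients on the left form the Cauchy product of this polynomial with the exponential series. -/
theorem tsum_Gamma_mul_cliffordCoeff_mul_pow {α : ℝ} (hα : -1 / 2 ≤ α) (k : ℕ) (X : ℝ) :
    ∑' j : ℕ, Real.Gamma (α + 1 + k + j) * cliffordCoeff α j * X ^ j =
      Real.exp X * ∑ m ∈ Finset.range (k + 1),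
        (k.choose m * (Real.Gamma (α + 1 + k) / Real.Gamma (α + 1 + m))) * X ^ m := by
  have h0 : ∀ m ∉ Finset.range (k + 1),
      (k.choose m * (Real.Gamma (α + 1 + k) / Real.Gamma (α + 1 + m))) * X ^ m = 0 := by
    intro m hm
    rw [Nat.choose_eq_zero_of_lt (by simpa using hm)]
    simp
  have hs : Summable fun m : ℕ =>
      ‖(k.choose m * (Real.Gamma (α + 1 + k) / Real.Gamma (α + 1 + m))) * X ^ m‖ :=
    (hasSum_sum_of_ne_finset_zero (s := Finset.range (k + 1))
      fun m hm => by rw [h0 m hm, norm_zero]).summable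
  rw [← tsum_eq_sum (L := .unconditional ℕ) h0, ← Real.tsum_pow_div_factorial, mul_comm,
    tsum_mul_tsum_eq_tsum_sum_antidiagonal_of_summable_norm hs
      (Real.summable_norm_pow_div_factorial X)]
  refine tsum_congr fun j => ?_
  rw [Gamma_mul_cliffordCoeff_eq_sum hα, Finset.sum_mul]
  refine Finset.sum_congr rfl fun ij hij => ?_
  rw [← Finset.HasAntidiagonal.mem_antidiagonal.1 hij, pow_add]
  ring

/-- The generating function of the Laguerre polynomials `L_k^α(-X)` weighted by `1 / Γ(k+α+1)`,
again a Cauchy product with the exponential series. -/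
theorem tsum_cliffordCoeff_mul_laguerre {α : ℝ} (hα : -1 / 2 ≤ α) (X Y : ℝ) :
    ∑' k : ℕ, cliffordCoeff α k * Y ^ k * ∑ m ∈ Finset.range (k + 1),
        (k.choose m * (Real.Gamma (α + 1 + k) / Real.Gamma (α + 1 + m))) * X ^ m =
      Real.exp Y * besselClifford α (X * Y) := by
  rw [← Real.tsum_pow_div_factorial, mul_comm, besselClifford,
    tsum_mul_tsum_eq_tsum_sum_antidiagonal_of_summable_norm
      (summable_norm_besselClifford hα _) (Real.summable_norm_pow_div_factorial Y)]
  refine tsum_congr fun k => ?_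
  rw [← Finset.Nat.sum_antidiagonal_eq_sum_range_succ_mk (n := k) (f := fun ij : ℕ × ℕ =>
    (k.choose ij.1 * (Real.Gamma (α + 1 + k) / Real.Gamma (α + 1 + ij.1))) * X ^ ij.1),
    Finset.mul_sum]
  refine Finset.sum_congr rfl fun ij hij => ?_
  obtain ⟨m, n⟩ := ij
  have hk := Finset.HasAntidiagonal.mem_antidiagonal.1 hij
  simp only at hk ⊢
  subst hk
  have hc := Nat.add_choose_mul_factorial_mul_factorial m n
  have hG (m : ℕ) := (Gamma_natCast_add_pos hα m).ne'
  have h1 := hG (m + n)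
  have h2 := hG m
  have e1 : α + 1 + ((m + n : ℕ) : ℝ) = ((m + n : ℕ) : ℝ) + α + 1 := by ring
  have e2 : α + 1 + (m : ℝ) = m + α + 1 := by ring
  rw [cliffordCoeff, cliffordCoeff, e1, e2]
  have hc' : ((m + n).choose m : ℝ) = (m + n).factorial / (m.factorial * n.factorial) := by
    rw [Nat.choose_symm_add, ← hc]; push_cast; field_simp
  rw [hc', pow_add]
  field_simp
  ring

/-- Weber's second exponential integral. -/
theorem integral_gaussian_mul_besselClifford_mul {α : ℝ} (hα : -1 / 2 ≤ α) {p : ℝ} (hp : 0 < p)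
    (A B : ℝ) :
    ∫ x in Ioi (0 : ℝ), x ^ (2 * α + 1) * Real.exp (-p * x ^ 2) *
        (besselClifford α (A * x ^ 2) * besselClifford α (B * x ^ 2)) =
      p ^ (-(α + 1)) / 2 * Real.exp ((A + B) / p) * besselClifford α (A * B / p ^ 2) := by
  have hq : (-1 : ℝ) < 2 * α + 1 := by linarith
  have key := hasSum_integral_of_dominated_convergence (μ := volume.restrict (Ioi (0 : ℝ)))
    (F := fun (k : ℕ) x => x ^ (2 * α + 1) * Real.exp (-p * x ^ 2) *
      (besselClifford α (A * x ^ 2) * (cliffordCoeff α k * (B * x ^ 2) ^ k)))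
    (f := fun x => x ^ (2 * α + 1) * Real.exp (-p * x ^ 2) *
        (besselClifford α (A * x ^ 2) * besselClifford α (B * x ^ 2)))
    (fun k x => x ^ (2 * α + 1) * Real.exp (-p * x ^ 2) *
      (besselClifford α (|A| * x ^ 2) * (cliffordCoeff α k * (|B| * x ^ 2) ^ k)))
    (fun k => by have := measurable_besselClifford hα; fun_prop) ?_ ?_ ?_ ?_
  · rw [← key.tsum_eq]
    -- Only the second factor is expanded. Each term is then a Gaussian moment of the first factor,
    -- which Kummer's transformation turns into `exp (A/p)` times a Laguerre polynomial in `A/p`;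
    -- the sum over `k` is the generating function.
    have hterm : ∀ k : ℕ, ∫ x in Ioi (0 : ℝ), x ^ (2 * α + 1) * Real.exp (-p * x ^ 2) *
        (besselClifford α (A * x ^ 2) * (cliffordCoeff α k * (B * x ^ 2) ^ k)) =
        p ^ (-(α + 1)) / 2 * Real.exp (A / p) * (cliffordCoeff α k * (B / p) ^ k *
          ∑ m ∈ Finset.range (k + 1),
        (k.choose m * (Real.Gamma (α + 1 + k) / Real.Gamma (α + 1 + m))) * (A / p) ^ m) := by
      intro k
      have hk : (0 : ℝ) ≤ k := k.cast_nonneg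
      have h := hasSum_integral_gaussian_mul_besselClifford hα hp
        (show -1 < 2 * α + 1 + 2 * k by linarith) A
      rw [show (2 * α + 1 + 2 * k + 1) / 2 = α + 1 + k by ring] at h
      have h2 : ∫ x in Ioi (0 : ℝ), x ^ (2 * α + 1) * Real.exp (-p * x ^ 2) *
          (besselClifford α (A * x ^ 2) * (cliffordCoeff α k * (B * x ^ 2) ^ k)) =
          cliffordCoeff α k * B ^ k * ∫ x in Ioi (0 : ℝ), x ^ (2 * α + 1 + 2 * k) *
            Real.exp (-p * x ^ 2) * besselClifford α (A * x ^ 2) := by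
        rw [← integral_const_mul]
        refine setIntegral_congr_fun measurableSet_Ioi fun x hx => ?_
        have hx : 0 < x := hx
        rw [Real.rpow_add hx (2 * α + 1), show (2 * (k : ℝ)) = ((2 * k : ℕ) : ℝ) by push_cast; ring,
          Real.rpow_natCast, mul_pow, ← pow_mul]
        ring
      rw [h2, ← h.tsum_eq]
      have h3 : ∀ j : ℕ, cliffordCoeff α j * A ^ j *
          (p ^ (-(α + 1 + k + j)) * Real.Gamma (α + 1 + k + j) / 2) =
          p ^ (-(α + 1 + k)) / 2 *
            (Real.Gamma (α + 1 + k + j) * cliffordCoeff α j * (A / p) ^ j) := by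
        intro j
        rw [neg_add _ (j : ℝ), Real.rpow_add hp, Real.rpow_neg hp.le (j : ℝ), Real.rpow_natCast,
          div_pow]
        ring
      simp_rw [h3]
      rw [tsum_mul_left, tsum_Gamma_mul_cliffordCoeff_mul_pow hα, neg_add _ (k : ℝ),
        Real.rpow_add hp, Real.rpow_neg hp.le (k : ℝ), Real.rpow_natCast, div_pow]
      ring
    simp_rw [hterm]
    rw [tsum_mul_left, tsum_cliffordCoeff_mul_laguerre hα, add_div, Real.exp_add,
      div_mul_div_comm, ← sq]
    ring
  · intro k
    filter_upwards [ae_restrict_mem measurableSet_Ioi] with x hx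
    have hx : 0 < x := hx
    have h := abs_besselClifford_le hα (A * x ^ 2)
    rw [abs_mul, abs_of_pos (by positivity : 0 < x ^ 2)] at h
    rw [norm_mul, Real.norm_eq_abs, Real.norm_eq_abs, abs_mul (besselClifford _ _),
      abs_cliffordCoeff_mul_pow hα, abs_of_pos (by positivity), abs_mul B, abs_of_pos (by positivity : 0 < x ^ 2)]
    have := (cliffordCoeff_pos hα k).le
    gcongr
  · exact Eventually.of_forall fun x =>
      (((hasSum_besselClifford hα _).summable.mul_left _).mul_left _)
  · simp_rw [tsum_mul_left]
    exact integrableOn_gaussian_mul_besselClifford_mul hα hp hq |A| |B|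
  · exact Eventually.of_forall fun x => ((hasSum_besselClifford hα _).mul_left _).mul_left _

/-! ### The heat kernel in closed form -/

/-- The eigenfunctions `√z J_α(z)`, extended to an even function of `z : ℝ`. -/
def besselEven (α z : ℝ) : ℝ := 2 ^ (-α) * |z| ^ (α + 1 / 2) * besselClifford α (-1 / 4 * z ^ 2)

/-- The closed form of the heat kernel, extended to an even function of both variables. -/
def besselHeatKernel (α t x y : ℝ) : ℝ :=
  2 ^ (-2 * α - 1) * t ^ (-(α + 1)) * |x * y| ^ (α + 1 / 2) *
    Real.exp (-(x ^ 2 + y ^ 2) / (4 * t)) * besselClifford α ((x * y) ^ 2 / (16 * t ^ 2))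

section Kernel

variable {α t : ℝ}

theorem besselPsi_eq_besselEven {l x : ℝ} (hl : 0 < l) (hx : 0 < x) :
    besselPsi α l x = besselEven α (l * x) := by
  have hz : 0 < x * l := mul_pos hx hl
  have h2 : 0 < x * l / 2 := by positivity
  have hJ : besselJ α (x * l) = (x * l / 2) ^ α * besselClifford α (-1 / 4 * (x * l) ^ 2) := by
    rw [besselJ, besselClifford, ← tsum_mul_left]
    refine tsum_congr fun k => ?_
    rw [Real.rpow_add h2, show (2 * (k : ℝ)) = ((2 * k : ℕ) : ℝ) by push_cast; ring,
      Real.rpow_natCast, cliffordCoeff, show -1 / 4 * (x * l) ^ 2 = -1 * (x * l / 2) ^ 2 by ring,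
      mul_pow, ← pow_mul]
    ring
  rw [besselPsi, hJ, besselEven, mul_comm l x, abs_of_pos hz, Real.sqrt_eq_rpow,
    Real.div_rpow hz.le two_pos.le, Real.rpow_add hz, Real.rpow_neg two_pos.le]
  ring

theorem continuous_besselEven (hα : -1 / 2 ≤ α) : Continuous (besselEven α) := by
  have h := continuous_besselClifford hα
  have : Continuous fun z : ℝ => |z| ^ (α + 1 / 2) :=
    continuous_abs.rpow_const fun z => Or.inr (by linarith)
  unfold besselEven
  fun_prop

theorem besselHeatKernel_nonneg (hα : -1 / 2 ≤ α) (ht : 0 < t) (x y : ℝ) :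
    0 ≤ besselHeatKernel α t x y := by
  have : 0 ≤ besselClifford α ((x * y) ^ 2 / (16 * t ^ 2)) :=
    besselClifford_nonneg hα (by positivity)
  unfold besselHeatKernel
  positivity

theorem besselHeatKernel_comm (x y : ℝ) : besselHeatKernel α t x y = besselHeatKernel α t y x := by
  rw [besselHeatKernel, besselHeatKernel, mul_comm x y, add_comm (x ^ 2)]

theorem continuous_besselHeatKernel (hα : -1 / 2 ≤ α) :
    Continuous fun q : ℝ × ℝ => besselHeatKernel α t q.1 q.2 := by
  have h := continuous_besselClifford hα
  have : Continuous fun q : ℝ × ℝ => |q.1 * q.2| ^ (α + 1 / 2) :=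
    (continuous_fst.mul continuous_snd).abs.rpow_const fun z => Or.inr (by linarith)
  unfold besselHeatKernel
  fun_prop

theorem besselHeatKernel_eq {x y : ℝ} (hx : 0 < x) (hy : 0 < y) :
    besselHeatKernel α t x y = 2 ^ (-2 * α - 1) * t ^ (-(α + 1)) * x ^ (α + 1 / 2) *
      Real.exp (-x ^ 2 / (4 * t)) * (y ^ (α + 1 / 2) * Real.exp (-(1 / (4 * t)) * y ^ 2) *
        besselClifford α (x ^ 2 / (16 * t ^ 2) * y ^ 2)) := by
  rw [besselHeatKernel, abs_of_pos (mul_pos hx hy), Real.mul_rpow hx.le hy.le,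
    show -(x ^ 2 + y ^ 2) / (4 * t) = -x ^ 2 / (4 * t) + -(1 / (4 * t)) * y ^ 2 by ring,
    Real.exp_add, show (x * y) ^ 2 / (16 * t ^ 2) = x ^ 2 / (16 * t ^ 2) * y ^ 2 by ring]
  ring

/-- Weber's integral with `A = -x²/4` and `B = -y²/4`. The product `A B` is positive, so the
oscillating factors combine into a series with nonnegative terms; this is the source of positivity.
-/
theorem besselKernel_eq (hα : -1 / 2 ≤ α) (ht : 0 < t) {x y : ℝ} (hx : 0 < x) (hy : 0 < y) :
    besselKernel α t x y = besselHeatKernel α t x y := by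
  have h := integral_gaussian_mul_besselClifford_mul hα ht (-1 / 4 * x ^ 2) (-1 / 4 * y ^ 2)
  have e : besselKernel α t x y = 2 ^ (-α) * 2 ^ (-α) * |x * y| ^ (α + 1 / 2) *
      ∫ l in Ioi (0 : ℝ), l ^ (2 * α + 1) * Real.exp (-t * l ^ 2) *
        (besselClifford α (-1 / 4 * x ^ 2 * l ^ 2) * besselClifford α (-1 / 4 * y ^ 2 * l ^ 2)) := by
    rw [besselKernel, ← integral_const_mul]
    refine setIntegral_congr_fun measurableSet_Ioi fun l hl => ?_
    have hl : 0 < l := hl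
    rw [besselPsi_eq_besselEven hl hx, besselPsi_eq_besselEven hl hy, besselEven, besselEven,
      abs_of_pos (mul_pos hl hx), abs_of_pos (mul_pos hl hy), abs_of_pos (mul_pos hx hy),
      Real.mul_rpow hl.le hx.le, Real.mul_rpow hl.le hy.le, Real.mul_rpow hx.le hy.le,
      show 2 * α + 1 = (α + 1 / 2) + (α + 1 / 2) by ring, Real.rpow_add hl (α + 1 / 2) (α + 1 / 2),
      show -1 / 4 * (l * x) ^ 2 = -1 / 4 * x ^ 2 * l ^ 2 by ring,
      show -1 / 4 * (l * y) ^ 2 = -1 / 4 * y ^ 2 * l ^ 2 by ring]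
    ring
  rw [e, h, besselHeatKernel, show -2 * α - 1 = -α + -α - 1 by ring,
    Real.rpow_sub two_pos, Real.rpow_add two_pos,
    show (-1 / 4 * x ^ 2 + -1 / 4 * y ^ 2) / t = -(x ^ 2 + y ^ 2) / (4 * t) by field_simp; ring,
    show -1 / 4 * x ^ 2 * (-1 / 4 * y ^ 2) / t ^ 2 = (x * y) ^ 2 / (16 * t ^ 2) by
      field_simp; ring, Real.rpow_one]
  ring

/-- The Chapman–Kolmogorov identity. -/
theorem integral_besselHeatKernel_mul (hα : -1 / 2 ≤ α) {s t : ℝ} (hs : 0 < s) (ht : 0 < t)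
    {x z : ℝ} (hx : 0 < x) (hz : 0 < z) :
    ∫ y in Ioi (0 : ℝ), besselHeatKernel α s x y * besselHeatKernel α t y z =
      besselHeatKernel α (s + t) x z := by
  -- The Gaussian rates in the middle variable add up: `1/(4s) + 1/(4t)`.
  have hp : 0 < (s + t) / (4 * (s * t)) := by positivity
  have h := integral_gaussian_mul_besselClifford_mul hα hp (x ^ 2 / (16 * s ^ 2))
    (z ^ 2 / (16 * t ^ 2))
  have e : ∫ y in Ioi (0 : ℝ), besselHeatKernel α s x y * besselHeatKernel α t y z =
      2 ^ (-2 * α - 1) * 2 ^ (-2 * α - 1) * (s ^ (-(α + 1)) * t ^ (-(α + 1))) *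
        |x * z| ^ (α + 1 / 2) * Real.exp (-x ^ 2 / (4 * s) + -z ^ 2 / (4 * t)) *
      ∫ y in Ioi (0 : ℝ), y ^ (2 * α + 1) * Real.exp (-((s + t) / (4 * (s * t))) * y ^ 2) *
        (besselClifford α (x ^ 2 / (16 * s ^ 2) * y ^ 2) *
          besselClifford α (z ^ 2 / (16 * t ^ 2) * y ^ 2)) := by
    rw [← integral_const_mul]
    refine setIntegral_congr_fun measurableSet_Ioi fun y hy => ?_
    have hy : 0 < y := hy
    rw [besselHeatKernel_comm y z, besselHeatKernel_eq hx hy, besselHeatKernel_eq hz hy,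
      abs_of_pos (mul_pos hx hz), Real.mul_rpow hx.le hz.le,
      show 2 * α + 1 = (α + 1 / 2) + (α + 1 / 2) by ring, Real.rpow_add hy (α + 1 / 2) (α + 1 / 2), Real.exp_add,
      show -((s + t) / (4 * (s * t))) * y ^ 2 = -(1 / (4 * s)) * y ^ 2 + -(1 / (4 * t)) * y ^ 2 by
        field_simp; ring, Real.exp_add]
    ring
  have e2 : ((s + t) / (4 * (s * t))) ^ (-(α + 1)) = (s + t) ^ (-(α + 1)) /
      (2 ^ (-2 * α - 2) * (s ^ (-(α + 1)) * t ^ (-(α + 1)))) := by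
    rw [Real.div_rpow (by positivity) (by positivity), Real.mul_rpow (by positivity) (by positivity),
      Real.mul_rpow hs.le ht.le, show (4 : ℝ) = 2 ^ (2 : ℝ) by norm_num, ← Real.rpow_mul two_pos.le]
    ring_nf
  have e3 : (2 : ℝ) ^ (-2 * α - 1) = 2 ^ (-2 * α - 2) * 2 := by
    rw [← Real.rpow_add_one two_ne_zero]; ring_nf
  have e4 : Real.exp (-x ^ 2 / (4 * s) + -z ^ 2 / (4 * t)) *
      Real.exp ((x ^ 2 / (16 * s ^ 2) + z ^ 2 / (16 * t ^ 2)) / ((s + t) / (4 * (s * t)))) =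
      Real.exp (-(x ^ 2 + z ^ 2) / (4 * (s + t))) := by
    rw [← Real.exp_add]
    congr 1
    field_simp
    ring
  have e5 : x ^ 2 / (16 * s ^ 2) * (z ^ 2 / (16 * t ^ 2)) / ((s + t) / (4 * (s * t))) ^ 2 =
      (x * z) ^ 2 / (16 * (s + t) ^ 2) := by
    field_simp
    ring
  rw [e, h, e5, e2, besselHeatKernel, ← e4, e3]
  have h1 : (0 : ℝ) < 2 ^ (-2 * α - 2) := by positivity
  have h2 : 0 < s ^ (-(α + 1)) := by positivity
  have h3 : 0 < t ^ (-(α + 1)) := by positivity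
  field_simp

theorem integrableOn_besselHeatKernel (hα : -1 / 2 ≤ α) (ht : 0 < t) {x : ℝ} (hx : 0 < x) :
    IntegrableOn (besselHeatKernel α t x) (Ioi 0) := by
  have h := (integrableOn_gaussian_mul_besselClifford hα (show 0 < 1 / (4 * t) by positivity)
    (show -1 < α + 1 / 2 by linarith) (x ^ 2 / (16 * t ^ 2))).const_mul
    (2 ^ (-2 * α - 1) * t ^ (-(α + 1)) * x ^ (α + 1 / 2) * Real.exp (-x ^ 2 / (4 * t)))
  refine h.congr ?_
  filter_upwards [ae_restrict_mem measurableSet_Ioi] with y hy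
  exact (besselHeatKernel_eq hx hy).symm

theorem Real.Gamma_add_natCast_eq_ascPochhammer {a : ℝ} (ha : 0 < a) (k : ℕ) :
    Real.Gamma (a + k) = Real.Gamma a * (ascPochhammer ℝ k).eval a := by
  induction k with
  | zero => simp
  | succ k ih => rw [Gamma_add_natCast_succ ha, ih, ascPochhammer_succ_eval]; ring

theorem auxH_eq_tsum {η γ : ℝ} (hη : 0 < η) (hγ : 0 < γ) (u : ℝ) :
    auxH η γ u = u ^ (γ - η) * Real.exp (-u) *
      ∑' k : ℕ, Real.Gamma (η + k) / (Real.Gamma (γ + k) * k.factorial) * u ^ k := by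
  have h : ∀ k : ℕ, Real.Gamma (η + k) / (Real.Gamma (γ + k) * k.factorial) * u ^ k =
      Real.Gamma η / Real.Gamma γ * ((ascPochhammer ℝ k).eval η / (ascPochhammer ℝ k).eval γ *
        u ^ k / (k.factorial : ℝ)) := by
    intro k
    rw [Real.Gamma_add_natCast_eq_ascPochhammer hη, Real.Gamma_add_natCast_eq_ascPochhammer hγ]
    simp only [div_eq_mul_inv, mul_inv]
    ring
  simp_rw [h]
  rw [tsum_mul_left, auxH, confluentHypergeometric]
  ring

/-- Termwise Gaussian moments: the `k`-th moment contributes `Γ(α/2 + 3/4 + k)` and the Taylor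
coefficient `1 / (k! Γ(α+1+k))`, which together form the series of `₁F₁`. -/
theorem integral_besselHeatKernel (hα : -1 / 2 ≤ α) (ht : 0 < t) {x : ℝ} (hx : 0 < x) :
    ∫ y in Ioi (0 : ℝ), besselHeatKernel α t x y =
      auxH (α / 2 + 3 / 4) (α + 1) (x ^ 2 / (4 * t)) := by
  have hp : 0 < 1 / (4 * t) := by positivity
  have h := hasSum_integral_gaussian_mul_besselClifford hα hp
    (show -1 < α + 1 / 2 by linarith) (x ^ 2 / (16 * t ^ 2))
  have h4 : (0 : ℝ) < 4 * t := by positivity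
  rw [setIntegral_congr_fun measurableSet_Ioi fun y hy => besselHeatKernel_eq hx hy,
    integral_const_mul, ← h.tsum_eq, auxH_eq_tsum (by linarith) (by linarith)]
  have e : ∀ k : ℕ, cliffordCoeff α k * (x ^ 2 / (16 * t ^ 2)) ^ k *
      ((1 / (4 * t)) ^ (-((α + 1 / 2 + 1) / 2 + k)) *
        Real.Gamma ((α + 1 / 2 + 1) / 2 + k) / 2) =
      (4 * t) ^ (α / 2 + 3 / 4) / 2 * (Real.Gamma (α / 2 + 3 / 4 + k) /
        (Real.Gamma (α + 1 + k) * k.factorial) * (x ^ 2 / (4 * t)) ^ k) := by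
    intro k
    rw [show (α + 1 / 2 + 1) / 2 = α / 2 + 3 / 4 by ring, one_div, Real.inv_rpow h4.le,
      Real.rpow_neg h4.le, inv_inv, Real.rpow_add h4, Real.rpow_natCast, cliffordCoeff,
      show x ^ 2 / (16 * t ^ 2) = x ^ 2 / (4 * t) * (4 * t)⁻¹ by field_simp; ring, mul_pow,
      inv_pow, show (k : ℝ) + α + 1 = α + 1 + k by ring]
    have : 0 < (4 * t) ^ k := by positivity
    field_simp
  simp_rw [e]
  rw [tsum_mul_left, show α + 1 - (α / 2 + 3 / 4) = α / 2 + 1 / 4 by ring,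
    Real.div_rpow (by positivity) h4.le, ← Real.rpow_natCast x 2, ← Real.rpow_mul hx.le,
    show ((2 : ℕ) : ℝ) * (α / 2 + 1 / 4) = α + 1 / 2 by push_cast; ring]
  have e1 : (2 : ℝ) ^ (-2 * α - 1) * t ^ (-(α + 1)) = 2 * (4 * t) ^ (-(α + 1)) := by
    rw [Real.mul_rpow (by norm_num) ht.le, show (4 : ℝ) = 2 ^ (2 : ℝ) by norm_num,
      ← Real.rpow_mul two_pos.le, show -2 * α - 1 = 2 * (-(α + 1)) + 1 by ring,
      Real.rpow_add_one two_ne_zero]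
    ring
  have e2 : (4 * t) ^ (-(α + 1)) * (4 * t) ^ (α / 2 + 3 / 4) = ((4 * t) ^ (α / 2 + 1 / 4))⁻¹ := by
    rw [← Real.rpow_add h4, ← Real.rpow_neg h4.le]
    ring_nf
  rw [e1, div_eq_mul_inv (x ^ (α + 1 / 2)), ← e2, neg_div]
  ring

/-- For fixed `x` the heat kernel is bounded in `y`. -/
theorem exists_besselHeatKernel_le (hα : -1 / 2 ≤ α) (ht : 0 < t) {x : ℝ} (hx : 0 < x) :
    ∃ C, ∀ y, 0 < y → besselHeatKernel α t x y ≤ C := by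
  have ha : 0 ≤ α + 1 / 2 := by linarith
  -- The total exponential rate in `y`: `y ^ (α + 1/2) ≤ exp ((α + 1/2) y)`, and the rest comes from
  -- the entire series. The maximum of `b y - y²/(4t)` is `b² t`.
  set b := α + 1 / 2 + 2 * √(x ^ 2 / (16 * t ^ 2)) with hb
  set D := 2 ^ (-2 * α - 1) * t ^ (-(α + 1)) * x ^ (α + 1 / 2) * Real.exp (-x ^ 2 / (4 * t))
  refine ⟨D * ((Real.Gamma (α + 1))⁻¹ * Real.exp (b ^ 2 * t)), fun y hy => ?_⟩
  rw [besselHeatKernel_eq hx hy]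
  have h1 : y ^ (α + 1 / 2) ≤ Real.exp ((α + 1 / 2) * y) := by
    rw [mul_comm, Real.exp_mul]
    exact Real.rpow_le_rpow hy.le (by linarith [Real.add_one_le_exp y]) ha
  have h2 := (le_abs_self _).trans (abs_besselClifford_mul_sq_le hα (x ^ 2 / (16 * t ^ 2)) y)
  rw [abs_of_pos hy, abs_of_nonneg (by positivity)] at h2
  have hG : 0 < Real.Gamma (α + 1) := Real.Gamma_pos_of_pos (by linarith)
  have hE : 0 ≤ besselClifford α (x ^ 2 / (16 * t ^ 2) * y ^ 2) :=
    besselClifford_nonneg hα (by positivity)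
  refine mul_le_mul_of_nonneg_left ?_ (by positivity)
  calc _ ≤ Real.exp ((α + 1 / 2) * y) * Real.exp (-(1 / (4 * t)) * y ^ 2) *
        ((Real.Gamma (α + 1))⁻¹ * Real.exp (2 * √(x ^ 2 / (16 * t ^ 2)) * y)) := by gcongr
    _ = (Real.Gamma (α + 1))⁻¹ * Real.exp (b * y - y ^ 2 / (4 * t)) := by
        rw [hb, show (α + 1 / 2 + 2 * √(x ^ 2 / (16 * t ^ 2))) * y - y ^ 2 / (4 * t) =
          (α + 1 / 2) * y + -(1 / (4 * t)) * y ^ 2 + 2 * √(x ^ 2 / (16 * t ^ 2)) * y by ring,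
          Real.exp_add, Real.exp_add]
        ring
    _ ≤ _ := by
        have e : b ^ 2 * t - (b * y - y ^ 2 / (4 * t)) = (2 * b * t - y) ^ 2 / (4 * t) := by
          field_simp; ring
        have : 0 ≤ (2 * b * t - y) ^ 2 / (4 * t) := by positivity
        have : b * y - y ^ 2 / (4 * t) ≤ b ^ 2 * t := by linarith
        gcongr

end Kernel

/-! ### Euler's integral and bounds for `auxH` -/

/-- Finiteness, like the value of the integral below, comes from the beta density having total mass
one. -/
theorem integrableOn_beta {a b : ℝ} (ha : 0 < a) (hb : 0 < b) :
    IntegrableOn (fun x : ℝ => x ^ (a - 1) * (1 - x) ^ (b - 1)) (Ioo 0 1) := by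
  have h := (ProbabilityTheory.lintegral_betaPDF (α := a) (β := b)).symm.trans
    (ProbabilityTheory.lintegral_betaPDF_eq_one ha hb)
  have hB := ProbabilityTheory.beta_pos ha hb
  have hi : IntegrableOn (fun x : ℝ => 1 / ProbabilityTheory.beta a b * x ^ (a - 1) *
      (1 - x) ^ (b - 1)) (Ioo 0 1) := by
    refine (lintegral_ofReal_ne_top_iff_integrable ?_ ?_).1 (by rw [h]; simp)
    · exact Measurable.aestronglyMeasurable (by fun_prop)
    · filter_upwards [ae_restrict_mem measurableSet_Ioo] with x hx
      have := hx.1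
      have : 0 < 1 - x := by linarith [hx.2]
      simp only [Pi.zero_apply]
      positivity
  refine (hi.const_mul (ProbabilityTheory.beta a b)).congr (Eventually.of_forall fun x => ?_)
  simp only
  field_simp

theorem integral_beta {a b : ℝ} (ha : 0 < a) (hb : 0 < b) :
    ∫ x in Ioo (0 : ℝ) 1, x ^ (a - 1) * (1 - x) ^ (b - 1) =
      Real.Gamma a * Real.Gamma b / Real.Gamma (a + b) := by
  have h := (ProbabilityTheory.lintegral_betaPDF (α := a) (β := b)).symm.trans
    (ProbabilityTheory.lintegral_betaPDF_eq_one ha hb)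
  have hB := ProbabilityTheory.beta_pos ha hb
  have h2 := integral_eq_lintegral_of_nonneg_ae (μ := volume.restrict (Ioo (0 : ℝ) 1))
    (f := fun x : ℝ => 1 / ProbabilityTheory.beta a b * x ^ (a - 1) *
      (1 - x) ^ (b - 1)) ?_ (Measurable.aestronglyMeasurable (by fun_prop))
  · rw [h, ENNReal.toReal_one] at h2
    simp_rw [mul_assoc] at h2
    rw [integral_const_mul] at h2
    rw [one_div_mul_eq_div, div_eq_one_iff_eq hB.ne'] at h2
    exact h2
  · filter_upwards [ae_restrict_mem measurableSet_Ioo] with x hx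
    have := hx.1
    have : 0 < 1 - x := by linarith [hx.2]
    simp only [Pi.zero_apply]
    positivity

section AuxH

variable {η δ : ℝ}

theorem integrableOn_beta_mul_exp (hη : 0 < η) (hδ : 0 < δ) (c u : ℝ) :
    IntegrableOn (fun r : ℝ => r ^ (δ - 1) * (1 - r) ^ (η - 1) * Real.exp (c + u * r))
      (Ioo 0 1) := by
  refine Integrable.mono' ((integrableOn_beta hδ hη).mul_const (Real.exp (|c| + |u|)))
    (Measurable.aestronglyMeasurable (by fun_prop)) ?_
  filter_upwards [ae_restrict_mem measurableSet_Ioo] with r hr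
  have h0 := hr.1
  have h1 : 0 < 1 - r := by linarith [hr.2]
  rw [Real.norm_eq_abs, abs_of_pos (by positivity)]
  have : c + u * r ≤ |c| + |u| := by
    have h3 := le_abs_self c
    have h4 : u * r ≤ |u| * r := by gcongr; exact le_abs_self u
    have h5 : |u| * r ≤ |u| := mul_le_of_le_one_right (abs_nonneg u) hr.2.le
    linarith
  gcongr

/-- Euler's integral for `₁F₁` after the reflection `r ↦ 1 - r`, which cancels the factor `exp
(-u)`. Without the weight `(1-r)^(η-1)` and over all of `(0, ∞)` the right side would be exactly `1`
for `u > 0`, so the size of `auxH` is decided by the weight and the tail. -/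
theorem auxH_eq_integral (hη : 0 < η) (hδ : 0 < δ) (u : ℝ) :
    auxH η (η + δ) u = (Real.Gamma δ)⁻¹ *
      (u ^ δ * ∫ r in Ioo (0 : ℝ) 1, r ^ (δ - 1) * (1 - r) ^ (η - 1) * Real.exp (-(u * r))) := by
  have hG := (Real.Gamma_pos_of_pos hδ).ne'
  have key := hasSum_integral_of_dominated_convergence (μ := volume.restrict (Ioo (0 : ℝ) 1))
    (F := fun (k : ℕ) r => r ^ (δ - 1) * (1 - r) ^ (η - 1) *
      ((u * (1 - r)) ^ k / (k.factorial : ℝ)))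
    (f := fun r => r ^ (δ - 1) * (1 - r) ^ (η - 1) * Real.exp (u * (1 - r)))
    (fun k r => r ^ (δ - 1) * (1 - r) ^ (η - 1) * ((|u| * (1 - r)) ^ k / (k.factorial : ℝ)))
    (fun k => Measurable.aestronglyMeasurable (by fun_prop)) ?_ ?_ ?_ ?_
  · have hterm : ∀ k : ℕ, ∫ r in Ioo (0 : ℝ) 1, r ^ (δ - 1) * (1 - r) ^ (η - 1) *
        ((u * (1 - r)) ^ k / (k.factorial : ℝ)) = Real.Gamma δ * (Real.Gamma (η + k) /
          (Real.Gamma (η + δ + k) * k.factorial) * u ^ k) := by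
      intro k
      have h := integral_beta hδ (show 0 < η + k by positivity)
      rw [show δ + (η + k) = η + δ + k by ring] at h
      have e : ∫ r in Ioo (0 : ℝ) 1, r ^ (δ - 1) * (1 - r) ^ (η - 1) *
          ((u * (1 - r)) ^ k / (k.factorial : ℝ)) =
          u ^ k / k.factorial * ∫ r in Ioo (0 : ℝ) 1, r ^ (δ - 1) * (1 - r) ^ (η + k - 1) := by
        rw [← integral_const_mul]
        refine setIntegral_congr_fun measurableSet_Ioo fun r hr => ?_
        have h1 : 0 < 1 - r := by linarith [hr.2]
        rw [show η + k - 1 = η - 1 + k by ring, Real.rpow_add h1, Real.rpow_natCast, mul_pow]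
        ring
      rw [e, h]
      simp only [div_eq_mul_inv, mul_inv]
      ring
    simp_rw [hterm] at key
    have h := key.tsum_eq
    rw [tsum_mul_left] at h
    have e : ∫ r in Ioo (0 : ℝ) 1, r ^ (δ - 1) * (1 - r) ^ (η - 1) * Real.exp (u * (1 - r)) =
        Real.exp u * ∫ r in Ioo (0 : ℝ) 1, r ^ (δ - 1) * (1 - r) ^ (η - 1) *
          Real.exp (-(u * r)) := by
      rw [← integral_const_mul]
      congr 1
      funext r
      rw [show u * (1 - r) = u + -(u * r) by ring, Real.exp_add]
      ring
    rw [e] at h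
    rw [auxH_eq_tsum hη (by linarith), show η + δ - η = δ by ring, eq_inv_mul_iff_mul_eq₀ hG]
    calc _ = u ^ δ * Real.exp (-u) * (Real.Gamma δ * ∑' k : ℕ, Real.Gamma (η + k) /
          (Real.Gamma (η + δ + k) * k.factorial) * u ^ k) := by ring
      _ = _ := by
        rw [h, mul_assoc, ← mul_assoc (Real.exp (-u)), ← Real.exp_add, neg_add_cancel,
          Real.exp_zero, one_mul]
  · intro k
    filter_upwards [ae_restrict_mem measurableSet_Ioo] with r hr
    have h0 := hr.1
    have h1 : 0 < 1 - r := by linarith [hr.2]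
    rw [norm_mul, norm_div, norm_pow, norm_mul u, Real.norm_of_nonneg h1.le, Real.norm_natCast,
      Real.norm_of_nonneg (by positivity), Real.norm_eq_abs]
  · exact Eventually.of_forall fun r =>
      ((Real.summable_norm_pow_div_factorial _).of_norm.mul_left _)
  · simp_rw [tsum_mul_left, Real.tsum_pow_div_factorial]
    refine (integrableOn_beta_mul_exp hη hδ |u| (-|u|)).congr (Eventually.of_forall fun r => ?_)
    simp only
    rw [show |u| + -|u| * r = |u| * (1 - r) by ring]
  · refine Eventually.of_forall fun r => ?_
    rw [← Real.tsum_pow_div_factorial]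
    exact (Real.summable_norm_pow_div_factorial _).of_norm.hasSum.mul_left _

theorem integrableOn_rpow_mul_exp_neg_mul {a u : ℝ} (ha : 0 < a) (hu : 0 < u) :
    IntegrableOn (fun r : ℝ => r ^ (a - 1) * Real.exp (-(u * r))) (Ioi 0) := by
  by_contra h
  have h2 := Real.integral_rpow_mul_exp_neg_mul_Ioi ha hu
  rw [integral_undef h] at h2
  have : 0 < (1 / u) ^ a * Real.Gamma a := mul_pos (by positivity) (Real.Gamma_pos_of_pos ha)
  linarith

theorem rpow_mul_integral_rpow_mul_exp_neg_mul {a u : ℝ} (ha : 0 < a) (hu : 0 < u) :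
    u ^ a * ∫ r in Ioi (0 : ℝ), r ^ (a - 1) * Real.exp (-(u * r)) = Real.Gamma a := by
  rw [Real.integral_rpow_mul_exp_neg_mul_Ioi ha hu, one_div, Real.inv_rpow hu.le,
    mul_inv_cancel_left₀ (by positivity)]

theorem setIntegral_Ioi_zero_eq_add {g : ℝ → ℝ} (hg : IntegrableOn g (Ioi 0)) :
    ∫ r in Ioi (0 : ℝ), g r = (∫ r in Ioo (0 : ℝ) 1, g r) + ∫ r in Ici (1 : ℝ), g r := by
  rw [← Ioo_union_Ici_eq_Ioi (show (0 : ℝ) < 1 by norm_num)]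
  refine setIntegral_union (disjoint_left.2 fun x hx hx' => not_le.2 hx.2 hx') measurableSet_Ici
    (hg.mono_set Ioo_subset_Ioi_self) (hg.mono_set (Ici_subset_Ioi.2 one_pos))

/-- The weight is at most `1`; strictness comes from the missing interval `[1, ∞)`, hence also holds
at `η = 1`. -/
theorem auxH_lt_one (hη : 1 ≤ η) (hδ : 0 < δ) {u : ℝ} (hu : 0 < u) : auxH η (η + δ) u < 1 := by
  have hG := Real.Gamma_pos_of_pos hδ
  have hI := integrableOn_rpow_mul_exp_neg_mul hδ hu
  rw [auxH_eq_integral (by linarith) hδ, inv_mul_lt_iff₀ hG, mul_one,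
    ← rpow_mul_integral_rpow_mul_exp_neg_mul hδ hu]
  gcongr
  have h1 : ∫ r in Ioo (0 : ℝ) 1, r ^ (δ - 1) * (1 - r) ^ (η - 1) * Real.exp (-(u * r)) ≤
      ∫ r in Ioo (0 : ℝ) 1, r ^ (δ - 1) * Real.exp (-(u * r)) := by
    have hi := integrableOn_beta_mul_exp (show 0 < η by linarith) hδ 0 (-u)
    simp only [zero_add, neg_mul] at hi
    refine setIntegral_mono_on hi (hI.mono_set Ioo_subset_Ioi_self) measurableSet_Ioo fun r hr => ?_
    have h0 := hr.1
    have h1 : 0 < 1 - r := by linarith [hr.2]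
    have : (1 - r) ^ (η - 1) ≤ 1 := Real.rpow_le_one h1.le (by linarith) (by linarith)
    have h3 : 0 < r ^ (δ - 1) := by positivity
    gcongr
    exact mul_le_of_le_one_right h3.le this
  refine h1.trans_lt ?_
  rw [setIntegral_Ioi_zero_eq_add hI]
  refine lt_add_of_pos_right _ ?_
  rw [setIntegral_pos_iff_support_of_nonneg_ae]
  · have : Ici (1 : ℝ) ⊆ Function.support fun r : ℝ => r ^ (δ - 1) * Real.exp (-(u * r)) := by
      intro r hr
      have : 0 < r := lt_of_lt_of_le one_pos hr
      exact (by positivity : 0 < r ^ (δ - 1) * Real.exp (-(u * r))).ne'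
    rw [inter_eq_right.2 this]
    simp
  · filter_upwards [ae_restrict_mem measurableSet_Ici] with r hr
    have : 0 < r := lt_of_lt_of_le one_pos hr
    simp only [Pi.zero_apply]
    positivity
  · exact hI.mono_set (Ici_subset_Ioi.2 one_pos)

/-- The interval is split at `1/2`. To the left the weight is at most `2^(1-η)` and the Gamma
integral remains. To the right `(u r)^δ ≤ exp (u r)` bounds everything but the weight by `1/r ≤ 2`,
and the weight is integrable. -/
theorem exists_auxH_le (hη : 0 < η) (hη1 : η ≤ 1) (hδ : 0 < δ) (hδ1 : δ ≤ 1) :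
    ∃ c, ∀ u, 0 < u → auxH η (η + δ) u ≤ c := by
  have hG := Real.Gamma_pos_of_pos hδ
  refine ⟨(Real.Gamma δ)⁻¹ * (2 ^ (1 - η) * Real.Gamma δ +
    -- The trivial factor `r ^ (1 - 1)` puts the integral in the beta form with first parameter `1`.
    2 * ∫ r in Ioo (0 : ℝ) 1, r ^ ((1 : ℝ) - 1) * (1 - r) ^ (η - 1)), fun u hu => ?_⟩
  rw [auxH_eq_integral hη hδ]
  have hI := integrableOn_rpow_mul_exp_neg_mul hδ hu
  have hb := integrableOn_beta one_pos hη
  gcongr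
  calc u ^ δ * ∫ r in Ioo (0 : ℝ) 1, r ^ (δ - 1) * (1 - r) ^ (η - 1) * Real.exp (-(u * r))
      = ∫ r in Ioo (0 : ℝ) 1, u ^ δ * (r ^ (δ - 1) * (1 - r) ^ (η - 1) * Real.exp (-(u * r))) := by
        rw [integral_const_mul]
    _ ≤ ∫ r in Ioo (0 : ℝ) 1, (2 ^ (1 - η) * u ^ δ * (r ^ (δ - 1) * Real.exp (-(u * r))) +
          2 * (r ^ ((1 : ℝ) - 1) * (1 - r) ^ (η - 1))) := by
        have hi := integrableOn_beta_mul_exp hη hδ 0 (-u)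
        simp only [zero_add, neg_mul] at hi
        refine setIntegral_mono_on (hi.const_mul _) (((hI.mono_set Ioo_subset_Ioi_self).const_mul
          _).add (hb.const_mul _)) measurableSet_Ioo fun r hr => ?_
        have h0 := hr.1
        have h1 : 0 < 1 - r := by linarith [hr.2]
        rw [sub_self, Real.rpow_zero, one_mul]
        rcases le_total r (1 / 2) with h | h
        · have : (1 - r) ^ (η - 1) ≤ 2 ^ (1 - η) := by
            rw [← neg_sub 1 η, Real.rpow_neg h1.le, ← Real.inv_rpow h1.le]
            refine Real.rpow_le_rpow (by positivity) ?_ (by linarith)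
            rw [inv_le_comm₀ h1 two_pos]
            linarith
          have : 0 ≤ 2 * (1 - r) ^ (η - 1) := by positivity
          calc _ ≤ u ^ δ * (r ^ (δ - 1) * 2 ^ (1 - η) * Real.exp (-(u * r))) := by gcongr
            _ ≤ _ := by linarith
        · have h2 : u ^ δ * r ^ (δ - 1) * Real.exp (-(u * r)) ≤ 2 := by
            have hur : 0 < u * r := by positivity
            have : (u * r) ^ δ ≤ Real.exp (u * r) := by
              calc (u * r) ^ δ ≤ (Real.exp (u * r)) ^ δ :=
                    Real.rpow_le_rpow hur.le (by linarith [Real.add_one_le_exp (u * r)]) hδ.le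
                _ ≤ (Real.exp (u * r)) ^ (1 : ℝ) :=
                    Real.rpow_le_rpow_of_exponent_le (Real.one_le_exp hur.le) hδ1
                _ = _ := Real.rpow_one _
            calc u ^ δ * r ^ (δ - 1) * Real.exp (-(u * r))
                = (u * r) ^ δ * Real.exp (-(u * r)) * r⁻¹ := by
                  rw [Real.rpow_sub_one h0.ne', Real.mul_rpow hu.le h0.le]; ring
              _ ≤ Real.exp (u * r) * Real.exp (-(u * r)) * r⁻¹ := by gcongr
              _ = r⁻¹ := by rw [← Real.exp_add, add_neg_cancel, Real.exp_zero, one_mul]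
              _ ≤ 2 := by rw [inv_le_comm₀ h0 two_pos]; linarith
          have : 0 ≤ 2 ^ (1 - η) * u ^ δ * (r ^ (δ - 1) * Real.exp (-(u * r))) := by positivity
          calc _ = u ^ δ * r ^ (δ - 1) * Real.exp (-(u * r)) * (1 - r) ^ (η - 1) := by ring
            _ ≤ 2 * (1 - r) ^ (η - 1) := by gcongr
            _ ≤ _ := by linarith
    _ = 2 ^ (1 - η) * (u ^ δ * ∫ r in Ioo (0 : ℝ) 1, r ^ (δ - 1) * Real.exp (-(u * r))) +
          2 * ∫ r in Ioo (0 : ℝ) 1, r ^ ((1 : ℝ) - 1) * (1 - r) ^ (η - 1) := by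
        rw [integral_add ((hI.mono_set Ioo_subset_Ioi_self).const_mul _) (hb.const_mul _),
          integral_const_mul, integral_const_mul, mul_assoc]
    _ ≤ _ := by
        rw [← rpow_mul_integral_rpow_mul_exp_neg_mul hδ hu]
        gcongr ?_ * (_ * ?_) + _
        refine setIntegral_mono_set hI ?_ Ioo_subset_Ioi_self.eventuallyLE
        filter_upwards [ae_restrict_mem measurableSet_Ioi] with r hr
        have : 0 < r := hr
        simp only [Pi.zero_apply]
        positivity

theorem one_add_mul_le_one_sub_rpow {r : ℝ} (hr : r < 1) {s : ℝ} (hs : 0 ≤ s) :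
    1 + s * r ≤ (1 - r) ^ (-s) := by
  have h1 : 0 < 1 - r := by linarith
  rw [Real.rpow_def_of_pos h1]
  have h2 : Real.log (1 - r) ≤ -r := by linarith [Real.log_le_sub_one_of_pos h1]
  have h3 := Real.add_one_le_exp (s * r)
  have h4 : s * r ≤ Real.log (1 - r) * -s := by nlinarith
  have h5 := Real.exp_le_exp.2 h4
  linarith

/-- By Bernoulli the weight is at least `1 + (1-η) r`. The linear term integrates to a multiple of
`u^(-δ-1)`, while the lost tail over `[1, ∞)` is at most a multiple of `u^(-δ-2)`. -/
theorem exists_one_lt_auxH (hη : 0 < η) (hη1 : η < 1) (hδ : 0 < δ) :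
    ∃ u₀ > 0, ∀ u, u₀ ≤ u → 1 < auxH η (η + δ) u := by
  have hG := Real.Gamma_pos_of_pos hδ
  have hG1 := Real.Gamma_pos_of_pos (show 0 < δ + 1 by linarith)
  have hG2 := Real.Gamma_pos_of_pos (show 0 < δ + 2 by linarith)
  -- The quotient is the value of `u` at which the tail bound `2 J2` equals the gain `(1 - η) J1`;
  -- adding `1` makes the inequality strict.
  refine ⟨2 * Real.Gamma (δ + 2) / ((1 - η) * Real.Gamma (δ + 1)) + 1, ?_, fun u hu => ?_⟩
  · have : 0 < 1 - η := by linarith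
    positivity
  have hs : 0 < 1 - η := by linarith
  have hu0 : 0 < u := lt_of_lt_of_le (by positivity) hu
  have hu1 : 2 * Real.Gamma (δ + 2) / ((1 - η) * Real.Gamma (δ + 1)) < u := by linarith
  rw [div_lt_iff₀ (by positivity)] at hu1
  rw [auxH_eq_integral hη hδ, lt_inv_mul_iff₀ hG, mul_one]
  have hI0 := integrableOn_rpow_mul_exp_neg_mul hδ hu0
  have hI1 := integrableOn_rpow_mul_exp_neg_mul (show 0 < δ + 1 by linarith) hu0
  have hI2 := integrableOn_rpow_mul_exp_neg_mul (show 0 < δ + 2 by linarith) hu0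
  have e0 := rpow_mul_integral_rpow_mul_exp_neg_mul hδ hu0
  have e1 := rpow_mul_integral_rpow_mul_exp_neg_mul (show 0 < δ + 1 by linarith) hu0
  have e2 := rpow_mul_integral_rpow_mul_exp_neg_mul (show 0 < δ + 2 by linarith) hu0
  rw [show δ + 1 - 1 = δ by ring] at e1 hI1
  rw [show δ + 2 - 1 = δ + 1 by ring] at e2 hI2
  set g : ℝ → ℝ := fun r => r ^ (δ - 1) * Real.exp (-(u * r)) +
    (1 - η) * (r ^ δ * Real.exp (-(u * r))) with hg
  have hgI : IntegrableOn g (Ioi 0) := hI0.add (hI1.const_mul _)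
  have hlow : ∫ r in Ioo (0 : ℝ) 1, g r ≤
      ∫ r in Ioo (0 : ℝ) 1, r ^ (δ - 1) * (1 - r) ^ (η - 1) * Real.exp (-(u * r)) := by
    have hi := integrableOn_beta_mul_exp hη hδ 0 (-u)
    simp only [zero_add, neg_mul] at hi
    refine setIntegral_mono_on (hgI.mono_set Ioo_subset_Ioi_self) hi measurableSet_Ioo
      fun r hr => ?_
    have h0 := hr.1
    have h := one_add_mul_le_one_sub_rpow hr.2 hs.le
    rw [neg_sub] at h
    calc g r = r ^ (δ - 1) * (1 + (1 - η) * r) * Real.exp (-(u * r)) := by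
          rw [hg]
          have : r ^ δ = r ^ (δ - 1) * r := by rw [← Real.rpow_add_one h0.ne']; ring_nf
          simp only [this]
          ring
      _ ≤ _ := by gcongr
  have htail : ∫ r in Ici (1 : ℝ), g r ≤
      2 * ∫ r in Ioi (0 : ℝ), r ^ (δ + 1) * Real.exp (-(u * r)) := by
    have hsub : Ici (1 : ℝ) ⊆ Ioi 0 := Ici_subset_Ioi.2 one_pos
    rw [← integral_const_mul]
    refine (setIntegral_mono_on (hgI.mono_set hsub) ((hI2.mono_set hsub).const_mul 2)
      measurableSet_Ici fun r hr => ?_).trans (setIntegral_mono_set (hI2.const_mul 2) ?_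
        hsub.eventuallyLE)
    · have hr1 : 1 ≤ r := hr
      have hr0 : 0 < r := hsub hr
      have h1 : r ^ (δ - 1) ≤ r ^ (δ + 1) :=
        Real.rpow_le_rpow_of_exponent_le hr1 (by linarith)
      have h2 : r ^ δ ≤ r ^ (δ + 1) := Real.rpow_le_rpow_of_exponent_le hr1 (by linarith)
      have h3 : (1 - η) * (r ^ δ * Real.exp (-(u * r))) ≤
          1 * (r ^ (δ + 1) * Real.exp (-(u * r))) := by
        gcongr
        linarith
      have h4 : r ^ (δ - 1) * Real.exp (-(u * r)) ≤ r ^ (δ + 1) * Real.exp (-(u * r)) := by gcongr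
      simp only [hg]
      linarith
    · filter_upwards [ae_restrict_mem measurableSet_Ioi] with r hr
      have : 0 < r := hr
      simp only [Pi.zero_apply]
      positivity
  have hsplit := setIntegral_Ioi_zero_eq_add hgI
  have htot : ∫ r in Ioi (0 : ℝ), g r = (∫ r in Ioi (0 : ℝ), r ^ (δ - 1) * Real.exp (-(u * r))) +
      (1 - η) * ∫ r in Ioi (0 : ℝ), r ^ δ * Real.exp (-(u * r)) := by
    rw [hg, integral_add hI0 (hI1.const_mul _), integral_const_mul]
  set J0 := ∫ r in Ioi (0 : ℝ), r ^ (δ - 1) * Real.exp (-(u * r))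
  set J1 := ∫ r in Ioi (0 : ℝ), r ^ δ * Real.exp (-(u * r))
  set J2 := ∫ r in Ioi (0 : ℝ), r ^ (δ + 1) * Real.exp (-(u * r))
  have hJ : J0 < ∫ r in Ioo (0 : ℝ) 1, r ^ (δ - 1) * (1 - r) ^ (η - 1) * Real.exp (-(u * r)) := by
    refine lt_of_lt_of_le ?_ hlow
    have hJ2 : 2 * J2 < (1 - η) * J1 := by
      have hu2 : 0 < u ^ (δ + 2) := by positivity
      rw [← mul_lt_mul_iff_right₀ hu2]
      have : u ^ (δ + 2) = u ^ (δ + 1) * u := by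
        rw [← Real.rpow_add_one hu0.ne']; ring_nf
      calc u ^ (δ + 2) * (2 * J2) = 2 * Real.Gamma (δ + 2) := by rw [← e2]; ring
        _ < u * ((1 - η) * Real.Gamma (δ + 1)) := hu1
        _ = _ := by rw [← e1, this]; ring
    linarith
  rw [← e0]
  gcongr

end AuxH

theorem auxH_half_half {u : ℝ} (hu : 0 < u) : auxH (1 / 2) (1 / 2) u = 1 := by
  rw [auxH_eq_tsum one_half_pos one_half_pos, sub_self, Real.rpow_zero, one_mul]
  have : ∀ k : ℕ, Real.Gamma (1 / 2 + k) / (Real.Gamma (1 / 2 + k) * k.factorial) * u ^ k =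
      u ^ k / (k.factorial : ℝ) := by
    intro k
    have := (Real.Gamma_pos_of_pos (show (0 : ℝ) < 1 / 2 + k by positivity)).ne'
    field_simp
  simp_rw [this]
  rw [Real.tsum_pow_div_factorial, ← Real.exp_add, neg_add_cancel, Real.exp_zero]

/-- The supremum of `T_t 1` is finite for every order, and at most one outside `(-1/2, 1/2)`. -/
theorem exists_auxH_bessel_le {α : ℝ} (hα : -1 / 2 ≤ α) :
    ∃ c : ℝ, 1 < c ∧ ∀ u, 0 < u → auxH (α / 2 + 3 / 4) (α + 1) u ≤ c := by
  rcases hα.eq_or_lt with h | h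
  -- At `α = -1/2` the two parameters of `auxH` coincide, so Euler's integral is not available and
  -- the series is an exponential.
  · refine ⟨2, one_lt_two, fun u hu => ?_⟩
    rw [← h]
    norm_num [auxH_half_half hu]
  have e : α + 1 = (α / 2 + 3 / 4) + (α / 2 + 1 / 4) := by ring
  rw [e]
  rcases le_total α (1 / 2) with h2 | h2
  · obtain ⟨c, hc⟩ := exists_auxH_le (η := α / 2 + 3 / 4) (δ := α / 2 + 1 / 4) (by linarith)
      (by linarith) (by linarith) (by linarith)
    -- The maximum with `2` only serves `1 < c`.
    exact ⟨max c 2, lt_max_of_lt_right one_lt_two, fun u hu => (hc u hu).trans (le_max_left _ _)⟩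
  · exact ⟨2, one_lt_two, fun u hu =>
      (auxH_lt_one (by linarith) (by linarith) hu).le.trans one_le_two⟩

theorem auxH_bessel_lt_one {α : ℝ} (hα : 1 / 2 ≤ α) {u : ℝ} (hu : 0 < u) :
    auxH (α / 2 + 3 / 4) (α + 1) u < 1 := by
  have h := auxH_lt_one (η := α / 2 + 3 / 4) (δ := α / 2 + 1 / 4) (by linarith) (by linarith) hu
  rwa [show α / 2 + 3 / 4 + (α / 2 + 1 / 4) = α + 1 by ring] at h

theorem auxH_bessel_neg_half {u : ℝ} (hu : 0 < u) :
    auxH ((-1 / 2) / 2 + 3 / 4) (-1 / 2 + 1) u = 1 := by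
  have h := auxH_half_half hu
  norm_num at h ⊢
  exact h

/-! ### Integral operators with symmetric nonnegative kernels -/

section Schur

variable {X 𝕜 : Type*} [MeasurableSpace X] [RCLike 𝕜] {μ : Measure X}
  {k : X → X → ℝ} {c : ℝ≥0∞}

/-- The integral operator with kernel `k`. -/
def kernelOp (μ : Measure X) (k : X → X → ℝ) (f : X → 𝕜) (x : X) : 𝕜 := ∫ y, k x y • f y ∂μ

theorem aestronglyMeasurable_kernel_smul (hk : Measurable (Function.uncurry k)) {f : X → 𝕜}
    (hf : AEStronglyMeasurable f μ) :
    AEStronglyMeasurable (fun q : X × X => k q.1 q.2 • f q.2) (μ.prod μ) :=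
  hk.aestronglyMeasurable.smul hf.comp_snd

theorem enorm_kernelOp_le (f : X → 𝕜) (x : X) :
    ‖kernelOp μ k f x‖ₑ ≤ ∫⁻ y, ‖k x y‖ₑ * ‖f y‖ₑ ∂μ :=
  (enorm_integral_le_lintegral_enorm _).trans_eq (by simp_rw [enorm_smul])

/-- Hölder's inequality for the factorization `K F = K^(1-1/p) (K F^p)^(1/p)`. -/
theorem lintegral_kernel_mul_rpow_le {p : ℝ} (hp : 1 ≤ p) {K F : X → ℝ≥0∞}
    (hK : AEMeasurable K μ) (hF : AEMeasurable F μ) (hc : ∫⁻ y, K y ∂μ ≤ c) :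
    (∫⁻ y, K y * F y ∂μ) ^ p ≤ c ^ (p - 1) * ∫⁻ y, K y * F y ^ p ∂μ := by
  have hp0 : 0 < p := by linarith
  have h := ENNReal.lintegral_mul_norm_pow_le hK (hK.mul (hF.pow_const p))
    (show 0 ≤ 1 - p⁻¹ by linarith [inv_le_one_of_one_le₀ hp]) (inv_nonneg.2 hp0.le) (by ring)
  have e : ∀ y, K y ^ (1 - p⁻¹) * (K y * F y ^ p) ^ p⁻¹ = K y * F y := by
    intro y
    rw [ENNReal.mul_rpow_of_nonneg _ _ (inv_nonneg.2 hp0.le), ENNReal.rpow_rpow_inv hp0.ne',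
      ← mul_assoc, ← ENNReal.rpow_add_of_nonneg _ _
        (by linarith [inv_le_one_of_one_le₀ hp]) (inv_nonneg.2 hp0.le)]
    simp
  simp only [Pi.mul_apply, e] at h
  calc (∫⁻ y, K y * F y ∂μ) ^ p
      ≤ ((∫⁻ y, K y ∂μ) ^ (1 - p⁻¹) * (∫⁻ y, K y * F y ^ p ∂μ) ^ p⁻¹) ^ p := by gcongr
    _ = (∫⁻ y, K y ∂μ) ^ (p - 1) * ∫⁻ y, K y * F y ^ p ∂μ := by
        rw [ENNReal.mul_rpow_of_nonneg _ _ hp0.le, ENNReal.rpow_inv_rpow hp0.ne',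
          ← ENNReal.rpow_mul]
        congr 2
        field_simp
    _ ≤ _ := by gcongr

theorem inner_kernelOp_left (f : X → 𝕜) (x : X) (b : 𝕜) :
    inner 𝕜 (kernelOp μ k f x) b = ∫ y, k x y • (b * starRingEnd 𝕜 (f y)) ∂μ := by
  rw [RCLike.inner_apply, kernelOp, ← integral_conj, ← integral_const_mul]
  congr 1
  funext y
  rw [RCLike.real_smul_eq_coe_mul, RCLike.real_smul_eq_coe_mul, map_mul, RCLike.conj_ofReal]
  ring

variable [SFinite μ]

theorem aestronglyMeasurable_kernelOp (hk : Measurable (Function.uncurry k)) {f : X → 𝕜}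
    (hf : AEStronglyMeasurable f μ) : AEStronglyMeasurable (kernelOp μ k f) μ :=
  (aestronglyMeasurable_kernel_smul hk hf).integral_prod_right'

/-- The bound on the row integrals is used twice: once in Hölder's inequality, and once, through
symmetry and Tonelli, as a bound on the column integrals. -/
theorem lintegral_lintegral_kernel_rpow_le (hk : Measurable (Function.uncurry k))
    (hs : ∀ x y, k x y = k y x) (hc : ∀ᵐ x ∂μ, ∫⁻ y, ‖k x y‖ₑ ∂μ ≤ c) {p : ℝ} (hp : 1 ≤ p)
    {F : X → ℝ≥0∞} (hF : AEMeasurable F μ) :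
    ∫⁻ x, (∫⁻ y, ‖k x y‖ₑ * F y ∂μ) ^ p ∂μ ≤ c ^ p * ∫⁻ y, F y ^ p ∂μ := by
  have hkx : ∀ x, Measurable (k x) := fun x => hk.comp measurable_prodMk_left
  have hm : AEMeasurable (Function.uncurry fun x y => ‖k x y‖ₑ * F y ^ p) (μ.prod μ) :=
    hk.enorm.aemeasurable.mul (hF.comp_snd.pow_const p)
  calc ∫⁻ x, (∫⁻ y, ‖k x y‖ₑ * F y ∂μ) ^ p ∂μ
      ≤ ∫⁻ x, c ^ (p - 1) * ∫⁻ y, ‖k x y‖ₑ * F y ^ p ∂μ ∂μ := by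
        refine lintegral_mono_ae ?_
        filter_upwards [hc] with x hx
        exact lintegral_kernel_mul_rpow_le hp (hkx x).enorm.aemeasurable hF hx
    _ = c ^ (p - 1) * ∫⁻ y, ∫⁻ x, ‖k x y‖ₑ * F y ^ p ∂μ ∂μ := by
        have h1 : AEMeasurable (fun x => ∫⁻ y, ‖k x y‖ₑ * F y ^ p ∂μ) μ := hm.lintegral_prod_right'
        rw [lintegral_const_mul'' _ h1, lintegral_lintegral_swap hm]
    _ ≤ c ^ (p - 1) * ∫⁻ y, c * F y ^ p ∂μ := by
        gcongr _ * ?_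
        refine lintegral_mono_ae ?_
        filter_upwards [hc] with y hy
        simp_rw [hs _ y]
        rw [lintegral_mul_const _ (hkx y).enorm]
        gcongr
    _ = c ^ p * ∫⁻ y, F y ^ p ∂μ := by
        rw [lintegral_const_mul'' _ (hF.pow_const p), ← mul_assoc]
        congr 1
        conv_lhs => rw [← ENNReal.rpow_one c, ← ENNReal.rpow_mul]
        rw [← ENNReal.rpow_add_of_nonneg _ _ (by linarith) zero_le_one]
        ring_nf

/-- The Schur test. -/
theorem eLpNorm_kernelOp_le (hk : Measurable (Function.uncurry k))
    (hs : ∀ x y, k x y = k y x) (hc : ∀ᵐ x ∂μ, ∫⁻ y, ‖k x y‖ₑ ∂μ ≤ c) {p : ℝ≥0∞} (hp : 1 ≤ p)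
    {f : X → 𝕜} (hf : AEStronglyMeasurable f μ) :
    eLpNorm (kernelOp μ k f) p μ ≤ c * eLpNorm f p μ := by
  rcases eq_or_ne p ∞ with rfl | hp'
  · rw [eLpNorm_exponent_top, eLpNorm_exponent_top]
    refine eLpNormEssSup_le_of_ae_enorm_bound ?_
    filter_upwards [hc] with x hx
    refine (enorm_kernelOp_le f x).trans ?_
    calc ∫⁻ y, ‖k x y‖ₑ * ‖f y‖ₑ ∂μ ≤ ∫⁻ y, ‖k x y‖ₑ * eLpNormEssSup f μ ∂μ := by
          refine lintegral_mono_ae ?_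
          filter_upwards [ae_le_eLpNormEssSup (f := f) (μ := μ)] with y hy
          gcongr
      _ = (∫⁻ y, ‖k x y‖ₑ ∂μ) * eLpNormEssSup f μ :=
          lintegral_mul_const _ (hk.comp measurable_prodMk_left).enorm
      _ ≤ _ := by gcongr
  · have hp0 : p ≠ 0 := (zero_lt_one.trans_le hp).ne'
    have hp1 : 1 ≤ p.toReal := by
      rw [← ENNReal.toReal_one]
      exact ENNReal.toReal_mono hp' hp
    have hpp : 0 < p.toReal := by linarith
    rw [eLpNorm_eq_lintegral_rpow_enorm_toReal hp0 hp', eLpNorm_eq_lintegral_rpow_enorm_toReal hp0 hp']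
    have h : ∫⁻ x, ‖kernelOp μ k f x‖ₑ ^ p.toReal ∂μ ≤
        c ^ p.toReal * ∫⁻ y, ‖f y‖ₑ ^ p.toReal ∂μ :=
      (lintegral_mono fun x => by gcongr; exact enorm_kernelOp_le f x).trans
        (lintegral_lintegral_kernel_rpow_le hk hs hc hp1 hf.enorm)
    calc _ ≤ (c ^ p.toReal * ∫⁻ y, ‖f y‖ₑ ^ p.toReal ∂μ) ^ (1 / p.toReal) := by gcongr
      _ = _ := by
        rw [ENNReal.mul_rpow_of_nonneg _ _ (by positivity), one_div, ENNReal.rpow_rpow_inv hpp.ne']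

theorem memLp_kernelOp (hk : Measurable (Function.uncurry k)) (hs : ∀ x y, k x y = k y x)
    (hc : ∀ᵐ x ∂μ, ∫⁻ y, ‖k x y‖ₑ ∂μ ≤ c) (hct : c ≠ ∞) {p : ℝ≥0∞} (hp : 1 ≤ p)
    {f : X → 𝕜} (hf : MemLp f p μ) : MemLp (kernelOp μ k f) p μ :=
  ⟨aestronglyMeasurable_kernelOp hk hf.1,
    (eLpNorm_kernelOp_le hk hs hc hp hf.1).trans_lt (ENNReal.mul_lt_top hct.lt_top hf.2)⟩

/-- Cauchy–Schwarz and the Schur estimate for `|k|`; this licenses Fubini in the symmetry of the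
operator and in the Parseval identity. -/
theorem integrable_kernel_smul_mul_conj (hk : Measurable (Function.uncurry k))
    (hs : ∀ x y, k x y = k y x) (hc : ∀ᵐ x ∂μ, ∫⁻ y, ‖k x y‖ₑ ∂μ ≤ c) (hct : c ≠ ∞)
    {f g : X → 𝕜} (hf : MemLp f 2 μ) (hg : MemLp g 2 μ) :
    Integrable (fun q : X × X => k q.1 q.2 • (g q.1 * starRingEnd 𝕜 (f q.2))) (μ.prod μ) := by
  have hm : AEStronglyMeasurable
      (fun q : X × X => k q.1 q.2 • (g q.1 * starRingEnd 𝕜 (f q.2))) (μ.prod μ) :=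
    hk.aestronglyMeasurable.smul
      (hg.1.comp_fst.mul (RCLike.continuous_conj.comp_aestronglyMeasurable hf.1.comp_snd))
  refine ⟨hm, ?_⟩
  rw [HasFiniteIntegral, lintegral_prod _ hm.enorm]
  have hfin : ∀ {h : X → 𝕜}, MemLp h 2 μ → ∫⁻ x, ‖h x‖ₑ ^ (2 : ℝ) ∂μ < ∞ := fun {h} hh => by
    have := lintegral_rpow_enorm_lt_top_of_eLpNorm_lt_top two_ne_zero ENNReal.ofNat_ne_top hh.2
    simpa using this
  have e : ∀ x, ∫⁻ y, ‖k x y • (g x * starRingEnd 𝕜 (f y))‖ₑ ∂μ =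
      ‖g x‖ₑ * ∫⁻ y, ‖k x y‖ₑ * ‖f y‖ₑ ∂μ := by
    intro x
    have hx : Measurable (k x) := hk.comp measurable_prodMk_left
    have h1 : AEMeasurable (fun y => ‖k x y‖ₑ * ‖f y‖ₑ) μ := hx.enorm.aemeasurable.mul hf.1.enorm
    rw [← lintegral_const_mul'' _ h1]
    refine lintegral_congr fun y => ?_
    have : ‖starRingEnd 𝕜 (f y)‖ₑ = ‖f y‖ₑ := by
      rw [← ofReal_norm, RCLike.norm_conj, ofReal_norm]
    rw [enorm_smul, enorm_mul, this]
    ring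
  simp_rw [e]
  have hm2 : AEMeasurable (fun x => ∫⁻ y, ‖k x y‖ₑ * ‖f y‖ₑ ∂μ) μ :=
    (show AEMeasurable (Function.uncurry fun x y => ‖k x y‖ₑ * ‖f y‖ₑ) (μ.prod μ) from
      hk.enorm.aemeasurable.mul hf.1.enorm.comp_snd).lintegral_prod_right'
  refine (ENNReal.lintegral_mul_le_Lp_mul_Lq μ Real.HolderConjugate.two_two hg.1.enorm
    hm2).trans_lt ?_
  refine ENNReal.mul_lt_top ?_ ?_
  · exact ENNReal.rpow_lt_top_of_nonneg (by norm_num) (hfin hg).ne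
  · refine ENNReal.rpow_lt_top_of_nonneg (by norm_num) (ne_of_lt ?_)
    refine (lintegral_lintegral_kernel_rpow_le hk hs hc one_le_two hf.1.enorm).trans_lt ?_
    exact ENNReal.mul_lt_top (ENNReal.rpow_lt_top_of_nonneg (by norm_num) hct) (hfin hf)

theorem integral_inner_kernelOp (hs : ∀ x y, k x y = k y x) {f g : X → 𝕜}
    (h : Integrable (fun q : X × X => k q.1 q.2 • (g q.1 * starRingEnd 𝕜 (f q.2))) (μ.prod μ)) :
    ∫ x, inner 𝕜 (kernelOp μ k f x) (g x) ∂μ = ∫ x, inner 𝕜 (f x) (kernelOp μ k g x) ∂μ := by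
  have e2 : ∀ x, inner 𝕜 (f x) (kernelOp μ k g x) =
      ∫ y, k y x • (g y * starRingEnd 𝕜 (f x)) ∂μ := by
    intro x
    rw [RCLike.inner_apply, kernelOp, ← integral_mul_const]
    congr 1
    funext y
    rw [hs x y, RCLike.real_smul_eq_coe_mul, RCLike.real_smul_eq_coe_mul]
    ring
  simp_rw [inner_kernelOp_left, e2]
  exact integral_integral_swap h

/-- Composition of two integral operators with nonnegative kernels. -/
theorem kernelOp_kernelOp {k₁ k₂ k₃ : X → X → ℝ} (h₁ : Measurable (Function.uncurry k₁))
    (h₂ : Measurable (Function.uncurry k₂)) (n₁ : ∀ x y, 0 ≤ k₁ x y) (n₂ : ∀ x y, 0 ≤ k₂ x y)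
    {f : X → 𝕜} (hf : AEStronglyMeasurable f μ) {x : X}
    (hi : ∀ᵐ z ∂μ, Integrable (fun y => k₁ x y * k₂ y z) μ)
    (he : ∀ᵐ z ∂μ, ∫ y, k₁ x y * k₂ y z ∂μ = k₃ x z)
    (h₃ : Integrable (fun z => k₃ x z • f z) μ) :
    kernelOp μ k₁ (kernelOp μ k₂ f) x = kernelOp μ k₃ f x := by
  have hm : AEStronglyMeasurable (fun q : X × X => (k₁ x q.1 * k₂ q.1 q.2) • f q.2) (μ.prod μ) :=
    (((h₁.comp measurable_prodMk_left).comp measurable_fst).mul h₂).aestronglyMeasurable.smul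
      hf.comp_snd
  -- Since the kernels are nonnegative, integrating the norm in `y` reproduces `k₃ x z ‖f z‖`, so
  -- integrability of `k₃ f` suffices for Fubini.
  have hint : Integrable (fun q : X × X => (k₁ x q.1 * k₂ q.1 q.2) • f q.2) (μ.prod μ) := by
    rw [integrable_prod_iff' hm]
    refine ⟨?_, h₃.norm.congr ?_⟩
    · filter_upwards [hi] with z hz
      exact hz.smul_const _
    · filter_upwards [he] with z hz
      have hpos : 0 ≤ k₃ x z := hz ▸ integral_nonneg fun y => mul_nonneg (n₁ x y) (n₂ y z)
      simp_rw [norm_smul, Real.norm_of_nonneg (mul_nonneg (n₁ x _) (n₂ _ z))]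
      rw [integral_mul_const, hz, Real.norm_of_nonneg hpos]
  calc kernelOp μ k₁ (kernelOp μ k₂ f) x
      = ∫ y, ∫ z, (k₁ x y * k₂ y z) • f z ∂μ ∂μ := by
        simp_rw [kernelOp, ← integral_smul, smul_smul]
    _ = ∫ z, ∫ y, (k₁ x y * k₂ y z) • f z ∂μ ∂μ := integral_integral_swap hint
    _ = _ := by
        refine integral_congr_ae ?_
        filter_upwards [he] with z hz
        rw [integral_smul_const, hz]

end Schur

/-! ### The space `L¹ + L^∞` -/

section L1AddLinfty

variable {X 𝕜 : Type*} [MeasurableSpace X] [RCLike 𝕜] {μ : Measure X}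

theorem MemL1AddLinfty.aestronglyMeasurable {f : X → 𝕜} (hf : MemL1AddLinfty μ f) :
    AEStronglyMeasurable f μ := by
  obtain ⟨g, h, hg, hh, rfl⟩ := hf
  exact hg.1.add hh.1

/-- The bounded part is `f / max 1 ‖f‖`. The remainder vanishes where `‖f‖ ≤ 1` and is at most `‖f‖
≤ ‖f‖^p` elsewhere. -/
theorem MeasureTheory.MemLp.memL1AddLinfty {p : ℝ≥0∞} (hp : 1 ≤ p) {f : X → 𝕜} (hf : MemLp f p μ) :
    MemL1AddLinfty μ f := by
  rcases eq_or_ne p ∞ with rfl | hp'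
  · exact ⟨0, f, MemLp.zero, hf, (zero_add f).symm⟩
  have hp0 : p ≠ 0 := (zero_lt_one.trans_le hp).ne'
  have hp1 : 1 ≤ p.toReal := by
    rw [← ENNReal.toReal_one]
    exact ENNReal.toReal_mono hp' hp
  have hmax : ∀ x, 0 < max 1 ‖f x‖ := fun x => lt_max_of_lt_left one_pos
  have hm : AEStronglyMeasurable (fun x => (max 1 ‖f x‖)⁻¹ • f x) μ :=
    (((continuous_const.max continuous_norm).inv₀ fun z : 𝕜 =>
      (lt_max_of_lt_left one_pos).ne').comp_aestronglyMeasurable hf.1).smul hf.1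
  refine ⟨fun x => f x - (max 1 ‖f x‖)⁻¹ • f x, fun x => (max 1 ‖f x‖)⁻¹ • f x, ?_, ?_, ?_⟩
  · rw [memLp_one_iff_integrable]
    refine (hf.integrable_norm_rpow hp0 hp').mono' (hf.1.sub hm) (Eventually.of_forall fun x => ?_)
    rcases le_total ‖f x‖ 1 with h | h
    · rw [max_eq_left h, inv_one, one_smul, sub_self, norm_zero]
      positivity
    · have : f x - (max 1 ‖f x‖)⁻¹ • f x = (1 - ‖f x‖⁻¹) • f x := by
        rw [max_eq_right h, sub_smul, one_smul]
      rw [this, norm_smul, Real.norm_of_nonneg (by linarith [inv_le_one_of_one_le₀ h])]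
      calc (1 - ‖f x‖⁻¹) * ‖f x‖ ≤ 1 * ‖f x‖ := by
            gcongr
            linarith [inv_nonneg.2 (norm_nonneg (f x))]
        _ = ‖f x‖ ^ (1 : ℝ) := by rw [one_mul, Real.rpow_one]
        _ ≤ _ := Real.rpow_le_rpow_of_exponent_le h hp1
  · refine memLp_top_of_bound hm 1 (Eventually.of_forall fun x => ?_)
    rw [norm_smul, norm_inv, Real.norm_of_nonneg (hmax x).le, inv_mul_le_iff₀ (hmax x), mul_one]
    exact le_max_right _ _
  · funext x
    simp

theorem MeasureTheory.Integrable.smul_of_memL1AddLinfty {k : X → ℝ} {C : ℝ} (hk : Integrable k μ)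
    (hC : ∀ᵐ x ∂μ, ‖k x‖ ≤ C) {f : X → 𝕜} (hf : MemL1AddLinfty μ f) :
    Integrable (fun x => k x • f x) μ := by
  obtain ⟨g, h, hg, hh, rfl⟩ := hf
  simp only [Pi.add_apply, smul_add]
  refine Integrable.add ?_ ?_
  · exact (memLp_one_iff_integrable.1 hg).bdd_smul C hk.1 hC
  · refine hk.smul_bdd (eLpNorm h ∞ μ).toReal hh.1 ?_
    have := ae_le_eLpNormEssSup (f := h) (μ := μ)
    filter_upwards [this] with x hx
    rw [← toReal_enorm]
    exact ENNReal.toReal_mono hh.2.ne hx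

end L1AddLinfty

/-! ### The heat semigroup as integral operators on the half-line -/

instance instSigmaFiniteHalfLine : SigmaFinite halfLine := by
  unfold halfLine
  infer_instance

theorem ae_halfLine_pos : ∀ᵐ x ∂halfLine, 0 < x := ae_restrict_mem measurableSet_Ioi

section HalfLine

variable {α t : ℝ} {𝕜 : Type*} [RCLike 𝕜]

theorem measurable_besselHeatKernel (hα : -1 / 2 ≤ α) (t : ℝ) :
    Measurable (Function.uncurry (besselHeatKernel α t)) :=
  (continuous_besselHeatKernel hα).measurable

theorem besselSemigroup_zero (α : ℝ) (f : ℝ → 𝕜) : besselSemigroup α 0 f = f := if_pos rfl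

theorem besselSemigroup_eq_kernelOp (hα : -1 / 2 ≤ α) (ht : 0 < t) (f : ℝ → 𝕜) {x : ℝ}
    (hx : 0 < x) :
    besselSemigroup α t f x = kernelOp halfLine (besselHeatKernel α t) f x := by
  rw [besselSemigroup, if_neg ht.ne', kernelOp]
  refine integral_congr_ae ?_
  filter_upwards [ae_halfLine_pos] with y hy
  rw [besselKernel_eq hα ht hx hy]

theorem besselSemigroup_ae_eq (hα : -1 / 2 ≤ α) (ht : 0 < t) (f : ℝ → 𝕜) :
    besselSemigroup α t f =ᵐ[halfLine] kernelOp halfLine (besselHeatKernel α t) f := by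
  filter_upwards [ae_halfLine_pos] with x hx
  exact besselSemigroup_eq_kernelOp hα ht f hx

theorem integrable_besselHeatKernel_smul (hα : -1 / 2 ≤ α) (ht : 0 < t) {f : ℝ → 𝕜}
    (hf : MemL1AddLinfty halfLine f) {x : ℝ} (hx : 0 < x) :
    Integrable (fun y => besselHeatKernel α t x y • f y) halfLine := by
  obtain ⟨C, hC⟩ := exists_besselHeatKernel_le hα ht hx
  refine Integrable.smul_of_memL1AddLinfty (C := C) (integrableOn_besselHeatKernel hα ht hx) ?_ hf
  filter_upwards [ae_halfLine_pos] with y hy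
  rw [Real.norm_of_nonneg (besselHeatKernel_nonneg hα ht x y)]
  exact hC y hy

theorem lintegral_besselHeatKernel (hα : -1 / 2 ≤ α) (ht : 0 < t) {x : ℝ} (hx : 0 < x) :
    ∫⁻ y, ‖besselHeatKernel α t x y‖ₑ ∂halfLine =
      ENNReal.ofReal (auxH (α / 2 + 3 / 4) (α + 1) (x ^ 2 / (4 * t))) := by
  rw [← integral_besselHeatKernel hα ht hx,
    ofReal_integral_eq_lintegral_ofReal (integrableOn_besselHeatKernel hα ht hx)
      (Eventually.of_forall (besselHeatKernel_nonneg hα ht x))]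
  refine lintegral_congr fun y => ?_
  rw [Real.enorm_of_nonneg (besselHeatKernel_nonneg hα ht x y)]

theorem ae_lintegral_besselHeatKernel_le (hα : -1 / 2 ≤ α) {c : ℝ}
    (hc : ∀ u, 0 < u → auxH (α / 2 + 3 / 4) (α + 1) u ≤ c) (ht : 0 < t) :
    ∀ᵐ x ∂halfLine, ∫⁻ y, ‖besselHeatKernel α t x y‖ₑ ∂halfLine ≤ ENNReal.ofReal c := by
  filter_upwards [ae_halfLine_pos] with x hx
  have hx : 0 < x := hx
  rw [lintegral_besselHeatKernel hα ht hx]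
  exact ENNReal.ofReal_le_ofReal (hc _ (by positivity))

theorem memLp_besselSemigroup (hα : -1 / 2 ≤ α) {c : ℝ}
    (hc : ∀ u, 0 < u → auxH (α / 2 + 3 / 4) (α + 1) u ≤ c) (ht : 0 < t) {p : ℝ≥0∞} (hp : 1 ≤ p)
    {f : ℝ → 𝕜} (hf : MemLp f p halfLine) :
    MemLp (besselSemigroup α t f) p halfLine ∧
      eLpNorm (besselSemigroup α t f) p halfLine ≤ ENNReal.ofReal c * eLpNorm f p halfLine := by
  have hae := besselSemigroup_ae_eq hα ht f
  have hm := measurable_besselHeatKernel hα t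
  have hb := ae_lintegral_besselHeatKernel_le hα hc ht
  rw [memLp_congr_ae hae, eLpNorm_congr_ae hae]
  exact ⟨memLp_kernelOp hm besselHeatKernel_comm hb ENNReal.ofReal_ne_top hp hf,
    eLpNorm_kernelOp_le hm besselHeatKernel_comm hb hp hf.1⟩

theorem kernelOp_besselHeatKernel_add (hα : -1 / 2 ≤ α) (ht : 0 < t) {f g : ℝ → 𝕜}
    (hf : MemL1AddLinfty halfLine f) (hg : MemL1AddLinfty halfLine g) :
    kernelOp halfLine (besselHeatKernel α t) (f + g) =ᵐ[halfLine]
      kernelOp halfLine (besselHeatKernel α t) f + kernelOp halfLine (besselHeatKernel α t) g := by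
  filter_upwards [ae_halfLine_pos] with x hx
  simp only [kernelOp, Pi.add_apply, smul_add]
  exact integral_add (integrable_besselHeatKernel_smul hα ht hf hx)
    (integrable_besselHeatKernel_smul hα ht hg hx)

theorem kernelOp_smul {X : Type*} [MeasurableSpace X] (μ : Measure X) (k : X → X → ℝ) (a : 𝕜)
    (f : X → 𝕜) : kernelOp μ k (a • f) = a • kernelOp μ k f := by
  funext x
  simp only [kernelOp, Pi.smul_apply]
  rw [← integral_smul]
  exact integral_congr_ae (Eventually.of_forall fun y => smul_comm _ _ _)

theorem kernelOp_congr_ae {X : Type*} [MeasurableSpace X] {μ : Measure X} (k : X → X → ℝ)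
    {f g : X → 𝕜} (h : f =ᵐ[μ] g) : kernelOp μ k f = kernelOp μ k g := by
  funext x
  refine integral_congr_ae ?_
  filter_upwards [h] with y hy
  rw [hy]

theorem besselSemigroup_add_time (hα : -1 / 2 ≤ α) {s t : ℝ} (hs : 0 ≤ s) (ht : 0 ≤ t)
    {f : ℝ → 𝕜} (hf : MemL1AddLinfty halfLine f) :
    besselSemigroup α (s + t) f =ᵐ[halfLine] besselSemigroup α s (besselSemigroup α t f) := by
  rcases hs.eq_or_lt with rfl | hs
  · rw [zero_add, besselSemigroup_zero]
  rcases ht.eq_or_lt with rfl | ht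
  · rw [add_zero, besselSemigroup_zero]
  have hst : 0 < s + t := by linarith
  refine (besselSemigroup_ae_eq hα hst f).trans (EventuallyEq.trans ?_
    (besselSemigroup_ae_eq hα hs _).symm)
  rw [kernelOp_congr_ae _ (besselSemigroup_ae_eq hα ht f)]
  filter_upwards [ae_halfLine_pos] with x hx
  refine (kernelOp_kernelOp (measurable_besselHeatKernel hα s) (measurable_besselHeatKernel hα t)
    (besselHeatKernel_nonneg hα hs) (besselHeatKernel_nonneg hα ht) hf.aestronglyMeasurable
    ?_ ?_ (integrable_besselHeatKernel_smul hα hst hf hx)).symm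
  · filter_upwards [ae_halfLine_pos] with z hz
    obtain ⟨C, hC⟩ := exists_besselHeatKernel_le hα ht hz
    refine Integrable.mul_bdd (c := C) (integrableOn_besselHeatKernel hα hs hx) ?_ ?_
    · exact ((measurable_besselHeatKernel hα t).comp measurable_prodMk_right).aestronglyMeasurable
    · filter_upwards [ae_halfLine_pos] with y hy
      rw [Real.norm_of_nonneg (besselHeatKernel_nonneg hα ht y z), besselHeatKernel_comm]
      exact hC y hy
  · filter_upwards [ae_halfLine_pos] with z hz
    exact integral_besselHeatKernel_mul hα hs ht hx hz

/-- The heat operator on `L²(0, ∞)`; the identity for `t = 0`. -/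
def heatL2 (𝕜 : Type*) [RCLike 𝕜] (α t : ℝ) : Lp 𝕜 2 halfLine →L[𝕜] Lp 𝕜 2 halfLine :=
  if h : -1 / 2 ≤ α ∧ 0 < t then
    have hc := (exists_auxH_bessel_le h.1).choose_spec.2
    have hb := ae_lintegral_besselHeatKernel_le h.1 hc h.2
    have hm := measurable_besselHeatKernel h.1 t
    LinearMap.mkContinuousOfExistsBound
      { toFun := fun u => (memLp_kernelOp hm besselHeatKernel_comm hb ENNReal.ofReal_ne_top
          one_le_two (Lp.memLp u)).toLp _
        map_add' := fun u v => by
          rw [← MemLp.toLp_add]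
          refine MemLp.toLp_congr _ _ ?_
          rw [kernelOp_congr_ae _ (Lp.coeFn_add u v)]
          exact kernelOp_besselHeatKernel_add h.1 h.2 ((Lp.memLp u).memL1AddLinfty one_le_two)
            ((Lp.memLp v).memL1AddLinfty one_le_two)
        map_smul' := fun a u => by
          rw [RingHom.id_apply, ← MemLp.toLp_const_smul]
          refine MemLp.toLp_congr _ _ ?_
          rw [kernelOp_congr_ae _ (Lp.coeFn_smul a u), kernelOp_smul] }
      ⟨(exists_auxH_bessel_le h.1).choose, fun u => by
        have hc0 := (exists_auxH_bessel_le h.1).choose_spec.1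
        have := eLpNorm_kernelOp_le hm besselHeatKernel_comm hb one_le_two (Lp.memLp u).1
        simp only [LinearMap.coe_mk, AddHom.coe_mk, Lp.norm_toLp]
        rw [Lp.norm_def, ← ENNReal.toReal_ofReal (by linarith :
          (0 : ℝ) ≤ (exists_auxH_bessel_le h.1).choose), ← ENNReal.toReal_mul]
        exact ENNReal.toReal_mono (ENNReal.mul_ne_top ENNReal.ofReal_ne_top (Lp.memLp u).2.ne)
          this⟩
  else ContinuousLinearMap.id 𝕜 _

theorem coeFn_heatL2 (hα : -1 / 2 ≤ α) (ht : 0 ≤ t) (u : Lp 𝕜 2 halfLine) :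
    heatL2 𝕜 α t u =ᵐ[halfLine] besselSemigroup α t u := by
  rcases ht.eq_or_lt with rfl | ht
  · rw [heatL2, dif_neg (fun h => lt_irrefl _ h.2), besselSemigroup_zero]
    rfl
  · rw [heatL2, dif_pos ⟨hα, ht⟩]
    exact (MemLp.coeFn_toLp (memLp_kernelOp (measurable_besselHeatKernel hα t)
      besselHeatKernel_comm (ae_lintegral_besselHeatKernel_le hα
        (exists_auxH_bessel_le hα).choose_spec.2 ht) ENNReal.ofReal_ne_top one_le_two
        (Lp.memLp u))).trans (besselSemigroup_ae_eq hα ht _).symm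

theorem besselSemigroup_congr_ae (hα : -1 / 2 ≤ α) (ht : 0 ≤ t) {f g : ℝ → 𝕜}
    (h : f =ᵐ[halfLine] g) : besselSemigroup α t f =ᵐ[halfLine] besselSemigroup α t g := by
  rcases ht.eq_or_lt with rfl | ht
  · simpa only [besselSemigroup_zero] using h
  · refine (besselSemigroup_ae_eq hα ht f).trans (EventuallyEq.trans ?_
      (besselSemigroup_ae_eq hα ht g).symm)
    rw [kernelOp_congr_ae _ h]

theorem coeFn_heatL2_toLp (hα : -1 / 2 ≤ α) (ht : 0 ≤ t) {f : ℝ → 𝕜} (hf : MemLp f 2 halfLine) :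
    heatL2 𝕜 α t (hf.toLp f) =ᵐ[halfLine] besselSemigroup α t f :=
  (coeFn_heatL2 hα ht _).trans (besselSemigroup_congr_ae hα ht hf.coeFn_toLp)

theorem norm_heatL2_le (hα : -1 / 2 ≤ α) {c : ℝ} (hc0 : 1 ≤ c)
    (hc : ∀ u, 0 < u → auxH (α / 2 + 3 / 4) (α + 1) u ≤ c) (ht : 0 ≤ t) (u : Lp 𝕜 2 halfLine) :
    ‖heatL2 𝕜 α t u‖ ≤ c * ‖u‖ := by
  rcases ht.eq_or_lt with rfl | ht
  · rw [heatL2, dif_neg (fun h => lt_irrefl _ h.2)]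
    exact le_mul_of_one_le_left (norm_nonneg _) hc0
  have h := (memLp_besselSemigroup hα hc ht one_le_two (Lp.memLp u)).2
  rw [Lp.norm_def, Lp.norm_def, eLpNorm_congr_ae (coeFn_heatL2 hα ht.le u),
    ← ENNReal.toReal_ofReal (zero_le_one.trans hc0), ← ENNReal.toReal_mul]
  exact ENNReal.toReal_mono (ENNReal.mul_ne_top ENNReal.ofReal_ne_top (Lp.memLp u).2.ne) h

/-! ### Strong continuity -/

/-- The functions `x ^ (α + 1/2) exp (-a x ^ 2)`. -/
def besselGauss (α a x : ℝ) : ℝ := x ^ (α + 1 / 2) * Real.exp (-a * x ^ 2)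

theorem besselGauss_mul {a b x : ℝ} (hx : 0 < x) :
    besselGauss α a x * besselGauss α b x = x ^ (2 * α + 1) * Real.exp (-(a + b) * x ^ 2) := by
  rw [besselGauss, besselGauss, show 2 * α + 1 = (α + 1 / 2) + (α + 1 / 2) by ring,
    Real.rpow_add hx (α + 1 / 2) (α + 1 / 2), neg_add, add_mul, Real.exp_add]
  ring

theorem measurable_besselGauss (α a : ℝ) : Measurable (besselGauss α a) := by
  unfold besselGauss
  fun_prop

theorem memLp_besselGauss (𝕜 : Type*) [RCLike 𝕜] (hα : -1 / 2 ≤ α) {a : ℝ} (ha : 0 < a) :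
    MemLp (fun x => (besselGauss α a x : 𝕜)) 2 halfLine := by
  refine MemLp.ofReal ((memLp_two_iff_integrable_sq
    (measurable_besselGauss α a).aestronglyMeasurable).2 ?_)
  refine Integrable.congr (integrableOn_rpow_mul_exp_neg_mul_sq (b := a + a) (by positivity)
    (show -1 < 2 * α + 1 by linarith)) ?_
  filter_upwards [ae_halfLine_pos] with x hx
  exact (besselGauss_mul hx).symm.trans (sq _).symm

theorem integral_besselGauss_mul (hα : -1 / 2 ≤ α) {a b : ℝ} (ha : 0 < a) (hb : 0 < b) :
    ∫ x, besselGauss α a x * besselGauss α b x ∂halfLine =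
      (a + b) ^ (-(α + 1)) * Real.Gamma (α + 1) / 2 := by
  have h := integral_rpow_mul_exp_neg_mul_sq (p := a + b) (by positivity)
    (show -1 < 2 * α + 1 by linarith)
  rw [show (2 * α + 1 + 1) / 2 = α + 1 by ring] at h
  rw [← h]
  refine integral_congr_ae ?_
  filter_upwards [ae_halfLine_pos] with x hx
  exact besselGauss_mul hx

theorem inner_besselGauss (hα : -1 / 2 ≤ α) {a b : ℝ} (ha : 0 < a) (hb : 0 < b) :
    inner 𝕜 ((memLp_besselGauss 𝕜 hα ha).toLp _) ((memLp_besselGauss 𝕜 hα hb).toLp _) =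
      (((a + b) ^ (-(α + 1)) * Real.Gamma (α + 1) / 2 : ℝ) : 𝕜) := by
  rw [← integral_besselGauss_mul hα ha hb, ← integral_ofReal, L2.inner_def]
  refine integral_congr_ae ?_
  filter_upwards [(memLp_besselGauss 𝕜 hα ha).coeFn_toLp, (memLp_besselGauss 𝕜 hα hb).coeFn_toLp]
    with x h1 h2
  rw [h1, h2, RCLike.inner_apply, RCLike.conj_ofReal, mul_comm]
  push_cast
  rfl

/-- Weber's integral with `B = 0`, where the factor `besselClifford α 0` is positive and cancels.
The family of Gaussians is therefore stable under the semigroup up to scalars. -/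
theorem integral_besselHeatKernel_mul_besselGauss (hα : -1 / 2 ≤ α) (ht : 0 < t) {a : ℝ}
    (ha : 0 < a) {x : ℝ} (hx : 0 < x) :
    ∫ y, besselHeatKernel α t x y * besselGauss α a y ∂halfLine =
      (1 + 4 * a * t) ^ (-(α + 1)) * besselGauss α (a / (1 + 4 * a * t)) x := by
  have hq : 0 < 1 + 4 * a * t := by positivity
  have hp : 0 < (1 + 4 * a * t) / (4 * t) := by positivity
  have h := integral_gaussian_mul_besselClifford_mul hα hp (x ^ 2 / (16 * t ^ 2)) 0
  have h0 : 0 < besselClifford α 0 := by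
    rw [besselClifford, tsum_eq_single 0 (fun k hk => by simp [hk])]
    simpa using cliffordCoeff_pos hα 0
  simp only [zero_mul, mul_zero, zero_div, add_zero, ← mul_assoc, integral_mul_const] at h
  have h := mul_right_cancel₀ h0.ne' h
  have e : ∫ y, besselHeatKernel α t x y * besselGauss α a y ∂halfLine =
      2 ^ (-2 * α - 1) * t ^ (-(α + 1)) * x ^ (α + 1 / 2) * Real.exp (-x ^ 2 / (4 * t)) *
      ∫ y in Ioi (0 : ℝ), y ^ (2 * α + 1) * Real.exp (-((1 + 4 * a * t) / (4 * t)) * y ^ 2) *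
        besselClifford α (x ^ 2 / (16 * t ^ 2) * y ^ 2) := by
    rw [← integral_const_mul]
    refine setIntegral_congr_fun measurableSet_Ioi fun y hy => ?_
    have hy : 0 < y := hy
    have := besselGauss_mul (α := α) (a := 1 / (4 * t)) (b := a) hy
    rw [show (1 + 4 * a * t) / (4 * t) = 1 / (4 * t) + a by field_simp, ← this,
      besselHeatKernel_eq hx hy]
    simp only [besselGauss]
    ring
  rw [e, h, besselGauss, show -x ^ 2 / (4 * t) = -(a / (1 + 4 * a * t)) * x ^ 2 -
    x ^ 2 / (16 * t ^ 2) / ((1 + 4 * a * t) / (4 * t)) by field_simp; ring, Real.exp_sub,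
    Real.div_rpow hq.le (by positivity), Real.mul_rpow (by norm_num) ht.le,
    show (4 : ℝ) = 2 ^ (2 : ℝ) by norm_num, ← Real.rpow_mul two_pos.le,
    show -2 * α - 1 = 2 * (-(α + 1)) + 1 by ring, Real.rpow_add_one two_ne_zero]
  have h2 : (0 : ℝ) < 2 ^ (2 * (-(α + 1))) := by positivity
  have h3 : 0 < t ^ (-(α + 1)) := by positivity
  field_simp

theorem heatL2_besselGauss (hα : -1 / 2 ≤ α) (ht : 0 < t) {a : ℝ} (ha : 0 < a)
    (hb : 0 < a / (1 + 4 * a * t)) :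
    heatL2 𝕜 α t ((memLp_besselGauss 𝕜 hα ha).toLp _) =
      (((1 + 4 * a * t) ^ (-(α + 1)) : ℝ) : 𝕜) • (memLp_besselGauss 𝕜 hα hb).toLp _ := by
  rw [← MemLp.toLp_const_smul]
  refine Lp.ext ((coeFn_heatL2_toLp hα ht.le _).trans (EventuallyEq.trans ?_
    (MemLp.coeFn_toLp _).symm))
  filter_upwards [ae_halfLine_pos] with x hx
  rw [besselSemigroup_eq_kernelOp hα ht _ hx, kernelOp]
  simp only [RCLike.real_smul_eq_coe_mul, Pi.smul_apply, smul_eq_mul, ← RCLike.ofReal_mul]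
  rw [integral_ofReal, integral_besselHeatKernel_mul_besselGauss hα ht ha hx]

/-- The squared norm of the difference expands into inner products of Gaussians, all explicit; the
expression is continuous in `t` up to `t = 0`, where it vanishes. -/
theorem tendsto_heatL2_besselGauss (hα : -1 / 2 ≤ α) {a : ℝ} (ha : 0 < a) :
    Tendsto (fun t => heatL2 𝕜 α t ((memLp_besselGauss 𝕜 hα ha).toLp _)) (𝓝[>] 0)
      (𝓝 ((memLp_besselGauss 𝕜 hα ha).toLp _)) := by
  rw [tendsto_iff_norm_sub_tendsto_zero]
  have key : Tendsto (fun t => ‖heatL2 𝕜 α t ((memLp_besselGauss 𝕜 hα ha).toLp _) -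
      (memLp_besselGauss 𝕜 hα ha).toLp _‖ ^ 2) (𝓝[>] 0) (𝓝 0) := by
    let N : ℝ → ℝ := fun b => b ^ (-(α + 1)) * Real.Gamma (α + 1) / 2
    let L : ℝ → ℝ := fun t => (1 + 4 * a * t) ^ (-(α + 1))
    let B : ℝ → ℝ := fun t => a / (1 + 4 * a * t)
    have hev : ∀ᶠ t in 𝓝[>] (0 : ℝ), L t ^ 2 * N (B t + B t) - 2 * (L t * N (B t + a)) + N (a + a) =
        ‖heatL2 𝕜 α t ((memLp_besselGauss 𝕜 hα ha).toLp _) -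
          (memLp_besselGauss 𝕜 hα ha).toLp _‖ ^ 2 := by
      filter_upwards [self_mem_nhdsWithin] with t ht
      have ht : 0 < t := ht
      have hb : 0 < a / (1 + 4 * a * t) := by positivity
      have hL : 0 < L t := by positivity
      have hn : ∀ {b : ℝ} (hb : 0 < b), ‖(memLp_besselGauss 𝕜 hα hb).toLp _‖ ^ 2 = N (b + b) := by
        intro b hb
        rw [← inner_self_eq_norm_sq (𝕜 := 𝕜), inner_besselGauss hα hb hb, RCLike.ofReal_re]
      rw [heatL2_besselGauss hα ht ha hb, norm_sub_sq (𝕜 := 𝕜), inner_smul_left, norm_smul,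
        mul_pow, hn hb, hn ha, inner_besselGauss hα hb ha, RCLike.conj_ofReal, ← RCLike.ofReal_mul,
        RCLike.ofReal_re, RCLike.norm_ofReal, abs_of_pos hL]
    refine Tendsto.congr' hev ?_
    have hcont : ContinuousAt (fun t => L t ^ 2 * N (B t + B t) - 2 * (L t * N (B t + a)) +
        N (a + a)) 0 := by
      have hN : ∀ {b : ℝ}, 0 < b → ContinuousAt N b := fun {b} hb =>
        ((Real.continuousAt_rpow_const _ _ (Or.inl hb.ne')).mul_const _).div_const _
      have hL : ContinuousAt L 0 := by
        refine ContinuousAt.rpow_const (by fun_prop) (Or.inl ?_)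
        simp
      have hB : ContinuousAt B 0 := by
        refine ContinuousAt.div (by fun_prop) (by fun_prop) ?_
        simp
      have hB0 : B 0 = a := by simp [B]
      have h1 : ContinuousAt (fun t => N (B t + B t)) 0 :=
        ContinuousAt.comp (g := N) (hN (by rw [hB0]; positivity)) (hB.add hB)
      have h2 : ContinuousAt (fun t => N (B t + a)) 0 :=
        ContinuousAt.comp (g := N) (hN (by rw [hB0]; positivity)) (hB.add_const a)
      exact (((hL.pow 2).mul h1).sub ((hL.mul h2).const_mul 2)).add_const _
    have h := hcont.tendsto
    have e0 : L 0 ^ 2 * N (B 0 + B 0) - 2 * (L 0 * N (B 0 + a)) + N (a + a) = 0 := by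
      have hB0 : B 0 = a := by simp [B]
      have hL0 : L 0 = 1 := by simp [L]
      rw [hB0, hL0]
      ring
    rw [e0] at h
    exact h.mono_left nhdsWithin_le_nhds
  have h := key.sqrt
  simpa only [Real.sqrt_sq (norm_nonneg _), Real.sqrt_zero] using h

end HalfLine

/-! ### Totality of the Gaussians and the density argument -/

section Density

variable {α t : ℝ} {𝕜 : Type*} [RCLike 𝕜]

/-- A function of `x > 0` that is orthogonal to all the functions `exp (-n x ^ 2)` vanishes. -/
theorem ae_eq_zero_of_forall_integral_exp_neg_mul_sq {w : ℝ → 𝕜} (hw : Integrable w halfLine)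
    (h : ∀ n : ℕ, ∫ x, Real.exp (-n * x ^ 2) • w x ∂halfLine = 0) : w =ᵐ[halfLine] 0 := by
  have hexp : ∀ x : ℝ, Real.exp (-x ^ 2) ∈ Icc (0 : ℝ) 1 := fun x =>
    ⟨(Real.exp_pos _).le, Real.exp_le_one_iff.2 (by nlinarith [sq_nonneg x])⟩
  have hbdd : ∀ {φ : ℝ → ℝ}, Measurable φ → ∀ {C : ℝ}, (∀ x, |φ x| ≤ C) →
      Integrable (fun x => φ x • w x) halfLine := fun {φ} hm {C} hC =>
    hw.bdd_smul C hm.aestronglyMeasurable (Eventually.of_forall hC)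
  have hmono : ∀ n : ℕ, Integrable (fun x => Real.exp (-x ^ 2) ^ n • w x) halfLine := fun n =>
    hbdd (by fun_prop) (C := 1) fun x => by
      rw [abs_of_nonneg (by positivity)]
      exact pow_le_one₀ (hexp x).1 (hexp x).2
  -- By linearity `w` is orthogonal to every polynomial in `y = exp (-x²)`, including constants
  -- since `n = 0` is allowed.
  have hpoly : ∀ P : Polynomial ℝ, Integrable (fun x => P.eval (Real.exp (-x ^ 2)) • w x) halfLine ∧
      ∫ x, P.eval (Real.exp (-x ^ 2)) • w x ∂halfLine = 0 := by
    intro P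
    simp only [Polynomial.eval_eq_sum_range, Finset.sum_smul, mul_smul]
    have hi : ∀ n ∈ Finset.range (P.natDegree + 1), Integrable
        (fun x => P.coeff n • Real.exp (-x ^ 2) ^ n • w x) halfLine :=
      fun n _ => (hmono n).smul (P.coeff n)
    refine ⟨integrable_finsetSum _ hi, ?_⟩
    rw [integral_finsetSum _ hi]
    refine Finset.sum_eq_zero fun n _ => ?_
    have : ∀ x : ℝ, Real.exp (-x ^ 2) ^ n = Real.exp (-n * x ^ 2) := fun x => by
      rw [← Real.exp_nat_mul]; ring_nf
    rw [integral_smul]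
    simp_rw [this]
    rw [h n, smul_zero]
  have key := isOpen_Ioi.ae_eq_zero_of_integral_contDiff_smul_eq_zero (U := Ioi (0 : ℝ))
    (μ := volume) (f := w) (IntegrableOn.locallyIntegrableOn hw) ?_
  · exact (ae_restrict_iff' measurableSet_Ioi).2 key
  intro χ hχ hsupp hsub
  have hzero : ∀ x, x ∉ Ioi (0 : ℝ) → χ x = 0 := fun x hx => by
    by_contra hne
    exact hx (hsub (subset_tsupport _ hne))
  have hres : ∫ x, χ x • w x = ∫ x, χ x • w x ∂halfLine :=
    (setIntegral_eq_integral_of_forall_compl_eq_zero fun x hx => by rw [hzero x hx, zero_smul]).symm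
  rw [hres]
  obtain ⟨M, hM⟩ := hsupp.isBounded.subset_closedBall 0
  have hbig : ∀ z, M < z → χ z = 0 := fun z hz => by
    by_contra hne
    have := hM (subset_tsupport _ hne)
    rw [mem_closedBall_zero_iff, Real.norm_eq_abs] at this
    linarith [le_abs_self z]
  -- The test function in the variable `y = exp (-x²)`. Small `y` corresponds to `x` beyond the
  -- support of `χ`, so it extends continuously by zero to `y = 0` and Weierstrass approximation
  -- applies on `[0, 1]`.
  have hcont : ContinuousOn (fun y : ℝ => χ (√(-Real.log y))) (Icc 0 1) := by
    intro y hy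
    refine ContinuousAt.continuousWithinAt ?_
    rcases eq_or_ne y 0 with rfl | hne
    · have : (fun y : ℝ => χ (√(-Real.log y))) =ᶠ[𝓝 0] fun _ => 0 := by
        have hmem : Ioo (-Real.exp (-(M ^ 2))) (Real.exp (-(M ^ 2))) ∈ 𝓝 (0 : ℝ) :=
          Ioo_mem_nhds (by linarith [Real.exp_pos (-(M ^ 2))]) (Real.exp_pos _)
        filter_upwards [hmem] with y hy
        rcases eq_or_ne y 0 with rfl | hne
        -- At `y = 0` the default value `Real.log 0 = 0` gives `χ 0`, which is `0` because `χ` is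
        -- supported in `(0, ∞)`.
        · rw [Real.log_zero, neg_zero, Real.sqrt_zero]
          exact hzero 0 (by simp)
        · refine hbig _ (Real.lt_sqrt_of_sq_lt ?_)
          have h1 : |y| < Real.exp (-(M ^ 2)) := abs_lt.2 hy
          have h2 := Real.log_lt_log (abs_pos.2 hne) h1
          rw [Real.log_exp, Real.log_abs] at h2
          linarith
      exact continuousAt_const.congr this.symm
    · exact hχ.continuous.continuousAt.comp ((Real.continuousAt_log hne).neg.sqrt)
  have hχi : Integrable (fun x => χ x • w x) halfLine := by
    obtain ⟨C, hC⟩ := hχ.continuous.bounded_above_of_compact_support hsupp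
    exact hbdd hχ.continuous.measurable hC
  have hle : ∀ ε > 0, ‖∫ x, χ x • w x ∂halfLine‖ ≤ ε * ∫ x, ‖w x‖ ∂halfLine := by
    intro ε hε
    obtain ⟨P, hP⟩ := exists_polynomial_near_of_continuousOn 0 1 _ hcont ε hε
    have e : ∫ x, χ x • w x ∂halfLine =
        ∫ x, (χ x • w x - P.eval (Real.exp (-x ^ 2)) • w x) ∂halfLine := by
      rw [integral_sub hχi (hpoly P).1, (hpoly P).2, sub_zero]
    rw [e, ← integral_const_mul]
    refine norm_integral_le_of_norm_le (hw.norm.const_mul ε) ?_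
    filter_upwards [ae_halfLine_pos] with x hx
    have h1 := (hP _ (hexp x)).le
    simp only [Real.log_exp, neg_neg, Real.sqrt_sq hx.le] at h1
    rw [← sub_smul, norm_smul, Real.norm_eq_abs, abs_sub_comm]
    gcongr
  have h0 : ‖∫ x, χ x • w x ∂halfLine‖ ≤ 0 := by
    have hlim : Tendsto (fun ε : ℝ => ε * ∫ x, ‖w x‖ ∂halfLine) (𝓝[>] 0) (𝓝 0) := by
      have : Tendsto (fun ε : ℝ => ε * ∫ x, ‖w x‖ ∂halfLine) (𝓝 0)
          (𝓝 (0 * ∫ x, ‖w x‖ ∂halfLine)) := tendsto_id.mul_const _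
      rw [zero_mul] at this
      exact this.mono_left nhdsWithin_le_nhds
    exact ge_of_tendsto hlim (by filter_upwards [self_mem_nhdsWithin] with ε hε using hle ε hε)
  exact norm_le_zero_iff.1 h0

/-- The exponents `a = 1 + n` suffice: the corresponding Gaussian is `exp (-n x²)` times the one
with `a = 1`, and the product of the latter with `v` is integrable. -/
theorem eq_zero_of_forall_inner_besselGauss (hα : -1 / 2 ≤ α) {v : Lp 𝕜 2 halfLine}
    (h : ∀ (a : ℝ) (ha : 0 < a), inner 𝕜 ((memLp_besselGauss 𝕜 hα ha).toLp _) v = 0) : v = 0 := by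
  have hw : Integrable (fun x => besselGauss α 1 x • v x) halfLine := by
    have := MemLp.integrable_mul (memLp_besselGauss 𝕜 hα one_pos) (Lp.memLp v)
    refine this.congr (Eventually.of_forall fun x => ?_)
    simp [RCLike.real_smul_eq_coe_mul]
  have hw0 := ae_eq_zero_of_forall_integral_exp_neg_mul_sq hw fun n => by
    have ha : (0 : ℝ) < 1 + n := by positivity
    rw [← h _ ha, L2.inner_def]
    refine integral_congr_ae ?_
    filter_upwards [(memLp_besselGauss 𝕜 hα ha).coeFn_toLp] with x hx
    rw [hx, RCLike.inner_apply, RCLike.conj_ofReal, smul_smul, RCLike.real_smul_eq_coe_mul,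
      mul_comm, besselGauss, besselGauss, neg_add, add_mul, Real.exp_add]
    congr 2
    ring
  refine Lp.ext ?_
  filter_upwards [hw0, ae_halfLine_pos, Lp.coeFn_zero 𝕜 2 halfLine] with x hx hpos h0
  rw [h0, Pi.zero_apply]
  have : besselGauss α 1 x ≠ 0 := by
    have : 0 < besselGauss α 1 x := by unfold besselGauss; positivity
    exact this.ne'
  simpa [this] using hx

/-- The heat semigroup is strongly continuous on `L²`. -/
theorem tendsto_heatL2 (hα : -1 / 2 ≤ α) (u : Lp 𝕜 2 halfLine) :
    Tendsto (fun t => heatL2 𝕜 α t u) (𝓝[>] 0) (𝓝 u) := by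
  obtain ⟨c, hc1, hc⟩ := exists_auxH_bessel_le hα
  -- The vectors of strong continuity form a subspace. It is closed by the uniform bound `c` and
  -- dense because it contains all the Gaussians.
  let K : Submodule 𝕜 (Lp 𝕜 2 halfLine) :=
    { carrier := {v | Tendsto (fun t => heatL2 𝕜 α t v) (𝓝[>] 0) (𝓝 v)}
      add_mem' := fun {v w} hv hw => by
        simp only [mem_ofPred_eq, map_add] at hv hw ⊢
        exact hv.add hw
      zero_mem' := by
        simp only [mem_ofPred_eq, map_zero]
        exact tendsto_const_nhds
      smul_mem' := fun a v hv => by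
        simp only [mem_ofPred_eq, map_smul] at hv ⊢
        exact hv.const_smul a }
  have hclosed : K.topologicalClosure ≤ K := by
    intro v hv
    change v ∈ closure (K : Set (Lp 𝕜 2 halfLine)) at hv
    change Tendsto (fun t => heatL2 𝕜 α t v) (𝓝[>] 0) (𝓝 v)
    rw [Metric.tendsto_nhds]
    intro ε hε
    obtain ⟨w, hw, hvw⟩ := Metric.mem_closure_iff.1 hv (ε / (2 * (c + 1))) (by positivity)
    have hw : Tendsto (fun t => heatL2 𝕜 α t w) (𝓝[>] 0) (𝓝 w) := hw
    filter_upwards [Metric.tendsto_nhds.1 hw (ε / 2) (by positivity), self_mem_nhdsWithin]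
      with t h1 ht
    have h2 := norm_heatL2_le hα hc1.le hc (le_of_lt ht) (v - w)
    rw [map_sub, ← dist_eq_norm, ← dist_eq_norm] at h2
    have h3 : dist v w * (2 * (c + 1)) < ε := (lt_div_iff₀ (by positivity)).1 hvw
    calc dist (heatL2 𝕜 α t v) v
        ≤ dist (heatL2 𝕜 α t v) (heatL2 𝕜 α t w) + dist (heatL2 𝕜 α t w) w + dist w v :=
          dist_triangle4 _ _ _ _
      _ < c * dist v w + ε / 2 + dist v w := by
          rw [dist_comm w v]
          linarith
      _ ≤ ε := by linarith
  have htop : K.topologicalClosure = ⊤ := by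
    rw [Submodule.topologicalClosure_eq_top_iff, Submodule.eq_bot_iff]
    intro v hv
    exact eq_zero_of_forall_inner_besselGauss hα fun a ha =>
      (Submodule.mem_orthogonal K v).1 hv _ (tendsto_heatL2_besselGauss hα ha)
  exact (hclosed (htop ▸ Submodule.mem_top) : u ∈ K)

theorem tendsto_eLpNorm_besselSemigroup (hα : -1 / 2 ≤ α) {f : ℝ → 𝕜} (hf : MemLp f 2 halfLine) :
    Tendsto (fun t => eLpNorm (besselSemigroup α t f - f) 2 halfLine) (𝓝[>] 0) (𝓝 0) := by
  have h := (Lp.tendsto_Lp_iff_tendsto_eLpNorm' _ _).1 (tendsto_heatL2 hα (hf.toLp f))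
  refine h.congr' ?_
  filter_upwards [self_mem_nhdsWithin] with t ht
  exact eLpNorm_congr_ae ((coeFn_heatL2_toLp hα (le_of_lt ht) hf).sub hf.coeFn_toLp)

end Density

/-! ### The Hankel transform of compactly supported functions -/

section HankelCompact

variable {α t R : ℝ} {𝕜 : Type*} [RCLike 𝕜] {f g : ℝ → 𝕜}

/-- A crude bound is enough: against compactly supported functions and the factor `exp (-t l²)`,
exponential growth is harmless, so no asymptotics of Bessel functions are needed. -/
theorem exists_abs_besselEven_le (hα : -1 / 2 ≤ α) :
    ∃ C, 0 ≤ C ∧ ∀ z, |besselEven α z| ≤ C * Real.exp ((α + 3 / 2) * |z|) := by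
  have hG : 0 < Real.Gamma (α + 1) := Real.Gamma_pos_of_pos (by linarith)
  refine ⟨2 ^ (-α) * (Real.Gamma (α + 1))⁻¹, by positivity, fun z => ?_⟩
  have h1 : |z| ^ (α + 1 / 2) ≤ Real.exp ((α + 1 / 2) * |z|) := by
    rw [mul_comm, Real.exp_mul]
    exact Real.rpow_le_rpow (abs_nonneg z) (by linarith [Real.add_one_le_exp |z|]) (by linarith)
  have h2 := abs_besselClifford_mul_sq_le hα (-1 / 4) z
  have h3 : 2 * √|(-1 / 4 : ℝ)| = 1 := by
    rw [show |(-1 / 4 : ℝ)| = (1 / 2) ^ 2 by norm_num [abs_of_neg], Real.sqrt_sq (by norm_num)]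
    norm_num
  rw [h3, one_mul] at h2
  rw [besselEven, abs_mul, abs_of_nonneg (by positivity : 0 ≤ 2 ^ (-α) * |z| ^ (α + 1 / 2))]
  calc _ ≤ 2 ^ (-α) * Real.exp ((α + 1 / 2) * |z|) *
        ((Real.Gamma (α + 1))⁻¹ * Real.exp |z|) := by gcongr
    _ = _ := by
        rw [show (α + 3 / 2) * |z| = (α + 1 / 2) * |z| + |z| by ring, Real.exp_add]
        ring

/-- The Hankel transform of a compactly supported function, as a function of `l : ℝ`. -/
def besselHankel (α : ℝ) (f : ℝ → 𝕜) : ℝ → 𝕜 :=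
  kernelOp halfLine (fun l x => besselEven α (l * x)) f

theorem measurable_besselEven_mul (hα : -1 / 2 ≤ α) :
    Measurable (Function.uncurry fun l x : ℝ => besselEven α (l * x)) :=
  (continuous_besselEven hα).measurable.comp (measurable_fst.mul measurable_snd)

theorem aestronglyMeasurable_besselHankel (hα : -1 / 2 ≤ α) (hf : AEStronglyMeasurable f halfLine) :
    AEStronglyMeasurable (besselHankel α f) halfLine :=
  aestronglyMeasurable_kernelOp (measurable_besselEven_mul hα) hf

theorem exists_abs_besselEven_mul_norm_le (hα : -1 / 2 ≤ α) (R : ℝ) :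
    ∃ C b, 0 ≤ C ∧ 0 ≤ b ∧ ∀ (f : ℝ → 𝕜), (∀ x, x ∉ Ioo 0 R → f x = 0) → ∀ l x,
      |besselEven α (l * x)| * ‖f x‖ ≤ C * Real.exp (b * |l|) * ‖f x‖ := by
  obtain ⟨C, hC, h⟩ := exists_abs_besselEven_le hα
  -- `max R 0` keeps the rate nonnegative when `(0, R)` is empty.
  refine ⟨C, (α + 3 / 2) * max R 0, hC, mul_nonneg (by linarith) (le_max_right _ _),
    fun f hf l x => ?_⟩
  by_cases hx : x ∈ Ioo 0 R
  · refine mul_le_mul_of_nonneg_right ((h _).trans ?_) (norm_nonneg _)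
    rw [abs_mul, abs_of_pos hx.1, mul_assoc]
    have h1 : |l| * x ≤ max R 0 * |l| := by
      rw [mul_comm]
      gcongr
      exact hx.2.le.trans (le_max_left _ _)
    have h2 : 0 ≤ α + 3 / 2 := by linarith
    gcongr
  · rw [hf x hx]
    simp

theorem integrable_of_memLp_two_of_support (hf : MemLp f 2 halfLine)
    (hR : ∀ x, x ∉ Ioo 0 R → f x = 0) : Integrable f halfLine := by
  have h1 : MemLp ((Ioo 0 R).indicator fun _ => (1 : 𝕜)) 2 halfLine :=
    memLp_indicator_const 2 measurableSet_Ioo 1 (Or.inr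
      (((Measure.restrict_apply_le _ _).trans_lt measure_Ioo_lt_top).ne))
  refine (MemLp.integrable_mul h1 hf).congr (Eventually.of_forall fun x => ?_)
  by_cases hx : x ∈ Ioo 0 R
  · simp [hx]
  · simp [hR x hx]

theorem integrable_besselEven_smul (hα : -1 / 2 ≤ α) (hf : MemLp f 2 halfLine)
    (hR : ∀ x, x ∉ Ioo 0 R → f x = 0) (l : ℝ) :
    Integrable (fun x => besselEven α (l * x) • f x) halfLine := by
  obtain ⟨C, b, -, -, h⟩ := exists_abs_besselEven_mul_norm_le (𝕜 := 𝕜) hα R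
  have hi := integrable_of_memLp_two_of_support hf hR
  refine (hi.norm.const_mul (C * Real.exp (b * |l|))).mono' ?_ (Eventually.of_forall fun x => ?_)
  · exact ((measurable_besselEven_mul hα).comp measurable_prodMk_left).aestronglyMeasurable.smul
      hf.1
  · rw [norm_smul]
    exact h f hR l x

theorem besselHankel_sub (hα : -1 / 2 ≤ α) {S : ℝ} (hf : MemLp f 2 halfLine)
    (hR : ∀ x, x ∉ Ioo 0 R → f x = 0) (hg : MemLp g 2 halfLine)
    (hS : ∀ x, x ∉ Ioo 0 S → g x = 0) :
    besselHankel α (f - g) = besselHankel α f - besselHankel α g := by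
  funext l
  simp only [besselHankel, kernelOp, Pi.sub_apply, smul_sub]
  exact integral_sub (integrable_besselEven_smul hα hf hR l) (integrable_besselEven_smul hα hg hS l)

theorem integral_exp_mul_besselEven_mul (hα : -1 / 2 ≤ α) (ht : 0 < t) {x y : ℝ} (hx : 0 < x)
    (hy : 0 < y) :
    ∫ l, Real.exp (-t * l ^ 2) * besselEven α (l * x) * besselEven α (l * y) ∂halfLine =
      besselHeatKernel α t x y := by
  rw [← besselKernel_eq hα ht hx hy, besselKernel]
  refine integral_congr_ae ?_
  filter_upwards [ae_halfLine_pos] with l hl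
  rw [besselPsi_eq_besselEven hl hx, besselPsi_eq_besselEven hl hy]

theorem integrable_exp_neg_mul_sq_mul_exp (ht : 0 < t) (b : ℝ) :
    Integrable (fun l : ℝ => Real.exp (-t * l ^ 2) * Real.exp (b * |l|)) halfLine := by
  have h := integrableOn_rpow_mul_exp_neg_mul_sq_mul ht (show (-1 : ℝ) < 0 by norm_num)
    (f := fun l => Real.exp (b * |l|)) (by fun_prop) (b := b) (C := 1) fun x hx => by
      rw [abs_of_pos (Real.exp_pos _), abs_of_pos hx, one_mul]
  simp only [Real.rpow_zero, one_mul] at h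
  exact h

theorem integrable_exp_mul_besselEven_prod (hα : -1 / 2 ≤ α) (ht : 0 < t)
    (hf : MemLp f 2 halfLine) (hfR : ∀ x, x ∉ Ioo 0 R → f x = 0) (hg : MemLp g 2 halfLine)
    (hgR : ∀ x, x ∉ Ioo 0 R → g x = 0) :
    Integrable (fun q : ℝ × ℝ × ℝ => (Real.exp (-t * q.1 ^ 2) * besselEven α (q.1 * q.2.1) *
      besselEven α (q.1 * q.2.2)) • (g q.2.1 * starRingEnd 𝕜 (f q.2.2)))
      (halfLine.prod (halfLine.prod halfLine)) := by
  obtain ⟨C, b, hC, hb, h⟩ := exists_abs_besselEven_mul_norm_le (𝕜 := 𝕜) hα R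
  have hfi := integrable_of_memLp_two_of_support hf hfR
  have hgi := integrable_of_memLp_two_of_support hg hgR
  have hdom := (integrable_exp_neg_mul_sq_mul_exp ht (b + b)).mul_prod
    ((hgi.norm.mul_prod hfi.norm).const_mul (C * C))
  have he := (continuous_besselEven hα).measurable
  refine hdom.mono' ?_ (Eventually.of_forall fun q => ?_)
  · refine AEStronglyMeasurable.smul (by fun_prop : Measurable fun q : ℝ × ℝ × ℝ =>
      Real.exp (-t * q.1 ^ 2) * besselEven α (q.1 * q.2.1) *
        besselEven α (q.1 * q.2.2)).aestronglyMeasurable ?_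
    exact ((hg.1.comp_fst.mul (RCLike.continuous_conj.comp_aestronglyMeasurable
      hf.1.comp_snd))).comp_snd
  · obtain ⟨l, x, y⟩ := q
    simp only
    rw [norm_smul, norm_mul, norm_mul, norm_mul, RCLike.norm_conj, Real.norm_eq_abs,
      Real.norm_eq_abs, Real.norm_eq_abs, abs_of_pos (Real.exp_pos _), add_mul, Real.exp_add]
    calc _ = Real.exp (-t * l ^ 2) * (|besselEven α (l * x)| * ‖g x‖) *
          (|besselEven α (l * y)| * ‖f y‖) := by ring
      _ ≤ Real.exp (-t * l ^ 2) * (C * Real.exp (b * |l|) * ‖g x‖) *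
          (C * Real.exp (b * |l|) * ‖f y‖) := by
            exact mul_le_mul (mul_le_mul_of_nonneg_left (h g hgR l x) (by positivity))
              (h f hfR l y) (by positivity) (by positivity)
      _ = _ := by ring

theorem exp_smul_inner_besselHankel (l : ℝ) :
    Real.exp (-t * l ^ 2) • inner 𝕜 (besselHankel α f l) (besselHankel α g l) =
      ∫ z : ℝ × ℝ, (Real.exp (-t * l ^ 2) * besselEven α (l * z.1) * besselEven α (l * z.2)) •
        (g z.1 * starRingEnd 𝕜 (f z.2)) ∂halfLine.prod halfLine := by
  rw [RCLike.inner_apply, besselHankel, besselHankel, kernelOp, kernelOp, ← integral_conj,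
    ← integral_prod_mul, ← integral_smul]
  congr 1
  funext z
  simp only [RCLike.real_smul_eq_coe_mul, map_mul, RCLike.conj_ofReal]
  ring

theorem integrable_exp_smul_inner_besselHankel (hα : -1 / 2 ≤ α) (ht : 0 < t)
    (hf : MemLp f 2 halfLine) (hfR : ∀ x, x ∉ Ioo 0 R → f x = 0) (hg : MemLp g 2 halfLine)
    (hgR : ∀ x, x ∉ Ioo 0 R → g x = 0) :
    Integrable (fun l => Real.exp (-t * l ^ 2) • inner 𝕜 (besselHankel α f l) (besselHankel α g l))
      halfLine := by
  simp_rw [exp_smul_inner_besselHankel]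
  exact (integrable_exp_mul_besselEven_prod hα ht hf hfR hg hgR).integral_prod_left

theorem inner_heatL2 (hα : -1 / 2 ≤ α) (ht : 0 < t) (hf : MemLp f 2 halfLine)
    (hg : MemLp g 2 halfLine) :
    inner 𝕜 (heatL2 𝕜 α t (hf.toLp f)) (hg.toLp g) =
      ∫ x, inner 𝕜 (kernelOp halfLine (besselHeatKernel α t) f x) (g x) ∂halfLine := by
  rw [L2.inner_def]
  refine integral_congr_ae ?_
  filter_upwards [coeFn_heatL2_toLp hα ht.le hf, besselSemigroup_ae_eq hα ht f, hg.coeFn_toLp]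
    with x h1 h2 h3
  rw [h1, h2, h3]

/-- Parseval's identity regularized by `exp (-t l²)`: after Fubini the integral over `l` is the heat
kernel itself. -/
theorem integral_exp_smul_inner_besselHankel (hα : -1 / 2 ≤ α) (ht : 0 < t)
    (hf : MemLp f 2 halfLine) (hfR : ∀ x, x ∉ Ioo 0 R → f x = 0) (hg : MemLp g 2 halfLine)
    (hgR : ∀ x, x ∉ Ioo 0 R → g x = 0) :
    ∫ l, Real.exp (-t * l ^ 2) • inner 𝕜 (besselHankel α f l) (besselHankel α g l) ∂halfLine =
      inner 𝕜 (heatL2 𝕜 α t (hf.toLp f)) (hg.toLp g) := by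
  simp_rw [exp_smul_inner_besselHankel]
  obtain ⟨c, -, hc⟩ := exists_auxH_bessel_le hα
  have hk := integrable_kernel_smul_mul_conj (measurable_besselHeatKernel hα t)
    besselHeatKernel_comm (ae_lintegral_besselHeatKernel_le hα hc ht) ENNReal.ofReal_ne_top hf hg
  rw [integral_integral_swap (integrable_exp_mul_besselEven_prod hα ht hf hfR hg hgR),
    inner_heatL2 hα ht]
  simp_rw [inner_kernelOp_left]
  rw [← integral_prod _ hk]
  congr 1
  funext z
  rw [integral_smul_const]
  by_cases h1 : z.1 ∈ Ioo 0 R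
  · by_cases h2 : z.2 ∈ Ioo 0 R
    · rw [integral_exp_mul_besselEven_mul hα ht h1.1 h2.1]
    · simp [hfR _ h2]
  · simp [hgR _ h1]

/-- The regularized identity with `g = f` bounds the weighted integrals by `c ‖f‖²` uniformly in
`t`; Fatou's lemma along `t = 1/(n+1)` removes the weight. -/
theorem memLp_besselHankel (hα : -1 / 2 ≤ α) (hf : MemLp f 2 halfLine)
    (hfR : ∀ x, x ∉ Ioo 0 R → f x = 0) : MemLp (besselHankel α f) 2 halfLine := by
  obtain ⟨c, hc1, hc⟩ := exists_auxH_bessel_le hα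
  have hm := aestronglyMeasurable_besselHankel hα hf.1
  set B := c * ‖hf.toLp f‖ * ‖hf.toLp f‖
  have hbound : ∀ t : ℝ, 0 < t →
      ∫⁻ l, ENNReal.ofReal (Real.exp (-t * l ^ 2) * ‖besselHankel α f l‖ ^ 2) ∂halfLine ≤
        ENNReal.ofReal B := by
    intro t ht
    have e : ∀ l, Real.exp (-t * l ^ 2) • inner 𝕜 (besselHankel α f l) (besselHankel α f l) =
        ((Real.exp (-t * l ^ 2) * ‖besselHankel α f l‖ ^ 2 : ℝ) : 𝕜) := by
      intro l
      rw [inner_self_eq_norm_sq_to_K, RCLike.real_smul_eq_coe_mul]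
      push_cast
      rfl
    have hi := integrable_exp_smul_inner_besselHankel hα ht hf hfR hf hfR
    have hI := integral_exp_smul_inner_besselHankel hα ht hf hfR hf hfR
    simp_rw [e] at hi hI
    have hi : Integrable (fun l => Real.exp (-t * l ^ 2) * ‖besselHankel α f l‖ ^ 2) halfLine := by
      simpa using hi.re
    rw [integral_ofReal] at hI
    rw [← ofReal_integral_eq_lintegral_ofReal hi (Eventually.of_forall fun l => by positivity)]
    refine ENNReal.ofReal_le_ofReal ?_
    calc _ ≤ ‖((∫ l, Real.exp (-t * l ^ 2) * ‖besselHankel α f l‖ ^ 2 ∂halfLine : ℝ) : 𝕜)‖ := by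
          rw [RCLike.norm_ofReal]
          exact le_abs_self _
      _ ≤ ‖heatL2 𝕜 α t (hf.toLp f)‖ * ‖hf.toLp f‖ := by
          rw [hI]
          exact norm_inner_le_norm _ _
      _ ≤ _ := by
          exact mul_le_mul_of_nonneg_right (norm_heatL2_le hα hc1.le hc ht.le _) (norm_nonneg _)
  rw [memLp_two_iff_integrable_sq_norm hm]
  refine ⟨(hm.norm.pow 2), ?_⟩
  rw [hasFiniteIntegral_iff_ofReal (Eventually.of_forall fun l => by positivity)]
  let τ : ℕ → ℝ := fun n => 1 / ((n : ℝ) + 1)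
  have hτ : ∀ n, 0 < τ n := fun n => by positivity
  have hlim : ∀ l : ℝ, Tendsto (fun n => ENNReal.ofReal (Real.exp (-τ n * l ^ 2) *
      ‖besselHankel α f l‖ ^ 2)) atTop (𝓝 (ENNReal.ofReal (‖besselHankel α f l‖ ^ 2))) := by
    intro l
    refine (ENNReal.continuous_ofReal.tendsto _).comp ?_
    have h0 : Tendsto τ atTop (𝓝 0) := tendsto_one_div_add_atTop_nhds_zero_nat
    have h1 : Continuous fun s : ℝ => Real.exp (-s * l ^ 2) * ‖besselHankel α f l‖ ^ 2 := by
      fun_prop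
    have h2 := (h1.tendsto 0).comp h0
    simp only [neg_zero, zero_mul, Real.exp_zero, one_mul] at h2
    exact h2
  calc ∫⁻ l, ENNReal.ofReal (‖besselHankel α f l‖ ^ 2) ∂halfLine
      = ∫⁻ l, liminf (fun n => ENNReal.ofReal (Real.exp (-τ n * l ^ 2) *
          ‖besselHankel α f l‖ ^ 2)) atTop ∂halfLine := by
        simp_rw [fun l => (hlim l).liminf_eq]
    _ ≤ liminf (fun n => ∫⁻ l, ENNReal.ofReal (Real.exp (-τ n * l ^ 2) *
          ‖besselHankel α f l‖ ^ 2) ∂halfLine) atTop := by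
        refine lintegral_liminf_le' fun n => ?_
        exact ((by fun_prop : Measurable fun l : ℝ =>
          Real.exp (-τ n * l ^ 2)).aemeasurable.mul (hm.norm.pow 2).aemeasurable).ennreal_ofReal
    _ ≤ ENNReal.ofReal B := by
        refine liminf_le_of_le (by isBoundedDefault) fun b hb => ?_
        obtain ⟨n, hn⟩ := hb.exists
        exact hn.trans (hbound _ (hτ n))
    _ < ∞ := ENNReal.ofReal_lt_top

/-- The Hankel transform of compactly supported functions preserves inner products. -/
theorem inner_besselHankel (hα : -1 / 2 ≤ α) (hf : MemLp f 2 halfLine)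
    (hfR : ∀ x, x ∉ Ioo 0 R → f x = 0) (hg : MemLp g 2 halfLine)
    (hgR : ∀ x, x ∉ Ioo 0 R → g x = 0) :
    inner 𝕜 ((memLp_besselHankel hα hf hfR).toLp _) ((memLp_besselHankel hα hg hgR).toLp _) =
      inner 𝕜 (hf.toLp f) (hg.toLp g) := by
  have hi := L2.integrable_inner (𝕜 := 𝕜) ((memLp_besselHankel hα hf hfR).toLp _)
    ((memLp_besselHankel hα hg hgR).toLp _)
  have hae : (fun l => inner 𝕜 ((memLp_besselHankel hα hf hfR).toLp _ l)
      ((memLp_besselHankel hα hg hgR).toLp _ l)) =ᵐ[halfLine]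
      fun l => inner 𝕜 (besselHankel α f l) (besselHankel α g l) := by
    filter_upwards [(memLp_besselHankel hα hf hfR).coeFn_toLp,
      (memLp_besselHankel hα hg hgR).coeFn_toLp] with l h1 h2
    rw [h1, h2]
  rw [L2.inner_def, integral_congr_ae hae]
  have hi := hi.congr hae
  -- The two sides of the regularized identity are passed to the limit `t → 0`: dominated
  -- convergence on the transform side, strong continuity of the semigroup on the other.
  have h1 : Tendsto (fun t : ℝ => ∫ l, Real.exp (-t * l ^ 2) •
      inner 𝕜 (besselHankel α f l) (besselHankel α g l) ∂halfLine) (𝓝[>] 0)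
      (𝓝 (∫ l, inner 𝕜 (besselHankel α f l) (besselHankel α g l) ∂halfLine)) := by
    refine tendsto_integral_filter_of_dominated_convergence
      (fun l => ‖inner 𝕜 (besselHankel α f l) (besselHankel α g l)‖) ?_ ?_ hi.norm ?_
    · exact Eventually.of_forall fun t =>
        (by fun_prop : Measurable fun l : ℝ => Real.exp (-t * l ^ 2)).aestronglyMeasurable.smul hi.1
    · filter_upwards [self_mem_nhdsWithin] with t ht
      refine Eventually.of_forall fun l => ?_
      have ht : 0 < t := ht
      rw [norm_smul, Real.norm_of_nonneg (Real.exp_pos _).le]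
      refine mul_le_of_le_one_left (norm_nonneg _) (Real.exp_le_one_iff.2 ?_)
      nlinarith [mul_nonneg ht.le (sq_nonneg l)]
    · refine Eventually.of_forall fun l => ?_
      have hc : Continuous fun s : ℝ => Real.exp (-s * l ^ 2) •
        (inner 𝕜 (besselHankel α f l) (besselHankel α g l)) := by fun_prop
      have := hc.tendsto 0
      simp only [neg_zero, zero_mul, Real.exp_zero, one_smul] at this
      exact this.mono_left nhdsWithin_le_nhds
  have h2 : Tendsto (fun t : ℝ => ∫ l, Real.exp (-t * l ^ 2) •
      inner 𝕜 (besselHankel α f l) (besselHankel α g l) ∂halfLine) (𝓝[>] 0)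
      (𝓝 (inner 𝕜 (hf.toLp f) (hg.toLp g))) := by
    have := (tendsto_heatL2 hα (hf.toLp f)).inner (𝕜 := 𝕜) (tendsto_const_nhds (x := hg.toLp g))
    refine this.congr' ?_
    filter_upwards [self_mem_nhdsWithin] with t ht
    exact (integral_exp_smul_inner_besselHankel hα ht hf hfR hg hgR).symm
  exact tendsto_nhds_unique h1 h2

/-- The Hankel transform of compactly supported functions is symmetric. -/
theorem inner_besselHankel_comm (hα : -1 / 2 ≤ α) (hf : MemLp f 2 halfLine)
    (hfR : ∀ x, x ∉ Ioo 0 R → f x = 0) (hg : MemLp g 2 halfLine)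
    (hgR : ∀ x, x ∉ Ioo 0 R → g x = 0) :
    inner 𝕜 ((memLp_besselHankel hα hf hfR).toLp _) (hg.toLp g) =
      inner 𝕜 (hf.toLp f) ((memLp_besselHankel hα hg hgR).toLp _) := by
  obtain ⟨C, b, hC, hb, h⟩ := exists_abs_besselEven_mul_norm_le (𝕜 := 𝕜) hα R
  have hfi := integrable_of_memLp_two_of_support hf hfR
  have hgi := integrable_of_memLp_two_of_support hg hgR
  have hint : Integrable (fun q : ℝ × ℝ => besselEven α (q.1 * q.2) •
      (g q.1 * starRingEnd 𝕜 (f q.2))) (halfLine.prod halfLine) := by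
    refine ((hgi.norm.mul_prod hfi.norm).const_mul (C * Real.exp (b * |R|))).mono' ?_
      (Eventually.of_forall fun q => ?_)
    · exact (measurable_besselEven_mul hα).aestronglyMeasurable.smul
        (hg.1.comp_fst.mul (RCLike.continuous_conj.comp_aestronglyMeasurable hf.1.comp_snd))
    · obtain ⟨x, y⟩ := q
      simp only
      rw [norm_smul, norm_mul, RCLike.norm_conj]
      by_cases hx : x ∈ Ioo 0 R
      · have hxR : |x| ≤ |R| := by
          rw [abs_of_pos hx.1]
          exact hx.2.le.trans (le_abs_self R)
        calc _ = ‖g x‖ * (|besselEven α (x * y)| * ‖f y‖) := by rw [Real.norm_eq_abs]; ring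
          _ ≤ ‖g x‖ * (C * Real.exp (b * |x|) * ‖f y‖) := by
              exact mul_le_mul_of_nonneg_left (h f hfR x y) (norm_nonneg _)
          _ ≤ ‖g x‖ * (C * Real.exp (b * |R|) * ‖f y‖) := by gcongr
          _ = _ := by ring
      · simp [hgR x hx]
  have key := integral_inner_kernelOp (μ := halfLine) (k := fun l x => besselEven α (l * x))
    (fun x y => by rw [mul_comm]) hint
  rw [L2.inner_def, L2.inner_def]
  calc _ = ∫ x, inner 𝕜 (besselHankel α f x) (g x) ∂halfLine := by
        refine integral_congr_ae ?_
        filter_upwards [(memLp_besselHankel hα hf hfR).coeFn_toLp, hg.coeFn_toLp] with l h1 h2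
        rw [h1, h2]
    _ = ∫ x, inner 𝕜 (f x) (besselHankel α g x) ∂halfLine := key
    _ = _ := by
        refine integral_congr_ae ?_
        filter_upwards [(memLp_besselHankel hα hg hgR).coeFn_toLp, hf.coeFn_toLp] with l h1 h2
        rw [h1, h2]

end HankelCompact

/-! ### The Hankel transform on `L²(0, ∞)` -/

section Hankel

variable {α t R : ℝ} {𝕜 : Type*} [RCLike 𝕜] {f g f' g' : ℝ → 𝕜}

theorem memLp_indicator_Ioo (hf : MemLp f 2 halfLine) (R : ℝ) :
    MemLp ((Ioo 0 R).indicator f) 2 halfLine :=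
  hf.indicator measurableSet_Ioo

/-- The restriction of `f ∈ L²` to `(0, R)`. -/
def truncL2 (hf : MemLp f 2 halfLine) (R : ℝ) : Lp 𝕜 2 halfLine :=
  (memLp_indicator_Ioo hf R).toLp ((Ioo 0 R).indicator f)

theorem tendsto_truncL2 (hf : MemLp f 2 halfLine) :
    Tendsto (truncL2 hf) atTop (𝓝 (hf.toLp f)) := by
  rw [tendsto_iff_norm_sub_tendsto_zero]
  have hm : ∀ R : ℝ, MemLp ((Ioo 0 R).indicator f - f) 2 halfLine := fun R =>
    (memLp_indicator_Ioo hf R).sub hf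
  have e : ∀ R : ℝ, ‖truncL2 hf R - hf.toLp f‖ ^ 2 =
      ∫ x, ‖((Ioo 0 R).indicator f - f) x‖ ^ 2 ∂halfLine := by
    intro R
    rw [truncL2, ← MemLp.toLp_sub]
    refine RCLike.ofReal_injective (K := 𝕜) ?_
    rw [← integral_ofReal, RCLike.ofReal_pow, ← inner_self_eq_norm_sq_to_K, L2.inner_def]
    refine integral_congr_ae ?_
    filter_upwards [(hm R).coeFn_toLp] with x hx
    rw [hx, inner_self_eq_norm_sq_to_K, RCLike.ofReal_pow]
  have key : Tendsto (fun R : ℝ => ∫ x, ‖((Ioo 0 R).indicator f - f) x‖ ^ 2 ∂halfLine) atTop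
      (𝓝 (∫ _, 0 ∂halfLine)) := by
    refine tendsto_integral_filter_of_dominated_convergence (fun x => ‖f x‖ ^ 2)
      (Eventually.of_forall fun R => (hm R).1.norm.pow 2)
      (Eventually.of_forall fun R => Eventually.of_forall fun x => ?_)
      ((memLp_two_iff_integrable_sq_norm hf.1).1 hf) ?_
    · rw [Real.norm_of_nonneg (by positivity)]
      gcongr
      by_cases hx : x ∈ Ioo 0 R <;> simp [hx]
    · filter_upwards [ae_halfLine_pos] with x hx
      refine tendsto_const_nhds.congr' ?_
      filter_upwards [eventually_gt_atTop x] with R hR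
      simp [show x ∈ Ioo 0 R from ⟨hx, hR⟩]
  rw [integral_zero] at key
  simp_rw [← e] at key
  have h := key.sqrt
  simpa only [Real.sqrt_sq (norm_nonneg _), Real.sqrt_zero] using h

theorem indicator_Ioo_eq_zero (f : ℝ → 𝕜) (R : ℝ) :
    ∀ x, x ∉ Ioo 0 R → (Ioo 0 R).indicator f x = 0 :=
  fun _ hx => indicator_of_notMem hx f

theorem memLp_besselHankel_indicator (hα : -1 / 2 ≤ α) (hf : MemLp f 2 halfLine) (R : ℝ) :
    MemLp (besselHankel α ((Ioo 0 R).indicator f)) 2 halfLine :=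
  memLp_besselHankel hα (memLp_indicator_Ioo hf R) (indicator_Ioo_eq_zero f R)

/-- The Hankel transform of the restriction of `f ∈ L²` to `(0, R)`. -/
def hankelTruncL2 (hα : -1 / 2 ≤ α) (hf : MemLp f 2 halfLine) (R : ℝ) : Lp 𝕜 2 halfLine :=
  (memLp_besselHankel_indicator hα hf R).toLp (besselHankel α ((Ioo 0 R).indicator f))

theorem besselHankel_indicator_eq (f : ℝ → 𝕜) (R : ℝ) {l : ℝ} (hl : 0 < l) :
    besselHankel α ((Ioo 0 R).indicator f) l = ∫ x in Ioo 0 R, besselPsi α l x • f x := by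
  have e : ∀ x, besselEven α (l * x) • (Ioo 0 R).indicator f x =
      (Ioo 0 R).indicator (fun x => besselEven α (l * x) • f x) x := fun x => by
    by_cases hx : x ∈ Ioo 0 R <;> simp [hx]
  simp only [besselHankel, kernelOp, e, halfLine]
  rw [setIntegral_indicator measurableSet_Ioo, inter_eq_right.2 Ioo_subset_Ioi_self]
  refine setIntegral_congr_fun measurableSet_Ioo fun x hx => ?_
  rw [besselPsi_eq_besselEven hl hx.1]

theorem isHankelTransform_iff (hα : -1 / 2 ≤ α) (hf : MemLp f 2 halfLine)
    (hg : MemLp g 2 halfLine) :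
    IsHankelTransform α f g ↔
      Tendsto (hankelTruncL2 hα hf) atTop (𝓝 (hg.toLp g)) := by
  unfold hankelTruncL2
  rw [Lp.tendsto_Lp_iff_tendsto_eLpNorm'', IsHankelTransform, and_iff_right hg]
  refine tendsto_congr fun R => ?_
  rw [eLpNorm_sub_comm]
  refine eLpNorm_congr_ae ?_
  filter_upwards [ae_halfLine_pos] with l hl
  rw [Pi.sub_apply, besselHankel_indicator_eq f R hl]

theorem norm_toLp_besselHankel (hα : -1 / 2 ≤ α) (hf : MemLp f 2 halfLine)
    (hfR : ∀ x, x ∉ Ioo 0 R → f x = 0) :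
    ‖(memLp_besselHankel hα hf hfR).toLp _‖ = ‖hf.toLp f‖ := by
  rw [← sq_eq_sq₀ (norm_nonneg _) (norm_nonneg _), ← inner_self_eq_norm_sq (𝕜 := 𝕜),
    ← inner_self_eq_norm_sq (𝕜 := 𝕜), inner_besselHankel hα hf hfR hf hfR]

/-- The isometry applies to the difference of two truncations, which is supported in `(0, max R S)`.
Convergence of the truncations thus makes their transforms Cauchy. -/
theorem dist_hankelTruncL2 (hα : -1 / 2 ≤ α) (hf : MemLp f 2 halfLine) (R S : ℝ) :
    dist (hankelTruncL2 hα hf R) (hankelTruncL2 hα hf S) =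
      dist (truncL2 hf R) (truncL2 hf S) := by
  have hs : ∀ x, x ∉ Ioo 0 (max R S) →
      ((Ioo 0 R).indicator f - (Ioo 0 S).indicator f) x = 0 := by
    intro x hx
    rw [Pi.sub_apply, indicator_Ioo_eq_zero f R x fun h => hx ⟨h.1, h.2.trans_le (le_max_left _ _)⟩,
      indicator_Ioo_eq_zero f S x fun h => hx ⟨h.1, h.2.trans_le (le_max_right _ _)⟩, sub_zero]
  have hd := (memLp_indicator_Ioo hf R).sub (memLp_indicator_Ioo hf S)
  have e := besselHankel_sub hα (memLp_indicator_Ioo hf R) (indicator_Ioo_eq_zero f R)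
    (memLp_indicator_Ioo hf S) (indicator_Ioo_eq_zero f S)
  have h1 : hankelTruncL2 hα hf R - hankelTruncL2 hα hf S =
      (memLp_besselHankel hα hd hs).toLp _ := by
    rw [hankelTruncL2, hankelTruncL2, ← MemLp.toLp_sub]
    exact MemLp.toLp_congr _ _ (EventuallyEq.of_eq e.symm)
  have h2 : truncL2 hf R - truncL2 hf S = hd.toLp _ := by
    rw [truncL2, truncL2, ← MemLp.toLp_sub]
  rw [dist_eq_norm, dist_eq_norm, h1, h2, norm_toLp_besselHankel hα hd hs]

theorem exists_isHankelTransform (hα : -1 / 2 ≤ α) (hf : MemLp f 2 halfLine) :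
    ∃ g : ℝ → 𝕜, IsHankelTransform α f g := by
  have hc : CauchySeq (hankelTruncL2 hα hf) := by
    have := (tendsto_truncL2 hf).cauchySeq
    rw [Metric.cauchySeq_iff] at this ⊢
    simpa only [dist_hankelTruncL2] using this
  obtain ⟨u, hu⟩ := cauchySeq_tendsto_of_complete hc
  refine ⟨u, (isHankelTransform_iff hα hf (Lp.memLp u)).2 ?_⟩
  rwa [Lp.toLp_coeFn]

theorem IsHankelTransform.congr_right (h : IsHankelTransform α f g) (hg : g =ᵐ[halfLine] g') :
    IsHankelTransform α f g' := by
  refine ⟨(memLp_congr_ae hg).1 h.1, h.2.congr fun R => eLpNorm_congr_ae ?_⟩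
  filter_upwards [hg] with l hl
  rw [hl]

theorem memLp_exp_neg_mul_sq_smul (ht : 0 ≤ t) (hf : MemLp f 2 halfLine) :
    MemLp (fun l => Real.exp (-t * l ^ 2) • f l) 2 halfLine := by
  refine hf.of_le ((by fun_prop : Measurable fun l : ℝ =>
    Real.exp (-t * l ^ 2)).aestronglyMeasurable.smul hf.1) (Eventually.of_forall fun l => ?_)
  rw [norm_smul, Real.norm_of_nonneg (Real.exp_pos _).le]
  refine mul_le_of_le_one_left (norm_nonneg _) (Real.exp_le_one_iff.2 ?_)
  nlinarith [mul_nonneg ht (sq_nonneg l)]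

/-- Multiplication by `exp (-t l ^ 2)` on `L²(0, ∞)`. -/
def expMulL2 (𝕜 : Type*) [RCLike 𝕜] (ht : 0 ≤ t) : Lp 𝕜 2 halfLine →L[𝕜] Lp 𝕜 2 halfLine :=
  LinearMap.mkContinuous
    { toFun := fun u => (memLp_exp_neg_mul_sq_smul ht (Lp.memLp u)).toLp _
      map_add' := fun u v => by
        rw [← MemLp.toLp_add]
        refine MemLp.toLp_congr _ _ ?_
        filter_upwards [Lp.coeFn_add u v] with l hl
        rw [hl, Pi.add_apply, Pi.add_apply, smul_add]
      map_smul' := fun a u => by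
        rw [RingHom.id_apply, ← MemLp.toLp_const_smul]
        refine MemLp.toLp_congr _ _ ?_
        filter_upwards [Lp.coeFn_smul a u] with l hl
        rw [hl, Pi.smul_apply, Pi.smul_apply, smul_comm] } 1 fun u => by
    rw [one_mul]
    refine Lp.norm_le_norm_of_ae_le ?_
    filter_upwards [(memLp_exp_neg_mul_sq_smul ht (Lp.memLp u)).coeFn_toLp] with l hl
    simp only [LinearMap.coe_mk, AddHom.coe_mk]
    rw [hl, norm_smul, Real.norm_of_nonneg (Real.exp_pos _).le]
    refine mul_le_of_le_one_left (norm_nonneg _) (Real.exp_le_one_iff.2 ?_)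
    nlinarith [mul_nonneg ht (sq_nonneg l)]

theorem expMulL2_toLp (ht : 0 ≤ t) (hf : MemLp f 2 halfLine) :
    expMulL2 𝕜 ht (hf.toLp f) = (memLp_exp_neg_mul_sq_smul ht hf).toLp _ := by
  refine MemLp.toLp_congr (memLp_exp_neg_mul_sq_smul ht (Lp.memLp _)) _ ?_
  filter_upwards [hf.coeFn_toLp] with l hl
  rw [hl]

theorem inner_expMulL2_besselHankel (hα : -1 / 2 ≤ α) (ht : 0 ≤ t) (hf : MemLp f 2 halfLine)
    (hfR : ∀ x, x ∉ Ioo 0 R → f x = 0) (hg : MemLp g 2 halfLine)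
    (hgR : ∀ x, x ∉ Ioo 0 R → g x = 0) :
    inner 𝕜 (expMulL2 𝕜 ht ((memLp_besselHankel hα hf hfR).toLp _))
      ((memLp_besselHankel hα hg hgR).toLp _) =
      inner 𝕜 (heatL2 𝕜 α t (hf.toLp f)) (hg.toLp g) := by
  rcases ht.eq_or_lt with rfl | ht'
  · rw [expMulL2_toLp, heatL2, dif_neg (fun h => lt_irrefl _ h.2)]
    simp only [neg_zero, zero_mul, Real.exp_zero, one_smul, ContinuousLinearMap.coe_id', id_eq]
    exact inner_besselHankel hα hf hfR hg hgR
  · rw [← integral_exp_smul_inner_besselHankel hα ht' hf hfR hg hgR, expMulL2_toLp, L2.inner_def]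
    refine integral_congr_ae ?_
    filter_upwards [(memLp_exp_neg_mul_sq_smul ht (memLp_besselHankel hα hf hfR)).coeFn_toLp,
      (memLp_besselHankel hα hg hgR).coeFn_toLp] with l h1 h2
    rw [h1, h2, RCLike.inner_apply, RCLike.inner_apply, RCLike.real_smul_eq_coe_mul,
      RCLike.real_smul_eq_coe_mul, map_mul, RCLike.conj_ofReal]
    ring

theorem inner_expMulL2_hankelTruncL2 (hα : -1 / 2 ≤ α) (ht : 0 ≤ t) (hf : MemLp f 2 halfLine)
    (hg : MemLp g 2 halfLine) (R : ℝ) :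
    inner 𝕜 (expMulL2 𝕜 ht (hankelTruncL2 hα hf R)) (hankelTruncL2 hα hg R) =
      inner 𝕜 (heatL2 𝕜 α t (truncL2 hf R)) (truncL2 hg R) := by
  have h := inner_expMulL2_besselHankel hα ht (memLp_indicator_Ioo hf R)
    (indicator_Ioo_eq_zero f R) (memLp_indicator_Ioo hg R) (indicator_Ioo_eq_zero g R)
  unfold hankelTruncL2 truncL2
  exact h

theorem inner_hankelTruncL2_comm (hα : -1 / 2 ≤ α) (hf : MemLp f 2 halfLine)
    (hg : MemLp g 2 halfLine) (R : ℝ) :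
    inner 𝕜 (hankelTruncL2 hα hf R) (truncL2 hg R) =
      inner 𝕜 (truncL2 hf R) (hankelTruncL2 hα hg R) := by
  have h := inner_besselHankel_comm hα (memLp_indicator_Ioo hf R)
    (indicator_Ioo_eq_zero f R) (memLp_indicator_Ioo hg R) (indicator_Ioo_eq_zero g R)
  unfold hankelTruncL2 truncL2
  exact h

/-- The limit `R → ∞` of the identity for truncations, both operators being bounded on `L²`. -/
theorem IsHankelTransform.inner_expMulL2 (hα : -1 / 2 ≤ α) (ht : 0 ≤ t) (hf : MemLp f 2 halfLine)
    (hf' : MemLp f' 2 halfLine) (h : IsHankelTransform α f g) (h' : IsHankelTransform α f' g') :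
    inner 𝕜 (expMulL2 𝕜 ht (h.1.toLp g)) (h'.1.toLp g') =
      inner 𝕜 (heatL2 𝕜 α t (hf.toLp f)) (hf'.toLp f') := by
  have h1 : Tendsto (fun R => expMulL2 𝕜 ht (hankelTruncL2 hα hf R)) atTop _ :=
    ((expMulL2 𝕜 ht).continuous.tendsto _).comp ((isHankelTransform_iff hα hf h.1).1 h)
  have h2 := (isHankelTransform_iff hα hf' h'.1).1 h'
  have h3 : Tendsto (fun R => heatL2 𝕜 α t (truncL2 hf R)) atTop _ :=
    ((heatL2 𝕜 α t).continuous.tendsto _).comp (tendsto_truncL2 hf)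
  have h4 := tendsto_truncL2 hf'
  have h5 := h1.inner (𝕜 := 𝕜) h2
  have h6 := h3.inner (𝕜 := 𝕜) h4
  simp_rw [inner_expMulL2_hankelTruncL2] at h5
  exact tendsto_nhds_unique h5 h6

theorem IsHankelTransform.inner_comm (hα : -1 / 2 ≤ α) (hf : MemLp f 2 halfLine)
    (hf' : MemLp f' 2 halfLine) (h : IsHankelTransform α f g) (h' : IsHankelTransform α f' g') :
    inner 𝕜 (h.1.toLp g) (hf'.toLp f') = inner 𝕜 (hf.toLp f) (h'.1.toLp g') := by
  have h1 := ((isHankelTransform_iff hα hf h.1).1 h).inner (𝕜 := 𝕜) (tendsto_truncL2 hf')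
  have h2 := (tendsto_truncL2 hf).inner (𝕜 := 𝕜) ((isHankelTransform_iff hα hf' h'.1).1 h')
  simp_rw [inner_hankelTruncL2_comm] at h1
  exact tendsto_nhds_unique h1 h2

theorem isHankelHeat_besselSemigroup (hα : -1 / 2 ≤ α) (ht : 0 ≤ t) (hf : MemLp f 2 halfLine) :
    IsHankelHeat α t f (besselSemigroup α t f) := by
  obtain ⟨g, hg⟩ := exists_isHankelTransform hα hf
  have hm := memLp_exp_neg_mul_sq_smul ht hg.1
  obtain ⟨h, hh⟩ := exists_isHankelTransform hα hm
  refine ⟨g, hg, hh.congr_right ?_⟩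
  have key : hh.1.toLp h = heatL2 𝕜 α t (hf.toLp f) := by
    -- Tested against `v`: `⟨𝓗 e^(-t l²) 𝓗 f, v⟩ = ⟨e^(-t l²) 𝓗 f, 𝓗 v⟩ = ⟨T_t f, v⟩`. The inversion
    -- `𝓗² = 1` is not needed; it is the case `t = 0`.
    refine ext_inner_right 𝕜 fun v => ?_
    obtain ⟨g', hg'⟩ := exists_isHankelTransform hα (Lp.memLp v)
    have h1 := hh.inner_comm hα hm (Lp.memLp v) hg'
    have h2 := hg.inner_expMulL2 hα ht hf (Lp.memLp v) hg'
    rw [Lp.toLp_coeFn] at h1 h2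
    rw [h1, ← h2, expMulL2_toLp]
  exact hh.1.coeFn_toLp.symm.trans (key ▸ coeFn_heatL2_toLp hα ht hf)

end Hankel

/-! ### Contractivity, positivity and conservativity -/

/-- Without cancellation, Tonelli and symmetry give the `L¹` norm exactly as the integral of `F`
against `T 1`. An input supported where `T 1 > 1` therefore has its norm increased. -/
theorem eLpNorm_one_kernelOp {X 𝕜 : Type*} [MeasurableSpace X] [RCLike 𝕜] {μ : Measure X}
    [SFinite μ] {k : X → X → ℝ} (hk : Measurable (Function.uncurry k))
    (hs : ∀ x y, k x y = k y x) (h0 : ∀ x y, 0 ≤ k x y) {F : X → ℝ} (hF : Measurable F)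
    (hF0 : ∀ x, 0 ≤ F x) (hi : ∀ᵐ x ∂μ, Integrable (fun y => k x y * F y) μ) :
    eLpNorm (kernelOp μ k fun y => (F y : 𝕜)) 1 μ =
      ∫⁻ y, (∫⁻ x, ‖k y x‖ₑ ∂μ) * ‖F y‖ₑ ∂μ := by
  have h1 : ∀ᵐ x ∂μ, ‖kernelOp μ k (fun y => (F y : 𝕜)) x‖ₑ = ∫⁻ y, ‖k x y‖ₑ * ‖F y‖ₑ ∂μ := by
    filter_upwards [hi] with x hx
    have e : kernelOp μ k (fun y => (F y : 𝕜)) x = ((∫ y, k x y * F y ∂μ : ℝ) : 𝕜) := by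
      rw [kernelOp, ← integral_ofReal]
      simp only [RCLike.real_smul_eq_coe_mul, RCLike.ofReal_mul]
    have hn : ∀ y, 0 ≤ k x y * F y := fun y => mul_nonneg (h0 x y) (hF0 y)
    rw [e, ← ofReal_norm, RCLike.norm_ofReal, abs_of_nonneg (integral_nonneg hn),
      ofReal_integral_eq_lintegral_ofReal hx (Eventually.of_forall hn)]
    refine lintegral_congr fun y => ?_
    rw [← enorm_mul, Real.enorm_of_nonneg (hn y)]
  have hm : AEMeasurable (Function.uncurry fun x y => ‖k x y‖ₑ * ‖F y‖ₑ) (μ.prod μ) :=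
    hk.enorm.aemeasurable.mul (hF.comp measurable_snd).enorm.aemeasurable
  rw [eLpNorm_one_eq_lintegral_enorm, lintegral_congr_ae h1, lintegral_lintegral_swap hm]
  refine lintegral_congr fun y => ?_
  simp_rw [hs _ y]
  have hky : Measurable (k y) := hk.comp measurable_prodMk_left
  exact lintegral_mul_const _ hky.enorm

section Semigroup

variable {α t : ℝ} {𝕜 : Type*} [RCLike 𝕜]

theorem besselSemigroup_one (hα : -1 / 2 ≤ α) (ht : 0 < t) {x : ℝ} (hx : 0 < x) :
    besselSemigroup α t (fun _ => (1 : 𝕜)) x =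
      ((auxH (α / 2 + 3 / 4) (α + 1) (x ^ 2 / (4 * t)) : ℝ) : 𝕜) := by
  rw [besselSemigroup_eq_kernelOp hα ht _ hx, kernelOp, ← integral_besselHeatKernel hα ht hx,
    ← integral_ofReal]
  simp only [RCLike.real_smul_eq_coe_mul, mul_one]
  rfl

theorem integrable_besselKernel_smul (hα : -1 / 2 ≤ α) (ht : 0 < t) {f : ℝ → 𝕜}
    (hf : MemL1AddLinfty halfLine f) {x : ℝ} (hx : 0 < x) :
    Integrable (fun y => besselKernel α t x y • f y) halfLine := by
  refine (integrable_besselHeatKernel_smul hα ht hf hx).congr ?_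
  filter_upwards [ae_halfLine_pos] with y hy
  rw [besselKernel_eq hα ht hx hy]

theorem besselSemigroup_nonneg (hα : -1 / 2 ≤ α) (ht : 0 ≤ t) {f : ℝ → 𝕜}
    (hf : ∀ᵐ x ∂halfLine, 0 ≤ f x) : ∀ᵐ x ∂halfLine, 0 ≤ besselSemigroup α t f x := by
  rcases ht.eq_or_lt with rfl | ht
  · rwa [besselSemigroup_zero]
  filter_upwards [besselSemigroup_ae_eq hα ht f] with x hx
  -- In the order on `𝕜` a nonnegative value is real, so `f` may be replaced by its real part.
  have e : kernelOp halfLine (besselHeatKernel α t) f x =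
      ((∫ y, besselHeatKernel α t x y * RCLike.re (f y) ∂halfLine : ℝ) : 𝕜) := by
    rw [kernelOp, ← integral_ofReal]
    refine integral_congr_ae ?_
    filter_upwards [hf] with y hy
    rw [RCLike.real_smul_eq_coe_mul, RCLike.ofReal_mul]
    congr 1
    have := RCLike.nonneg_iff.1 hy
    refine RCLike.ext ?_ ?_ <;> simp [this.2]
  rw [hx, e, RCLike.ofReal_nonneg]
  refine integral_nonneg_of_ae ?_
  filter_upwards [hf] with y hy
  exact mul_nonneg (besselHeatKernel_nonneg hα ht x y) (RCLike.nonneg_iff.1 hy).1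

theorem integral_inner_besselSemigroup (hα : -1 / 2 ≤ α) (ht : 0 ≤ t) {f g : ℝ → 𝕜}
    (hf : MemLp f 2 halfLine) (hg : MemLp g 2 halfLine) :
    ∫ x, inner 𝕜 (besselSemigroup α t f x) (g x) ∂halfLine =
      ∫ x, inner 𝕜 (f x) (besselSemigroup α t g x) ∂halfLine := by
  rcases ht.eq_or_lt with rfl | ht
  · simp only [besselSemigroup_zero]
  obtain ⟨c, -, hc⟩ := exists_auxH_bessel_le hα
  have h := integral_inner_kernelOp besselHeatKernel_comm
    (integrable_kernel_smul_mul_conj (measurable_besselHeatKernel hα t) besselHeatKernel_comm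
      (ae_lintegral_besselHeatKernel_le hα hc ht) ENNReal.ofReal_ne_top hf hg)
  refine (integral_congr_ae ?_).trans (h.trans (integral_congr_ae ?_))
  · filter_upwards [besselSemigroup_ae_eq hα ht f] with x hx
    rw [hx]
  · filter_upwards [besselSemigroup_ae_eq hα ht g] with x hx
    rw [hx]

theorem isSymmetricDiffusionSemigroup_besselSemigroup (hα : -1 / 2 ≤ α)
    (hle : ∀ u, 0 < u → auxH (α / 2 + 3 / 4) (α + 1) u ≤ 1) :
    IsSymmetricDiffusionSemigroup halfLine (besselSemigroup (𝕜 := 𝕜) α) where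
  measurable t ht f hf := by
    rcases ht.eq_or_lt with rfl | ht
    · rw [besselSemigroup_zero]
      exact hf.aestronglyMeasurable
    · exact (aestronglyMeasurable_kernelOp (measurable_besselHeatKernel hα t)
        hf.aestronglyMeasurable).congr (besselSemigroup_ae_eq hα ht f).symm
  congr t ht f g _ _ h := besselSemigroup_congr_ae hα ht h
  map_add t ht f g hf hg := by
    rcases ht.eq_or_lt with rfl | ht
    · simp only [besselSemigroup_zero]
      rfl
    · exact (besselSemigroup_ae_eq hα ht _).trans ((kernelOp_besselHeatKernel_add hα ht hf hg).trans
        ((besselSemigroup_ae_eq hα ht f).add (besselSemigroup_ae_eq hα ht g)).symm)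
  map_smul t ht a f hf := by
    rcases ht.eq_or_lt with rfl | ht
    · simp only [besselSemigroup_zero]
      rfl
    · refine (besselSemigroup_ae_eq hα ht _).trans ?_
      rw [kernelOp_smul]
      exact ((besselSemigroup_ae_eq hα ht f).const_smul a).symm
  map_zero_time f _ := by rw [besselSemigroup_zero]
  contraction t ht p hp f hf := by
    rcases ht.eq_or_lt with rfl | ht
    · rw [besselSemigroup_zero]
      exact ⟨hf, le_rfl⟩
    · have h := memLp_besselSemigroup hα hle ht hp hf
      rwa [ENNReal.ofReal_one, one_mul] at h
  semigroup s t hs ht p hp f hf := besselSemigroup_add_time hα hs ht (hf.memL1AddLinfty hp)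
  self_adjoint t ht f g hf hg := integral_inner_besselSemigroup hα ht hf hg
  tendsto_zero f hf := tendsto_eLpNorm_besselSemigroup hα hf

theorem isSubmarkovianSemigroup_besselSemigroup (hα : -1 / 2 ≤ α)
    (hle : ∀ u, 0 < u → auxH (α / 2 + 3 / 4) (α + 1) u ≤ 1) :
    IsSubmarkovianSemigroup halfLine (besselSemigroup (𝕜 := 𝕜) α) where
  toIsSymmetricDiffusionSemigroup := isSymmetricDiffusionSemigroup_besselSemigroup hα hle
  positive t ht f _ h := besselSemigroup_nonneg hα ht h
  subconservative t ht := by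
    rcases ht.eq_or_lt with rfl | ht
    · rw [besselSemigroup_zero]
      exact Eventually.of_forall fun _ => le_rfl
    filter_upwards [ae_halfLine_pos] with x hx
    have hx : 0 < x := hx
    rw [besselSemigroup_one hα ht hx, ← RCLike.ofReal_one (K := 𝕜), RCLike.ofReal_le_ofReal]
    exact hle _ (by positivity)

theorem isMarkovianSemigroup_besselSemigroup_neg_half :
    IsMarkovianSemigroup halfLine (besselSemigroup (𝕜 := 𝕜) (-1 / 2)) where
  toIsSymmetricDiffusionSemigroup := isSymmetricDiffusionSemigroup_besselSemigroup le_rfl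
    fun _ hu => (auxH_bessel_neg_half hu).le
  positive t ht f _ h := besselSemigroup_nonneg le_rfl ht h
  conservative t ht := by
    rcases ht.eq_or_lt with rfl | ht
    · rw [besselSemigroup_zero]
      exact Eventually.of_forall fun _ => rfl
    filter_upwards [ae_halfLine_pos] with x hx
    have hx : 0 < x := hx
    rw [besselSemigroup_one le_rfl ht hx, auxH_bessel_neg_half (by positivity), RCLike.ofReal_one]

theorem not_isMarkovianSemigroup_besselSemigroup (hα : 1 / 2 ≤ α) :
    ¬ IsMarkovianSemigroup halfLine (besselSemigroup (𝕜 := 𝕜) α) := by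
  intro h
  -- The measure is nonzero, so the two almost everywhere statements hold together at some point.
  have : NeZero halfLine := ⟨by
    rw [halfLine, Ne, Measure.restrict_eq_zero]
    simp⟩
  obtain ⟨x, hx, h1⟩ := (ae_halfLine_pos.and (h.conservative 1 zero_le_one)).exists
  rw [besselSemigroup_one (by linarith) one_pos hx, ← RCLike.ofReal_one (K := 𝕜), RCLike.ofReal_inj] at h1
  exact (auxH_bessel_lt_one hα (by positivity)).ne h1

theorem not_isLpContractive_besselSemigroup (hα : -1 / 2 < α) (hα' : α < 1 / 2) :
    ¬ IsLpContractive halfLine (besselSemigroup (𝕜 := 𝕜) α) := by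
  intro h
  obtain ⟨u₀, hu₀, hu⟩ := exists_one_lt_auxH (η := α / 2 + 3 / 4) (δ := α / 2 + 1 / 4)
    (by linarith) (by linarith) (by linarith)
  rw [show α / 2 + 3 / 4 + (α / 2 + 1 / 4) = α + 1 by ring] at hu
  -- Chosen so that, at `t = 1`, `x²/4 ≥ u₀` for `x ≥ a`; hence `T_1 1 > 1` on all of `(a, a+1)`.
  set a := 2 * √u₀
  have ha : 0 ≤ a := by positivity
  have ha2 : a ^ 2 = 4 * u₀ := by
    rw [mul_pow, Real.sq_sqrt hu₀.le]
    norm_num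
  let s := Ioo a (a + 1)
  have hs : MeasurableSet s := measurableSet_Ioo
  have hμs : halfLine s = 1 := by
    have hs0 : s ⊆ Ioi 0 := fun x hx => ha.trans_lt hx.1
    rw [halfLine, Measure.restrict_apply hs, inter_eq_left.2 hs0, Real.volume_Ioo]
    simp
  -- Contractivity is tested only on `L² ∩ L^p`, which excludes the constant `1`; an indicator with
  -- `p = 1` is admissible and sees `T_1 1` by duality.
  let F : ℝ → ℝ := s.indicator fun _ => 1
  have hF : Measurable F := measurable_const.indicator hs
  have hFm : ∀ p, MemLp (fun x => (F x : 𝕜)) p halfLine := fun p =>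
    (memLp_indicator_const p hs 1 (Or.inr (by simp [hμs]))).ofReal
  have hk := measurable_besselHeatKernel hα.le 1
  have hi : ∀ᵐ x ∂halfLine, Integrable (fun y => besselHeatKernel α 1 x y * F y) halfLine := by
    filter_upwards [ae_halfLine_pos] with x hx
    have h2 := integrable_besselHeatKernel_smul hα.le one_pos ((hFm 1).memL1AddLinfty le_rfl) hx
    simpa [RCLike.real_smul_eq_coe_mul] using h2.re
  have hle := h 1 le_rfl 1 zero_le_one _ (hFm 2) (hFm 1)
  have hG : Measurable fun y => ∫⁻ x, ‖besselHeatKernel α 1 y x‖ₑ ∂halfLine :=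
    hk.enorm.lintegral_prod_right'
  rw [eLpNorm_congr_ae (besselSemigroup_ae_eq hα.le one_pos _),
    eLpNorm_one_kernelOp hk besselHeatKernel_comm (besselHeatKernel_nonneg hα.le one_pos) hF
      (indicator_nonneg fun _ _ => zero_le_one) hi, eLpNorm_one_eq_lintegral_enorm] at hle
  have e1 : ∀ y, (∫⁻ x, ‖besselHeatKernel α 1 y x‖ₑ ∂halfLine) * ‖F y‖ₑ =
      s.indicator (fun y => ∫⁻ x, ‖besselHeatKernel α 1 y x‖ₑ ∂halfLine) y := by
    intro y
    by_cases hy : y ∈ s <;> simp [F, hy]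
  have e2 : ∀ y, ‖(F y : 𝕜)‖ₑ = s.indicator (fun _ => 1) y := by
    intro y
    by_cases hy : y ∈ s <;> simp [F, hy]
  simp_rw [e1, e2] at hle
  rw [lintegral_indicator hs, lintegral_indicator hs] at hle
  refine absurd hle (not_le.2 ?_)
  refine setLIntegral_strict_mono hs (by simp [hμs]) hG (by simp [hμs])
    (Eventually.of_forall fun y hy => ?_)
  have hy0 : 0 < y := ha.trans_lt hy.1
  rw [lintegral_besselHeatKernel hα.le one_pos hy0, ENNReal.one_lt_ofReal]
  refine hu _ ?_
  have := pow_le_pow_left₀ ha hy.1.le 2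
  linarith

end Semigroup
end

/-! ### The proposition -/

theorem mainTheorem8 {𝕜 : Type*} [RCLike 𝕜] (α : ℝ) (hα : -1 / 2 ≤ α) :
    -- the integral operators are defined on `L¹ + L^∞`, at every point
    (∀ t : ℝ, 0 < t → ∀ f : ℝ → 𝕜, MemL1AddLinfty halfLine f → ∀ x : ℝ, 0 < x →
      Integrable (fun y => besselKernel α t x y • f y) halfLine) ∧
    -- and on `L²` they are the heat semigroup defined through the Hankel transform
    (∀ t : ℝ, 0 ≤ t → ∀ f : ℝ → 𝕜, MemLp f 2 halfLine →
      IsHankelHeat α t f (besselSemigroup α t f)) ∧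
    -- the value on the constant function one
    (∀ t : ℝ, 0 < t → ∀ x : ℝ, 0 < x →
      besselSemigroup α t (fun _ => (1 : 𝕜)) x =
        ((auxH (α / 2 + 3 / 4) (α + 1) (x ^ 2 / (4 * t)) : ℝ) : 𝕜)) ∧
    ((α = -1 / 2 ∨ 1 / 2 ≤ α) →
      IsSubmarkovianSemigroup halfLine (besselSemigroup (𝕜 := 𝕜) α) ∧
      (IsMarkovianSemigroup halfLine (besselSemigroup (𝕜 := 𝕜) α) ↔ α = -1 / 2)) ∧
    ((-1 / 2 < α ∧ α < 1 / 2) →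
      ¬ IsLpContractive halfLine (besselSemigroup (𝕜 := 𝕜) α) ∧
      ∃ c : ℝ, 1 < c ∧ ∀ p : ℝ≥0∞, 1 ≤ p → ∀ t : ℝ, 0 < t → ∀ f : ℝ → 𝕜,
        MemLp f p halfLine →
        MemLp (besselSemigroup α t f) p halfLine ∧
        eLpNorm (besselSemigroup α t f) p halfLine ≤
          ENNReal.ofReal c * eLpNorm f p halfLine) := by
  refine ⟨fun t ht f hf x hx => integrable_besselKernel_smul hα ht hf hx,
    fun t ht f hf => isHankelHeat_besselSemigroup hα ht hf,
    fun t ht x hx => besselSemigroup_one hα ht hx, fun h => ?_, fun h => ?_⟩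
  · rcases h with rfl | h
    · exact ⟨isSubmarkovianSemigroup_besselSemigroup le_rfl fun _ hu =>
        (auxH_bessel_neg_half hu).le, iff_of_true isMarkovianSemigroup_besselSemigroup_neg_half rfl⟩
    · exact ⟨isSubmarkovianSemigroup_besselSemigroup hα fun _ hu => (auxH_bessel_lt_one h hu).le,
        iff_of_false (not_isMarkovianSemigroup_besselSemigroup h) (by linarith)⟩
  · obtain ⟨c, hc1, hc⟩ := exists_auxH_bessel_le hα
    exact ⟨not_isLpContractive_besselSemigroup h.1 h.2, c, hc1, fun p hp t ht f hf =>
      memLp_besselSemigroup hα hc ht hp hf⟩
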